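/- Let $\mathfrak t$ be a plane tree with at least one inner vertex, all of whose inner (non-leaf) vertices have degree $3$, with two distinct marked leaves, the entrance and the exit. Let $\mathsf V(\mathfrak t)$ be its set of inner vertices. To every oriented edge $\vec{\mathsf e}$ starting at an inner vertex assign an angle $\varphi(\vec{\mathsf e})$, and let $\mathcal A_{\mathfrak t}$ be the polytope of all assignments with $\varphi(\vec{\mathsf e})>0$, with the three angles at each inner vertex adding up to $\pi$, and with $\varphi(\vec{\mathsf e})+\varphi(\overleftarrow{\mathsf e})>\pi$ for each edge $\mathsf e$ joining two inner vertices. Equip it with the measure $\operatorname{Vol}_{\mathfrak t}=2^{|\mathsf V(\mathfrak t)|}\prod_{\mathsf v\in\mathsf V(\mathfrak t)}\mathrm d\varphi(\vec{\mathsf e}_{\mathsf v,1})\,\mathrm d\varphi(\vec{\mathsf e}_{\mathsf v,2})$, where $\vec{\mathsf e}_{\mathsf v,1},\vec{\mathsf e}_{\mathsf v,2}$ are two of the three oriented edges starting at $\mathsf v$. Let $$E_{\mathfrak t}(u)=\int_{\mathcal A_{\mathfrak t}}\prod_{\mathsf v}\left(\frac{\sin\varphi(\vec{\mathsf e}^{\,\mathrm{in}}_{\mathsf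 v})}{\sin\varphi(\vec{\mathsf e}^{\,\mathrm{out}}_{\mathsf v})}\right)^{2u}\mathrm d\operatorname{Vol}_{\mathfrak t},$$ where $\mathsf v$ runs over the inner vertices on the path from the entrance to the exit, and $\vec{\mathsf e}^{\,\mathrm{in}}_{\mathsf v}$, $\vec{\mathsf e}^{\,\mathrm{out}}_{\mathsf v}$ are the edges of this path at $\mathsf v$ on the side of the entrance and of the exit, both oriented away from $\mathsf v$. Define the formal power series in $r$ $$\hat X_{\mathrm A}(u,r)=\sum_{\mathfrak t}(-1)^{|\mathsf V(\mathfrak t)|-1}r^{|\mathsf V(\mathfrak t)|}E_{\mathfrak t}(u),$$ the sum being over all such trees with marked entrance and exit. **Proposition.** Let $u\in(-\tfrac12,\tfrac12)$. Each integral $E_{\mathfrak t}(u)$ converges absolutely, $E_{\mathfrak t}$ is real-analytic at $u$, and, as formal power series in $r$, $$\hat X_{\mathrm A}(u,r)=1-\frac{2\pi u}{\sin(2\pi u)}\sum_{p=0}^\infty\frac{u^{2p}}{(2p+1)!!}\,\frac{\partial^{p+1}}{\partial r^{p+1}}\left[\frac{\sqrt r}{\sqrt2\,\pi}J_1(2\pi\sqrt{2r})\right],$$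 where $\frac{2\pi u}{\sin(2\pi u)}$ is read as $1$ at $u=0$, the bracket is the power series $\sum_{d\ge1}\frac{(-1)^{d-1}(2\pi^2)^{d-1}}{(d-1)!\,d!}r^d$, and the sum over $p$ converges coefficientwise in $r$. -/

import Mathlib

open scoped PowerSeries.WithPiTopology

noncomputable section

namespace AntiDelaunay

/-! Combinatorics. A plane tree all of whose inner vertices have degree three, with a marked
entrance leaf, is the same thing as a binary tree `t : BinaryTree Unit` rooted at the entrance
leaf: `node`s are the inner vertices and `nil`s are the leaves other than the entrance. The three
edges at an inner vertex are numbered in cyclic order: `0` is the edge on the side of the entrance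
leaf, `1` leads to the left subtree and `2` leads to the right subtree. -/

/-- The inner vertices of the tree. -/
inductive Vertex : BinaryTree Unit → Type
  | top {a : Unit} {l r : BinaryTree Unit} : Vertex (.node a l r)
  | inLeft {a : Unit} {l r : BinaryTree Unit} (v : Vertex l) : Vertex (.node a l r)
  | inRight {a : Unit} {l r : BinaryTree Unit} (v : Vertex r) : Vertex (.node a l r)

/-- The leaves of the tree other than the entrance leaf, that is, the candidates for the
exit leaf. -/
inductive Leaf : BinaryTree Unit → Type
  | here : Leaf .nil
  | inLeft {a : Unit} {l r : BinaryTree Unit} (x : Leaf l) : Leaf (.node a l r)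
  | inRight {a : Unit} {l r : BinaryTree Unit} (x : Leaf r) : Leaf (.node a l r)

instance Vertex.isEmpty_nil : IsEmpty (Vertex .nil) := ⟨fun v => nomatch v⟩

/-- The inner vertices of a nonempty tree: the topmost one and those of the two subtrees. -/
def Vertex.nodeEquiv (a : Unit) (l r : BinaryTree Unit) :
    Vertex (.node a l r) ≃ Unit ⊕ (Vertex l ⊕ Vertex r) where
  toFun v := match v with
    | .top => .inl ()
    | .inLeft v => .inr (.inl v)
    | .inRight v => .inr (.inr v)
  invFun s := match s with
    | .inl _ => .top
    | .inr (.inl v) => .inLeft v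
    | .inr (.inr v) => .inRight v
  left_inv v := by cases v <;> rfl
  right_inv s := by rcases s with _ | _ | _ <;> rfl

/-- The leaves of a nonempty tree: those of the two subtrees. -/
def Leaf.nodeEquiv (a : Unit) (l r : BinaryTree Unit) :
    Leaf (.node a l r) ≃ Leaf l ⊕ Leaf r where
  toFun x := match x with
    | .inLeft x => .inl x
    | .inRight x => .inr x
  invFun s := match s with
    | .inl x => .inLeft x
    | .inr x => .inRight x
  left_inv x := by cases x <;> rfl
  right_inv s := by rcases s with _ | _ <;> rfl

instance Vertex.fintype : (t : BinaryTree Unit) → Fintype (Vertex t)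
  | .nil => Fintype.ofIsEmpty
  | .node a l r =>
    haveI := Vertex.fintype l
    haveI := Vertex.fintype r
    Fintype.ofEquiv _ (Vertex.nodeEquiv a l r).symm

instance Leaf.fintype : (t : BinaryTree Unit) → Fintype (Leaf t)
  | .nil => ⟨{.here}, fun x => by cases x; simp⟩
  | .node a l r =>
    haveI := Leaf.fintype l
    haveI := Leaf.fintype r
    Fintype.ofEquiv _ (Leaf.nodeEquiv a l r).symm

/-- The inner vertex next to the entrance leaf, if there is one. -/
def topVertex : (t : BinaryTree Unit) → Option (Vertex t)
  | .nil => none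
  | .node _ _ _ => some .top

/-- `IsInnerEdge v i w`: the edge number `i` at `v`, pointing away from the entrance leaf
(so `i = 1` or `i = 2`), leads to the inner vertex `w`. Hence the edge is the edge number `i` of
`v` and the edge number `0` of `w`. -/
inductive IsInnerEdge : {t : BinaryTree Unit} → Vertex t → Fin 3 → Vertex t → Prop
  | topLeft {a : Unit} {l r : BinaryTree Unit} (w : Vertex l) (h : topVertex l = some w) :
      IsInnerEdge (t := .node a l r) .top 1 (.inLeft w)
  | topRight {a : Unit} {l r : BinaryTree Unit} (w : Vertex r) (h : topVertex r = some w) :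
      IsInnerEdge (t := .node a l r) .top 2 (.inRight w)
  | inLeft {a : Unit} {l r : BinaryTree Unit} (v w : Vertex l) (i : Fin 3)
      (h : IsInnerEdge v i w) : IsInnerEdge (t := .node a l r) (.inLeft v) i (.inLeft w)
  | inRight {a : Unit} {l r : BinaryTree Unit} (v w : Vertex r) (i : Fin 3)
      (h : IsInnerEdge v i w) : IsInnerEdge (t := .node a l r) (.inRight v) i (.inRight w)

/-- If `v` lies on the path from the entrance leaf to the exit leaf `x`, the number of the edge
through which this path leaves `v` (it enters `v` through the edge `0`); `none` otherwise. -/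
def exitEdge : {t : BinaryTree Unit} → Leaf t → Vertex t → Option (Fin 3)
  | _, .inLeft _, .top => some 1
  | _, .inLeft x, .inLeft v => exitEdge x v
  | _, .inLeft _, .inRight _ => none
  | _, .inRight _, .top => some 2
  | _, .inRight _, .inLeft _ => none
  | _, .inRight x, .inRight v => exitEdge x v

/-! Angle polytope. `φ v i` is the angle assigned to the edge number `i` at `v`, oriented away
from `v`; edges oriented away from a leaf have angle zero. -/

/-- The polytope of an anti-Delaunay vertex with subtree `t`: positive angles that add up to `π`
at each inner vertex, and whose sum over the two orientations of each edge between two inner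
vertices exceeds `π`. -/
def polytope (t : BinaryTree Unit) : Set (Vertex t → Fin 3 → ℝ) :=
  {φ | (∀ v i, 0 < φ v i) ∧ (∀ v, φ v 0 + φ v 1 + φ v 2 = Real.pi) ∧
    ∀ v i w, IsInnerEdge v i w → Real.pi < φ v i + φ w 0}

/-- The angle assignment with sum `π` at each vertex with given angles number `1` and `2`. -/
def anglesOfPair (t : BinaryTree Unit) (y : Vertex t → ℝ × ℝ) : Vertex t → Fin 3 → ℝ :=
  fun v => ![Real.pi - (y v).1 - (y v).2, (y v).1, (y v).2]

/-- The volume measure `2 ^ |V| ∏ dφ(v,1) dφ(v,2)` on the affine subspace of angle assignments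
with sum `π` at each vertex. -/
def vol (t : BinaryTree Unit) : MeasureTheory.Measure (Vertex t → Fin 3 → ℝ) :=
  (2 : ENNReal) ^ t.numNodes •
    MeasureTheory.Measure.map (anglesOfPair t) MeasureTheory.volume

/-- The difference of the edge distances of the entrance edge and of the exit edge: each vertex
on the path contributes `log sin` of the angle of the edge by which the path enters minus
`log sin` of the angle of the edge by which it leaves. -/
def distDiff {t : BinaryTree Unit} (x : Leaf t) (φ : Vertex t → Fin 3 → ℝ) : ℝ :=
  ∑ v, match exitEdge x v with
    | none => 0
    | some i => Real.log (Real.sin (φ v 0)) - Real.log (Real.sin (φ v i))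

/-- The weight `E_t(u)` of the tree `t` with exit leaf `x`. -/
def treeWeight {t : BinaryTree Unit} (x : Leaf t) (u : ℝ) : ℝ :=
  ∫ φ in polytope t, Real.exp (2 * u * distDiff x φ) ∂(vol t)

/-- The generating function `X̂_A(u, r)` as a formal power series in `r`: the sum of
`(-1) ^ (|V| - 1) r ^ |V| E_t(u)` over all plane binary trees with at least one inner vertex and
with a marked entrance leaf and a marked exit leaf. -/
def XA (u : ℝ) : PowerSeries ℝ :=
  PowerSeries.mk fun n =>
    if n = 0 then 0
    else ∑ t ∈ BinaryTree.treesOfNumNodesEq n, ∑ x : Leaf t, (-1) ^ (n - 1) * treeWeight x u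

/-! Bessel function. -/

/-- The Bessel function of the first kind `J_k` of order `k : ℕ`. -/
def besselJ (k : ℕ) (z : ℝ) : ℝ :=
  ∑' m : ℕ, (-1) ^ m / ((m.factorial : ℝ) * ((m + k).factorial : ℝ)) * (z / 2) ^ (2 * m + k)

/-- The formal power series in `r` of `√r / (√2 π) * J_1 (2 π √(2 r))`; see
`hasSum_besselSeries`. -/
def besselSeries : PowerSeries ℝ :=
  PowerSeries.mk fun d =>
    if d = 0 then 0
    else (-1) ^ (d - 1) * (2 * Real.pi ^ 2) ^ (d - 1) /
      (((d - 1).factorial : ℝ) * (d.factorial : ℝ))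

theorem hasSum_besselSeries {r : ℝ} (hr : 0 ≤ r) :
    HasSum (fun d : ℕ => PowerSeries.coeff d besselSeries * r ^ d)
      (√r / (√2 * Real.pi) * besselJ 1 (2 * Real.pi * √(2 * r))) := by
  have hs : Summable (fun m : ℕ => (-1 : ℝ) ^ m / ((m.factorial : ℝ) * ((m + 1).factorial : ℝ))
      * (2 * Real.pi * √(2 * r) / 2) ^ (2 * m + 1)) := by
    set c : ℝ := 2 * Real.pi * √(2 * r) / 2 with hc
    have hc0 : 0 ≤ c := by positivity
    refine Summable.of_norm_bounded (g := fun m : ℕ => c * ((c ^ 2) ^ m / (m.factorial : ℝ)))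
      ((Real.summable_pow_div_factorial (c ^ 2)).mul_left c) fun m => ?_
    have h1 : (1 : ℝ) ≤ ((m + 1).factorial : ℝ) := by
      exact_mod_cast Nat.succ_le_of_lt (Nat.factorial_pos _)
    have h0 : (0 : ℝ) < (m.factorial : ℝ) := by exact_mod_cast Nat.factorial_pos _
    rw [norm_mul, norm_div, norm_pow, norm_neg, norm_one, one_pow,
      Real.norm_of_nonneg (by positivity : 0 ≤ (m.factorial : ℝ) * ((m + 1).factorial : ℝ)),
      Real.norm_of_nonneg (by positivity : 0 ≤ c ^ (2 * m + 1))]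
    have e : c ^ (2 * m + 1) = c * (c ^ 2) ^ m := by ring
    rw [e, mul_comm, mul_assoc, div_eq_mul_one_div ((c ^ 2) ^ m)]
    refine mul_le_mul_of_nonneg_left (mul_le_mul_of_nonneg_left ?_ (by positivity)) hc0
    exact one_div_le_one_div_of_le h0 (le_mul_of_one_le_right h0.le h1)
  rw [← hasSum_nat_add_iff' 1]
  have h := (hs.hasSum.mul_left (√r / (√2 * Real.pi)))
  have h' : √r / (√2 * Real.pi) * besselJ 1 (2 * Real.pi * √(2 * r)) -
      ∑ i ∈ Finset.range 1, PowerSeries.coeff i besselSeries * r ^ i =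
      √r / (√2 * Real.pi) * ∑' m : ℕ, (-1 : ℝ) ^ m /
        ((m.factorial : ℝ) * ((m + 1).factorial : ℝ))
        * (2 * Real.pi * √(2 * r) / 2) ^ (2 * m + 1) := by
    simp [besselSeries, besselJ]
  rw [h']
  refine h.congr_fun fun m => ?_
  have hq : (√r) ^ 2 = r := Real.sq_sqrt hr
  have h2 : (√2 : ℝ) ^ 2 = 2 := Real.sq_sqrt (by norm_num)
  have h20 : (√2 : ℝ) ≠ 0 := by positivity
  have e : (2 * Real.pi * √(2 * r) / 2) ^ (2 * m + 1) =
      Real.pi * √2 * √r * (2 * Real.pi ^ 2) ^ m * r ^ m := by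
    rw [Real.sqrt_mul (by norm_num) r, pow_succ, pow_mul]
    have : (2 * Real.pi * (√2 * √r) / 2) ^ 2 = (2 * Real.pi ^ 2) * r := by
      calc _ = Real.pi ^ 2 * (√2) ^ 2 * (√r) ^ 2 := by ring
        _ = _ := by rw [hq, h2]; ring
    rw [this, mul_pow]; ring
  rw [e]
  simp only [besselSeries, PowerSeries.coeff_mk, Nat.add_sub_cancel, Nat.add_eq_zero_iff,
    one_ne_zero, and_false, if_false]
  field_simp
  rw [hq]
  ring

end AntiDelaunay

end

noncomputable section

namespace AntiDelaunay

open MeasureTheory Set Filter Topology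

/-! ### Convolution on an interval -/

theorem integral_triangle_swap {a : ℝ} (ha : 0 ≤ a) (k : ℝ → ℝ → ℂ)
    (hk : IntegrableOn (Function.uncurry k) (Ioc 0 a ×ˢ Ioc 0 a) (volume.prod volume)) :
    ∫ x in (0 : ℝ)..a, ∫ y in (0 : ℝ)..x, k x y =
      ∫ y in (0 : ℝ)..a, ∫ x in y..a, k x y := by
  set S : Set (ℝ × ℝ) := {p | p.2 ≤ p.1} with hS
  have hSm : MeasurableSet S := measurableSet_le measurable_snd measurable_fst
  have h1 : ∀ x ∈ Ioc 0 a, ∫ y in (0 : ℝ)..x, k x y =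
      ∫ y in Ioc 0 a, S.indicator (Function.uncurry k) (x, y) := by
    intro x hx
    have : ∀ y, S.indicator (Function.uncurry k) (x, y) = (Iic x).indicator (k x) y := by
      intro y
      by_cases h : y ≤ x <;> simp [indicator, hS, h]
    simp_rw [this]
    rw [intervalIntegral.integral_of_le hx.1.le, setIntegral_indicator measurableSet_Iic]
    congr 2
    ext y
    simp only [mem_Ioc, mem_inter_iff, mem_Iic]
    constructor
    · rintro ⟨h0, h1⟩; exact ⟨⟨h0, h1.trans hx.2⟩, h1⟩
    · rintro ⟨⟨h0, _⟩, h1⟩; exact ⟨h0, h1⟩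
  have h2 : ∀ y ∈ Ioc 0 a, ∫ x in y..a, k x y =
      ∫ x in Ioc 0 a, S.indicator (Function.uncurry k) (x, y) := by
    intro y hy
    have : ∀ x, S.indicator (Function.uncurry k) (x, y) = (Ici y).indicator (k · y) x := by
      intro x
      by_cases h : y ≤ x <;> simp [indicator, hS, h]
    simp_rw [this]
    rw [intervalIntegral.integral_of_le hy.2, setIntegral_indicator measurableSet_Ici,
      ← integral_Icc_eq_integral_Ioc]
    congr 2
    ext x
    simp only [mem_Ioc, mem_Icc, mem_inter_iff, mem_Ici]
    constructor
    · rintro ⟨h0, h1⟩; exact ⟨⟨hy.1.trans_le h0, h1⟩, h0⟩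
    · rintro ⟨⟨_, h0⟩, h1⟩; exact ⟨h1, h0⟩
  rw [intervalIntegral.integral_of_le ha, intervalIntegral.integral_of_le ha,
    setIntegral_congr_fun measurableSet_Ioc h1, setIntegral_congr_fun measurableSet_Ioc h2]
  apply integral_integral_swap
  rw [Measure.prod_restrict]
  exact hk.indicator hSm

/-- The convolution on the half-line. -/
def conv (f g : ℝ → ℂ) (a : ℝ) : ℂ := ∫ b in (0 : ℝ)..a, f (a - b) * g b

theorem conv_congr {f f' g g' : ℝ → ℂ} {a : ℝ} (ha : 0 ≤ a) (hf : EqOn f f' (Icc 0 a))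
    (hg : EqOn g g' (Icc 0 a)) : conv f g a = conv f' g' a := by
  refine intervalIntegral.integral_congr fun b hb => ?_
  rw [uIcc_of_le ha] at hb
  simp only [hg hb, hf (show a - b ∈ Icc 0 a from ⟨by linarith [hb.2], by linarith [hb.1]⟩)]

theorem conv_comm (f g : ℝ → ℂ) (a : ℝ) : conv f g a = conv g f a := by
  unfold conv
  have := intervalIntegral.integral_comp_sub_left (a := 0) (b := a)
    (fun b => f (a - b) * g b) a
  simp only [sub_self, sub_zero, sub_sub_cancel] at this
  rw [← this]
  simp_rw [mul_comm]

theorem continuous_conv {f g : ℝ → ℂ} (hf : Continuous f) (hg : Continuous g) :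
    Continuous (conv f g) := by
  unfold conv
  exact intervalIntegral.continuous_parametric_intervalIntegral_of_continuous
    (f := fun a b => f (a - b) * g b) (by fun_prop) continuous_id

/-- Fubini's theorem for the convolution with an integrable function. -/
theorem conv_conv {f g h : ℝ → ℂ} (hf : Continuous f) (hg : Continuous g) {a : ℝ} (ha : 0 ≤ a)
    (hh : IntegrableOn h (Ioc 0 a)) :
    conv f (conv g h) a = conv (conv f g) h a := by
  unfold conv
  have hk : IntegrableOn (Function.uncurry fun x y => f (a - x) * g (x - y) * h y)
      (Ioc 0 a ×ˢ Ioc 0 a) (volume.prod volume) := by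
    have h1 : Integrable (fun p : ℝ × ℝ => (1 : ℂ) * h p.2)
        ((volume.restrict (Ioc 0 a)).prod (volume.restrict (Ioc 0 a))) :=
      Integrable.mul_prod (f := fun _ => (1 : ℂ)) (integrable_const _) hh
    simp only [one_mul] at h1
    rw [IntegrableOn, ← Measure.prod_restrict]
    have hc : Continuous fun p : ℝ × ℝ => f (a - p.1) * g (p.1 - p.2) := by fun_prop
    obtain ⟨C, hC⟩ := (isCompact_Icc.prod isCompact_Icc :
      IsCompact (Icc (0 : ℝ) a ×ˢ Icc (0 : ℝ) a)).exists_bound_of_continuousOn hc.continuousOn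
    refine h1.bdd_mul (c := C) hc.aestronglyMeasurable ?_
    rw [Measure.prod_restrict]
    filter_upwards [ae_restrict_mem (measurableSet_Ioc.prod measurableSet_Ioc)] with p hp
    exact hC p ⟨Ioc_subset_Icc_self hp.1, Ioc_subset_Icc_self hp.2⟩
  have e1 : ∀ x, f (a - x) * ∫ y in (0 : ℝ)..x, g (x - y) * h y =
      ∫ y in (0 : ℝ)..x, f (a - x) * g (x - y) * h y := fun x => by
    rw [← intervalIntegral.integral_const_mul]; simp_rw [mul_assoc]
  have e2 : ∀ y, (∫ b in (0 : ℝ)..(a - y), f (a - y - b) * g b) * h y =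
      ∫ x in y..a, f (a - x) * g (x - y) * h y := fun y => by
    rw [← intervalIntegral.integral_mul_const]
    have := intervalIntegral.integral_comp_sub_right (a := y) (b := a)
      (fun b => f (a - y - b) * g b * h y) y
    simp only [sub_self] at this
    rw [← this]
    refine intervalIntegral.integral_congr fun x _ => ?_
    simp only [sub_sub, add_sub_cancel]
  simp_rw [e1, e2]
  exact integral_triangle_swap ha _ hk

/-! ### The convolution algebra of continuous functions on `[0, π)` -/

/-- The continuous functions on `[0, π)`, extended by zero. -/
def convSubmodule : Submodule ℂ (ℝ → ℂ) where
  carrier := {f | ContinuousOn f (Ico 0 Real.pi) ∧ ∀ x ∉ Ico 0 Real.pi, f x = 0}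
  add_mem' hf hg := ⟨hf.1.add hg.1, fun x hx => by simp [hf.2 x hx, hg.2 x hx]⟩
  zero_mem' := ⟨continuousOn_const, fun _ _ => rfl⟩
  smul_mem' c f hf := ⟨hf.1.const_smul c, fun x hx => by simp [hf.2 x hx]⟩

/-- The continuous functions on `[0, π)`, with convolution as multiplication. -/
def ConvFun : Type := convSubmodule

namespace ConvFun

instance : AddCommGroup ConvFun := inferInstanceAs (AddCommGroup convSubmodule)
instance : Module ℂ ConvFun := inferInstanceAs (Module ℂ convSubmodule)
instance : FunLike ConvFun ℝ ℂ := ⟨fun f => f.1, Subtype.val_injective⟩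

theorem continuousOn (f : ConvFun) : ContinuousOn f (Ico 0 Real.pi) := f.2.1

theorem apply_of_notMem (f : ConvFun) {x : ℝ} (hx : x ∉ Ico 0 Real.pi) : f x = 0 := f.2.2 x hx

@[ext] theorem ext {f g : ConvFun} (h : ∀ x ∈ Ico 0 Real.pi, f x = g x) : f = g := by
  refine DFunLike.ext _ _ fun x => ?_
  by_cases hx : x ∈ Ico 0 Real.pi
  · exact h x hx
  · rw [apply_of_notMem f hx, apply_of_notMem g hx]

/-- The restriction to `[0, π)` of a function that is continuous there. -/
def mk (f : ℝ → ℂ) (hf : ContinuousOn f (Ico 0 Real.pi)) : ConvFun :=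
  ⟨(Ico 0 Real.pi).indicator f, hf.congr fun _ hx => indicator_of_mem hx _,
    fun _ hx => indicator_of_notMem hx _⟩

theorem mk_apply (f : ℝ → ℂ) (hf : ContinuousOn f (Ico 0 Real.pi)) {x : ℝ}
    (hx : x ∈ Ico 0 Real.pi) : mk f hf x = f x := indicator_of_mem hx _

@[simp] theorem add_apply (f g : ConvFun) (x : ℝ) : (f + g) x = f x + g x := rfl
@[simp] theorem zero_apply (x : ℝ) : (0 : ConvFun) x = 0 := rfl
@[simp] theorem neg_apply (f : ConvFun) (x : ℝ) : (-f) x = -f x := rfl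
@[simp] theorem sub_apply (f g : ConvFun) (x : ℝ) : (f - g) x = f x - g x := rfl
@[simp] theorem smul_apply (c : ℂ) (f : ConvFun) (x : ℝ) : (c • f) x = c * f x := rfl

theorem sum_apply {ι : Type*} (s : Finset ι) (f : ι → ConvFun) (x : ℝ) :
    (∑ i ∈ s, f i) x = ∑ i ∈ s, f i x := by
  classical
  induction s using Finset.induction_on with
  | empty => simp
  | insert i s hi ih => simp [Finset.sum_insert hi, ih]

theorem exists_continuous_eqOn (f : ConvFun) {a : ℝ} (ha : a ∈ Ico 0 Real.pi) :
    ∃ F : ℝ → ℂ, Continuous F ∧ EqOn f F (Icc 0 a) := by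
  refine ⟨IccExtend ha.1 ((Icc 0 a).domRestrict f), ?_, fun x hx => ?_⟩
  · exact ((f.continuousOn.mono (Icc_subset_Ico_right ha.2)).domRestrict).Icc_extend'
  · rw [IccExtend_of_mem _ _ hx]; rfl

theorem continuousOn_conv (f g : ConvFun) : ContinuousOn (conv f g) (Ico 0 Real.pi) := by
  intro x hx
  obtain ⟨a, hxa, haπ⟩ := exists_between hx.2
  have ha : a ∈ Ico 0 Real.pi := ⟨hx.1.trans hxa.le, haπ⟩
  obtain ⟨F, hF, hfF⟩ := f.exists_continuous_eqOn ha
  obtain ⟨G, hG, hgG⟩ := g.exists_continuous_eqOn ha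
  have : ContinuousOn (conv f g) (Icc 0 a) :=
    (continuous_conv hF hG).continuousOn.congr fun y hy =>
      conv_congr hy.1 (hfF.mono (Icc_subset_Icc_right hy.2)) (hgG.mono (Icc_subset_Icc_right hy.2))
  refine (this x ⟨hx.1, hxa.le⟩).mono_of_mem_nhdsWithin ?_
  rw [mem_nhdsWithin]
  exact ⟨Iio a, isOpen_Iio, hxa, fun y hy => ⟨hy.2.1, hy.1.le⟩⟩

instance : Mul ConvFun := ⟨fun f g => mk _ (continuousOn_conv f g)⟩

theorem mul_apply (f g : ConvFun) {x : ℝ} (hx : x ∈ Ico 0 Real.pi) :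
    (f * g) x = ∫ b in (0 : ℝ)..x, f (x - b) * g b := mk_apply _ _ hx

theorem intervalIntegrable_mul (f g : ConvFun) {x : ℝ} (hx : x ∈ Ico 0 Real.pi) :
    IntervalIntegrable (fun b => f (x - b) * g b) volume 0 x := by
  apply ContinuousOn.intervalIntegrable
  rw [uIcc_of_le hx.1]
  refine ContinuousOn.mul (f.continuousOn.comp (by fun_prop) fun b hb => ?_)
    (g.continuousOn.mono (Icc_subset_Ico_right hx.2))
  exact ⟨by linarith [hb.2], by linarith [hb.1, hx.2]⟩

protected theorem mul_comm (f g : ConvFun) : f * g = g * f := by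
  ext x hx
  rw [mul_apply _ _ hx, mul_apply _ _ hx]
  exact conv_comm f g x

protected theorem mul_add (f g h : ConvFun) : f * (g + h) = f * g + f * h := by
  ext x hx
  rw [add_apply, mul_apply _ _ hx, mul_apply _ _ hx, mul_apply _ _ hx,
    ← intervalIntegral.integral_add (intervalIntegrable_mul _ _ hx)
      (intervalIntegrable_mul _ _ hx)]
  simp_rw [add_apply, mul_add]

protected theorem mul_smul (c : ℂ) (f g : ConvFun) : f * (c • g) = c • (f * g) := by
  ext x hx
  rw [smul_apply, mul_apply _ _ hx, mul_apply _ _ hx, ← intervalIntegral.integral_const_mul]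
  simp_rw [smul_apply, mul_left_comm]

protected theorem mul_assoc (f g h : ConvFun) : f * g * h = f * (g * h) := by
  ext x hx
  obtain ⟨F, hF, hfF⟩ := f.exists_continuous_eqOn hx
  obtain ⟨G, hG, hgG⟩ := g.exists_continuous_eqOn hx
  obtain ⟨H, hH, hhH⟩ := h.exists_continuous_eqOn hx
  have sub : ∀ {y}, y ∈ Icc 0 x → y ∈ Ico 0 Real.pi := fun hy => ⟨hy.1, hy.2.trans_lt hx.2⟩
  have hm : ∀ {p q : ConvFun} {P Q : ℝ → ℂ}, EqOn p P (Icc 0 x) → EqOn q Q (Icc 0 x) →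
      EqOn (p * q : ConvFun) (conv P Q) (Icc 0 x) := fun hp hq y hy => by
    rw [mul_apply _ _ (sub hy)]
    exact conv_congr hy.1 (hp.mono (Icc_subset_Icc_right hy.2)) (hq.mono (Icc_subset_Icc_right hy.2))
  have hxx : x ∈ Icc 0 x := ⟨hx.1, le_rfl⟩
  rw [hm (hm hfF hgG) hhH hxx, hm hfF (hm hgG hhH) hxx, conv_conv hF hG hx.1]
  exact hH.integrableOn_Ioc

instance : NonUnitalCommRing ConvFun where
  left_distrib := ConvFun.mul_add
  right_distrib f g h := by
    rw [ConvFun.mul_comm, ConvFun.mul_add, ConvFun.mul_comm h f, ConvFun.mul_comm h g]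
  zero_mul f := by ext x hx; simp [mul_apply _ _ hx]
  mul_zero f := by ext x hx; simp [mul_apply _ _ hx]
  mul_assoc := ConvFun.mul_assoc
  mul_comm := ConvFun.mul_comm

instance : SMulCommClass ℂ ConvFun ConvFun := ⟨fun c f g => (ConvFun.mul_smul c f g).symm⟩
instance : IsScalarTower ℂ ConvFun ConvFun :=
  ⟨fun c f g => by
    simp only [smul_eq_mul]
    rw [mul_comm, ConvFun.mul_smul, mul_comm]⟩

end ConvFun

/-! ### Algebra of the integral equation -/

section Algebra

variable {B : Type*} [CommRing B] [Algebra ℂ B] (d : Derivation ℂ B B) {z Y r u c q : B}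

theorem regular_two : IsLeftRegular (2 : B) := by
  have : IsUnit (algebraMap ℂ B 2) := (IsUnit.mk0 (2 : ℂ) two_ne_zero).map _
  rw [map_ofNat] at this
  exact this.isRegular.left

theorem one_add_sq {B : Type*} [CommRing B] {z Y r : B} (hY : Y = z - 2 * r * z * Y ^ 2) :
    (1 + 4 * r * z * Y) ^ 2 = 1 + 8 * r * z ^ 2 := by
  linear_combination 8 * r * z * hY

theorem one_add_mul_one_sub (hz : IsLeftRegular z) (hdz : d z = z ^ 2) (hdr : d r = 0)
    (hY : Y = z - 2 * r * z * Y ^ 2) :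
    (1 + 4 * r * z * Y) * (1 - 4 * r * d Y) = 1 := by
  have h := congrArg d (one_add_sq hY)
  have d4 : d (4 : B) = 0 := by simpa using d.map_natCast 4
  have d8 : d (8 : B) = 0 := by simpa using d.map_natCast 8
  simp only [pow_two, Derivation.leibniz, map_add, smul_eq_mul, hdz, hdr, d4, d8,
    Derivation.map_one_eq_zero] at h
  apply hz
  apply regular_two
  simp only
  linear_combination 2 * z * one_add_sq hY - h

theorem mul_q_eq (hz : IsLeftRegular z) (hdz : d z = z ^ 2) (hdr : d r = 0)
    (hY : Y = z - 2 * r * z * Y ^ 2)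
    (hU : IsLeftRegular (1 + 4 * u ^ 2 * z ^ 2 + 8 * r * z ^ 2))
    (hc : (1 + 4 * u ^ 2 * z ^ 2 + 8 * r * z ^ 2) * c = z)
    (hq : (1 + 4 * u ^ 2 * z ^ 2 + 8 * r * z ^ 2) * q = 2 * u * z ^ 2 * (1 - 4 * r * d Y)) :
    (1 + 4 * r * z * Y) * q = 2 * u * z * c := by
  apply hU
  simp only
  linear_combination (1 + 4 * r * z * Y) * hq - 2 * u * z * hc +
    2 * u * z ^ 2 * one_add_mul_one_sub d hz hdz hdr hY

theorem mul_c_add_eq (hz : IsLeftRegular z) (hdz : d z = z ^ 2) (hdr : d r = 0)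
    (hY : Y = z - 2 * r * z * Y ^ 2)
    (hU : IsLeftRegular (1 + 4 * u ^ 2 * z ^ 2 + 8 * r * z ^ 2))
    (hc : (1 + 4 * u ^ 2 * z ^ 2 + 8 * r * z ^ 2) * c = z)
    (hq : (1 + 4 * u ^ 2 * z ^ 2 + 8 * r * z ^ 2) * q = 2 * u * z ^ 2 * (1 - 4 * r * d Y)) :
    (1 + 4 * r * z * Y) * c + 2 * u * z * q = z * (1 - 4 * r * d Y) := by
  apply hU
  simp only
  linear_combination (1 + 4 * r * z * Y) * hc + 2 * u * z * hq +
    z * (1 - 4 * r * d Y) * one_add_sq hY -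
    z * (1 + 4 * r * z * Y) * one_add_mul_one_sub d hz hdz hdr hY

/-- The integral equation `sin · V = 1 * ((1 - 2u) cos · V - 4r sin · (Y * V))`, written with the
multiplications `σ`, `τ` by `exp (± i α)`. -/
def SatisfiesEq (σ τ : B →ₐ[ℂ] B) (z Y r u V : B) : Prop :=
  σ V - τ V = z * ((1 - 2 * u) * algebraMap ℂ B Complex.I * (σ V + τ V) -
    4 * r * (σ (Y * V) - τ (Y * V)))

variable (σ τ : B →ₐ[ℂ] B) {M V : B}

theorem satisfiesEq_iff (hσz : IsLeftRegular (σ z)) (hτz : IsLeftRegular (τ z))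
    (hz : IsLeftRegular z)
    (hzσ : σ z * (1 - algebraMap ℂ B Complex.I * z) = z)
    (hzτ : τ z * (1 + algebraMap ℂ B Complex.I * z) = z) :
    SatisfiesEq σ τ z Y r u V ↔
      τ z * σ V * (1 + 4 * r * σ z * σ Y + 2 * algebraMap ℂ B Complex.I * u * σ z) =
      σ z * τ V * (1 + 4 * r * τ z * τ Y - 2 * algebraMap ℂ B Complex.I * u * τ z) := by
  unfold SatisfiesEq
  simp only [map_mul]
  constructor
  · intro h
    apply hz
    simp only
    linear_combination σ z * τ z * h - σ V * τ z * hzσ + τ V * σ z * hzτ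
  · intro h
    apply hτz
    apply hσz
    simp only
    linear_combination z * h + σ V * τ z * hzσ - τ V * σ z * hzτ

/-- If `V` satisfies the integral equation, then so does `α V - M * V`. -/
theorem SatisfiesEq.sub (hσz : IsLeftRegular (σ z)) (hτz : IsLeftRegular (τ z))
    (hz : IsLeftRegular z)
    (hzσ : σ z * (1 - algebraMap ℂ B Complex.I * z) = z)
    (hzτ : τ z * (1 + algebraMap ℂ B Complex.I * z) = z)
    (hdσ : ∀ x, d (σ x) = σ (d x)) (hdτ : ∀ x, d (τ x) = τ (d x))
    (hdz : d z = z ^ 2) (hdr : d r = 0) (hdu : d u = 0)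
    (hσr : σ r = r) (hτr : τ r = r) (hσu : σ u = u) (hτu : τ u = u)
    (hY : Y = z - 2 * r * z * Y ^ 2)
    (hU : IsLeftRegular (1 + 4 * u ^ 2 * z ^ 2 + 8 * r * z ^ 2))
    (hc : (1 + 4 * u ^ 2 * z ^ 2 + 8 * r * z ^ 2) * c = z)
    (hq : (1 + 4 * u ^ 2 * z ^ 2 + 8 * r * z ^ 2) * q = 2 * u * z ^ 2 * (1 - 4 * r * d Y))
    (hM : σ M - τ M = (σ c - algebraMap ℂ B Complex.I * σ q) -
      (τ c + algebraMap ℂ B Complex.I * τ q))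
    (hV : SatisfiesEq σ τ z Y r u V) : SatisfiesEq σ τ z Y r u (d V - M * V) := by
  rw [satisfiesEq_iff σ τ hσz hτz hz hzσ hzτ] at hV ⊢
  have h1 := mul_q_eq d hz hdz hdr hY hU hc hq
  have h2 := mul_c_add_eq d hz hdz hdr hY hU hc hq
  have h1σ := congrArg σ h1
  have h1τ := congrArg τ h1
  have h2σ := congrArg σ h2
  have h2τ := congrArg τ h2
  have dI : d (algebraMap ℂ B Complex.I) = 0 := d.map_algebraMap _
  have d2 : d (2 : B) = 0 := by simpa using d.map_natCast 2
  have d4 : d (4 : B) = 0 := by simpa using d.map_natCast 4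
  have I2 : algebraMap ℂ B Complex.I * algebraMap ℂ B Complex.I = -1 := by
    rw [← map_mul, Complex.I_mul_I, map_neg, map_one]
  have hd := congrArg d hV
  simp only [map_add, map_sub, map_mul, map_one, map_ofNat, hσr, hτr, hσu, hτu] at h1σ h1τ h2σ h2τ
  simp only [Derivation.leibniz, map_add, map_sub, smul_eq_mul, hdr, d2, d4, dI, hdu, hdσ, hdτ, hdz,
    Derivation.map_one_eq_zero, map_pow] at hd
  simp only [map_sub, map_mul]
  generalize algebraMap ℂ B Complex.I = I at *
  linear_combination hd + (σ c - I * σ q - σ M - σ z - τ z) * hV -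
    σ z * τ V * (1 + 4 * r * τ z * τ Y - 2 * I * u * τ z) * hM -
    τ z * σ V * (h2σ - I * h1σ) + σ z * τ V * (h2τ + I * h1τ) +
    2 * u * σ z * τ z * (σ V * σ q - τ V * τ q) * I2

end Algebra

/-! ### The ring of formal power series over the convolution algebra -/

/-- The convolution algebra with a unit adjoined. -/
abbrev ConvRing : Type := Unitization ℂ ConvFun

namespace ConvFun

/-- Multiplication by the exponential `exp (w α)`. -/
def twist (w : ℂ) : ConvFun →ₙₐ[ℂ] ConvFun where
  toFun f := mk (fun x => Complex.exp (w * x) * f x)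
    (ContinuousOn.mul (by fun_prop) f.continuousOn)
  map_smul' c f := by
    ext x hx
    simp only [mk_apply _ _ hx, smul_apply, MonoidHom.id_apply]
    ring
  map_zero' := by ext x hx; simp [mk_apply _ _ hx]
  map_add' f g := by ext x hx; simp [mk_apply _ _ hx, mul_add]
  map_mul' f g := by
    ext x hx
    rw [mk_apply _ _ hx, mul_apply _ _ hx, mul_apply _ _ hx, ← intervalIntegral.integral_const_mul]
    refine intervalIntegral.integral_congr fun b hb => ?_
    rw [uIcc_of_le hx.1] at hb
    rw [mk_apply _ _ ⟨by linarith [hb.2], by linarith [hb.1, hx.2]⟩,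
      mk_apply _ _ ⟨hb.1, hb.2.trans_lt hx.2⟩]
    have : Complex.exp (w * x) = Complex.exp (w * ((x - b : ℝ) : ℂ)) * Complex.exp (w * b) := by
      rw [← Complex.exp_add]; push_cast; ring_nf
    rw [this]; ring

theorem twist_apply (w : ℂ) (f : ConvFun) {x : ℝ} (hx : x ∈ Ico 0 Real.pi) :
    twist w f x = Complex.exp (w * x) * f x :=
  mk_apply _ (ContinuousOn.mul (by fun_prop) f.continuousOn) hx

/-- Multiplication by the variable. -/
def mulVar : ConvFun →ₗ[ℂ] ConvFun where
  toFun f := mk (fun x => x * f x) (ContinuousOn.mul (by fun_prop) f.continuousOn)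
  map_smul' c f := by
    ext x hx
    simp only [mk_apply _ _ hx, smul_apply, RingHom.id_apply]
    ring
  map_add' f g := by ext x hx; simp [mk_apply _ _ hx, mul_add]

theorem mulVar_apply (f : ConvFun) {x : ℝ} (hx : x ∈ Ico 0 Real.pi) :
    mulVar f x = x * f x :=
  mk_apply _ (ContinuousOn.mul (by fun_prop) f.continuousOn) hx

theorem mulVar_mul (f g : ConvFun) : mulVar (f * g) = f * mulVar g + g * mulVar f := by
  rw [mul_comm g]
  ext x hx
  rw [mulVar_apply _ hx, add_apply, mul_apply _ _ hx, mul_apply _ _ hx, mul_apply _ _ hx,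
    ← intervalIntegral.integral_const_mul,
    ← intervalIntegral.integral_add (intervalIntegrable_mul _ _ hx)
      (intervalIntegrable_mul _ _ hx)]
  refine intervalIntegral.integral_congr fun b hb => ?_
  rw [uIcc_of_le hx.1] at hb
  rw [mulVar_apply _ ⟨hb.1, hb.2.trans_lt hx.2⟩,
    mulVar_apply _ ⟨by linarith [hb.2], by linarith [hb.1, hx.2]⟩]
  push_cast; ring

theorem mulVar_twist (w : ℂ) (f : ConvFun) : mulVar (twist w f) = twist w (mulVar f) := by
  ext x hx
  rw [mulVar_apply _ hx, twist_apply _ _ hx, twist_apply _ _ hx, mulVar_apply _ hx]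
  ring

/-- The constant function `1`. -/
def const : ConvFun := mk (fun _ => 1) continuousOn_const

theorem const_apply {x : ℝ} (hx : x ∈ Ico 0 Real.pi) : const x = 1 := mk_apply _ _ hx

theorem const_mul_apply (f : ConvFun) {x : ℝ} (hx : x ∈ Ico 0 Real.pi) :
    (const * f) x = ∫ b in (0 : ℝ)..x, f b := by
  rw [mul_apply _ _ hx]
  refine intervalIntegral.integral_congr fun b hb => ?_
  rw [uIcc_of_le hx.1] at hb
  rw [const_apply ⟨by linarith [hb.2], by linarith [hb.1, hx.2]⟩, one_mul]

theorem mulVar_const : mulVar const = const * const := by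
  ext x hx
  rw [mulVar_apply _ hx, const_mul_apply _ hx, const_apply hx]
  have : ∫ b in (0 : ℝ)..x, const b = ∫ b in (0 : ℝ)..x, (1 : ℂ) := by
    refine intervalIntegral.integral_congr fun b hb => ?_
    rw [uIcc_of_le hx.1] at hb
    exact const_apply ⟨hb.1, hb.2.trans_lt hx.2⟩
  rw [this]
  simp

theorem twist_const (w : ℂ) : twist w const = const + w • (const * twist w const) := by
  ext x hx
  rw [add_apply, smul_apply, twist_apply _ _ hx, const_mul_apply _ hx, const_apply hx]
  have : ∫ b in (0 : ℝ)..x, twist w const b = ∫ b in (0 : ℝ)..x, Complex.exp (w * b) := by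
    refine intervalIntegral.integral_congr fun b hb => ?_
    rw [uIcc_of_le hx.1] at hb
    have hb' : b ∈ Ico 0 Real.pi := ⟨hb.1, hb.2.trans_lt hx.2⟩
    rw [twist_apply _ _ hb', const_apply hb', mul_one]
  rw [this]
  by_cases hw : w = 0
  · simp [hw]
  · rw [integral_exp_mul_complex hw]
    field_simp
    simp

theorem hasDerivAt_integral (f : ConvFun) {x : ℝ} (hx : x ∈ Ioo 0 Real.pi) :
    HasDerivAt (fun y => ∫ b in (0 : ℝ)..y, f b) (f x) x := by
  have hc : ContinuousAt f x := f.continuousOn.continuousAt (Ico_mem_nhds hx.1 hx.2)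
  refine intervalIntegral.integral_hasDerivAt_right ?_ ?_ hc
  · exact (f.continuousOn.mono (by rw [uIcc_of_le hx.1.le]; exact Icc_subset_Ico_right hx.2)).intervalIntegrable
  · exact (f.continuousOn.mono Ioo_subset_Ico_self).stronglyMeasurableAtFilter isOpen_Ioo x hx

theorem eq_zero_of_const_mul (c : ℂ) (f : ConvFun) (h : c • const + const * f = 0) :
    c = 0 ∧ f = 0 := by
  have hx : ∀ x ∈ Ico 0 Real.pi, c + ∫ b in (0 : ℝ)..x, f b = 0 := fun x hx => by
    have := congrArg (fun g : ConvFun => g x) h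
    simpa [const_mul_apply _ hx, const_apply hx] using this
  have hc : c = 0 := by simpa using hx 0 ⟨le_rfl, Real.pi_pos⟩
  refine ⟨hc, ?_⟩
  have h0 : ∀ x ∈ Ioo 0 Real.pi, f x = 0 := fun x hx' => by
    have h1 := hasDerivAt_integral f hx'
    have h2 : HasDerivAt (fun y => ∫ b in (0 : ℝ)..y, f b) 0 x := by
      refine (hasDerivAt_const x (0 : ℂ)).congr_of_eventuallyEq ?_
      filter_upwards [Ioo_mem_nhds hx'.1 hx'.2] with y hy
      simpa [hc] using hx y (Ioo_subset_Ico_self hy)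
    exact h1.unique h2
  ext x hx'
  have hcl : x ∈ closure (Ioo 0 Real.pi) := by
    rw [closure_Ioo Real.pi_pos.ne]; exact Ico_subset_Icc_self hx'
  have := (f.continuousOn x hx').mono Ioo_subset_Ico_self
  have hne : (𝓝[Ioo 0 Real.pi] x).NeBot := mem_closure_iff_nhdsWithin_neBot.1 hcl
  refine tendsto_nhds_unique this ?_
  refine tendsto_const_nhds.congr' ?_
  filter_upwards [self_mem_nhdsWithin] with y hy
  exact (h0 y hy).symm

end ConvFun

namespace ConvRing

open ConvFun Unitization

/-- The multiplication by `exp (w α)`, as an algebra homomorphism. -/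
def twist (w : ℂ) : ConvRing →ₐ[ℂ] ConvRing :=
  Unitization.lift ((Unitization.inrNonUnitalAlgHom ℂ ConvFun).comp (ConvFun.twist w))

@[simp] theorem twist_inr (w : ℂ) (f : ConvFun) :
    twist w (f : ConvRing) = (ConvFun.twist w f : ConvFun) := by
  simp [twist]

/-- The multiplication by the variable, a derivation. -/
def mulVar : Derivation ℂ ConvRing ConvRing where
  toFun a := (ConvFun.mulVar a.snd : ConvFun)
  map_add' a b := by simp
  map_smul' c a := by simp
  map_one_eq_zero' := by simp
  leibniz' a b := by
    induction a using Unitization.ind with | inl_add_inr a f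
    induction b using Unitization.ind with | inl_add_inr b g
    ext
    · simp
    · simp [mulVar_mul]
      ring

@[simp] theorem mulVar_inr (f : ConvFun) : mulVar (f : ConvRing) = (ConvFun.mulVar f : ConvFun) := rfl

theorem mulVar_twist (w : ℂ) (a : ConvRing) : mulVar (twist w a) = twist w (mulVar a) := by
  induction a using Unitization.ind with | inl_add_inr a f
  have : twist w (inl a) = inl a := (twist w).commutes a
  have h2 : mulVar (inl a : ConvRing) = 0 := mulVar.map_algebraMap a
  simp [this, h2, ConvFun.mulVar_twist]

/-- The inverse of the differentiation. -/
def z : ConvRing := (const : ConvFun)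

theorem regular_z : IsLeftRegular z := by
  rw [isLeftRegular_iff_right_eq_zero_of_mul]
  intro a h
  induction a using Unitization.ind with | inl_add_inr a f
  have h' := congrArg (fun b : ConvRing => b.snd) h
  simp only [z, mul_add] at h'
  have := eq_zero_of_const_mul a f (by simpa using h')
  simp [this.1, this.2]

theorem mulVar_z : mulVar z = z ^ 2 := by
  rw [z, mulVar_inr, mulVar_const, pow_two, inr_mul]

theorem twist_z_mul (w : ℂ) : twist w z * (1 - algebraMap ℂ ConvRing w * z) = z := by
  have := congrArg (fun f : ConvFun => (f : ConvRing)) (twist_const w)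
  simp only [inr_add, inr_smul, inr_mul, ← twist_inr, Algebra.smul_def] at this
  rw [z]
  linear_combination this

theorem regular_twist_z (w : ℂ) : IsLeftRegular (twist w z) := by
  have := regular_z
  rw [← twist_z_mul w, mul_comm] at this
  exact this.of_mul

end ConvRing

/-- The ring of formal power series in `r` over the convolution ring. -/
abbrev ConvSeries : Type := PowerSeries ConvRing

namespace ConvSeries

open ConvFun Unitization

theorem algebraMap_eq (w : ℂ) : algebraMap ℂ ConvSeries w =
    PowerSeries.C (algebraMap ℂ ConvRing w) := by
  rw [PowerSeries.algebraMap_apply]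

/-- The multiplication by `exp (w α)`. -/
def twist (w : ℂ) : ConvSeries →ₐ[ℂ] ConvSeries := PowerSeries.mapAlgHom (ConvRing.twist w)

theorem coeff_twist (w : ℂ) (f : ConvSeries) (n : ℕ) :
    PowerSeries.coeff n (twist w f) = ConvRing.twist w (PowerSeries.coeff n f) := by
  simp [twist, PowerSeries.mapAlgHom_apply]

/-- The multiplication by `α`. -/
def mulVar : Derivation ℂ ConvSeries ConvSeries where
  toFun f := PowerSeries.mk fun n => ConvRing.mulVar (PowerSeries.coeff n f)
  map_add' a b := by ext n : 1; simp
  map_smul' c a := by ext n : 1; simp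
  map_one_eq_zero' := by
    ext n : 1
    simp only [LinearMap.coe_mk, AddHom.coe_mk, PowerSeries.coeff_mk, PowerSeries.coeff_one]
    split_ifs <;> simp
  leibniz' a b := by
    ext n : 1
    simp only [LinearMap.coe_mk, AddHom.coe_mk, PowerSeries.coeff_mk, PowerSeries.coeff_mul,
      map_sum, Derivation.leibniz, smul_eq_mul, map_add, Finset.sum_add_distrib]
    congr 1
    rw [← Finset.Nat.sum_antidiagonal_swap]
    rfl

theorem coeff_mulVar (f : ConvSeries) (n : ℕ) :
    PowerSeries.coeff n (mulVar f) = ConvRing.mulVar (PowerSeries.coeff n f) :=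
  PowerSeries.coeff_mk n (fun n => ConvRing.mulVar (PowerSeries.coeff n f))

theorem mulVar_twist (w : ℂ) (f : ConvSeries) : mulVar (twist w f) = twist w (mulVar f) := by
  ext n : 1
  rw [coeff_mulVar, coeff_twist, coeff_twist, coeff_mulVar, ConvRing.mulVar_twist]

/-- The inverse of the differentiation. -/
def z : ConvSeries := PowerSeries.C ConvRing.z

theorem regular_C {a : ConvRing} (ha : IsLeftRegular a) :
    IsLeftRegular (PowerSeries.C a : ConvSeries) := by
  intro f g h
  ext n : 1
  apply ha
  simpa using congrArg (PowerSeries.coeff n) h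

theorem twist_C (w : ℂ) (a : ConvRing) :
    twist w (PowerSeries.C a) = PowerSeries.C (ConvRing.twist w a) := by
  ext n : 1
  rw [coeff_twist, PowerSeries.coeff_C, PowerSeries.coeff_C]
  split_ifs <;> simp

theorem twist_X (w : ℂ) : twist w PowerSeries.X = PowerSeries.X := by
  ext n : 1
  rw [coeff_twist, PowerSeries.coeff_X]
  split_ifs <;> simp

theorem mulVar_X : mulVar PowerSeries.X = 0 := by
  ext n : 1
  rw [coeff_mulVar, PowerSeries.coeff_X]
  split_ifs <;> simp

theorem mulVar_z : mulVar z = z ^ 2 := by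
  ext n : 1
  rw [coeff_mulVar, z, ← map_pow, PowerSeries.coeff_C, PowerSeries.coeff_C]
  split_ifs <;> simp [ConvRing.mulVar_z]

theorem twist_z_mul (w : ℂ) : twist w z * (1 - algebraMap ℂ ConvSeries w * z) = z := by
  rw [algebraMap_eq, z, twist_C]
  conv_rhs => rw [← ConvRing.twist_z_mul w]
  simp

theorem isUnit_one_sub (w : ℂ) : IsUnit (1 - algebraMap ℂ ConvRing w * ConvRing.z) := by
  refine IsUnit.of_mul_eq_one (1 + algebraMap ℂ ConvRing w * ConvRing.twist w ConvRing.z) ?_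
  linear_combination algebraMap ℂ ConvRing w * ConvRing.twist_z_mul w

theorem regular_discr (u : ℂ) : IsLeftRegular (1 + 4 * (algebraMap ℂ ConvSeries u) ^ 2 * z ^ 2 +
    8 * PowerSeries.X * z ^ 2 : ConvSeries) := by
  refine IsUnit.isRegular ?_ |>.left
  rw [PowerSeries.isUnit_iff_constantCoeff]
  have h := (isUnit_one_sub (2 * u * Complex.I)).mul (isUnit_one_sub (-(2 * u * Complex.I)))
  have hI : algebraMap ℂ ConvRing Complex.I ^ 2 = -1 := by
    rw [← map_pow, Complex.I_sq, map_neg, map_one]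
  suffices e : PowerSeries.constantCoeff (1 + 4 * (algebraMap ℂ ConvSeries u) ^ 2 * z ^ 2 +
      8 * PowerSeries.X * z ^ 2 : ConvSeries) =
      (1 - algebraMap ℂ ConvRing (2 * u * Complex.I) * ConvRing.z) *
      (1 - algebraMap ℂ ConvRing (-(2 * u * Complex.I)) * ConvRing.z) by rw [e]; exact h
  simp only [map_add, map_mul, map_pow, map_one, map_neg, z, algebraMap_eq,
    PowerSeries.constantCoeff_C, PowerSeries.constantCoeff_X, map_ofNat]
  linear_combination (4 * algebraMap ℂ ConvRing u ^ 2 * ConvRing.z ^ 2) * hI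

/-- The power series with coefficients in the convolution algebra. -/
def ofSeq (f : ℕ → ConvFun) : ConvSeries := PowerSeries.mk fun n => (f n : ConvRing)

@[simp] theorem coeff_ofSeq (f : ℕ → ConvFun) (n : ℕ) :
    PowerSeries.coeff n (ofSeq f) = (f n : ConvRing) := PowerSeries.coeff_mk _ _

theorem inr_sum {ι : Type*} (s : Finset ι) (f : ι → ConvFun) :
    ((∑ i ∈ s, f i : ConvFun) : ConvRing) = ∑ i ∈ s, (f i : ConvRing) :=
  map_sum (Unitization.inrNonUnitalAlgHom ℂ ConvFun) f s

/-- The product of two sequences, viewed as power series. -/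
def seqMul (f g : ℕ → ConvFun) (n : ℕ) : ConvFun :=
  ∑ p ∈ Finset.HasAntidiagonal.antidiagonal n, f p.1 * g p.2

theorem ofSeq_mul (f g : ℕ → ConvFun) : ofSeq f * ofSeq g = ofSeq (seqMul f g) := by
  ext n : 1
  simp only [PowerSeries.coeff_mul, coeff_ofSeq, seqMul, inr_sum, inr_mul]

/-- The shift of a sequence, that is, the multiplication by `r` of the power series. -/
def shift (f : ℕ → ConvFun) : ℕ → ConvFun
  | 0 => 0
  | n + 1 => f n

theorem X_mul_ofSeq (f : ℕ → ConvFun) : PowerSeries.X * ofSeq f = ofSeq (shift f) := by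
  ext n : 1
  cases n with
  | zero => simp [shift]
  | succ n => simp [shift, PowerSeries.coeff_succ_X_mul]

theorem z_mul_ofSeq (f : ℕ → ConvFun) : z * ofSeq f = ofSeq fun n => const * f n := by
  ext n : 1
  simp [z, ConvRing.z]

theorem algebraMap_mul_ofSeq (w : ℂ) (f : ℕ → ConvFun) :
    algebraMap ℂ ConvSeries w * ofSeq f = ofSeq fun n => w • f n := by
  ext n : 1
  rw [← Algebra.smul_def]
  simp

theorem twist_ofSeq (w : ℂ) (f : ℕ → ConvFun) :
    twist w (ofSeq f) = ofSeq fun n => ConvFun.twist w (f n) := by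
  ext n : 1
  simp [coeff_twist]

theorem mulVar_ofSeq (f : ℕ → ConvFun) :
    mulVar (ofSeq f) = ofSeq fun n => ConvFun.mulVar (f n) := by
  ext n : 1
  simp [coeff_mulVar]

theorem ofSeq_add (f g : ℕ → ConvFun) : ofSeq f + ofSeq g = ofSeq (f + g) := by
  ext n : 1; simp

theorem ofSeq_sub (f g : ℕ → ConvFun) : ofSeq f - ofSeq g = ofSeq (f - g) := by
  ext n : 1; simp [sub_eq_add_neg]

theorem ofSeq_injective : Function.Injective ofSeq := fun f g h => by
  ext n : 1
  have := congrArg (PowerSeries.coeff n) h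
  simpa [Unitization.inr_injective.eq_iff] using this

theorem z_eq : z = ofSeq fun n => if n = 0 then const else 0 := by
  ext n : 1
  rw [z, coeff_ofSeq, PowerSeries.coeff_C]
  split_ifs <;> simp [ConvRing.z]

theorem satisfiesEq_ofSeq_iff (Y V : ℕ → ConvFun) (u : ℂ) :
    SatisfiesEq (twist Complex.I) (twist (-Complex.I)) z (ofSeq Y) PowerSeries.X
      (algebraMap ℂ ConvSeries u) (ofSeq V) ↔
    ∀ n, ∀ x ∈ Ico 0 Real.pi, Complex.sin x * V n x =
      ∫ b in (0 : ℝ)..x, ((1 - 2 * u) * Complex.cos b * V n b -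
        4 * Complex.sin b * shift (seqMul Y V) n b) := by
  have e1 : (1 - 2 * algebraMap ℂ ConvSeries u) * algebraMap ℂ ConvSeries Complex.I =
      algebraMap ℂ ConvSeries ((1 - 2 * u) * Complex.I) := by
    rw [map_mul, map_sub, map_mul, map_one, map_ofNat (algebraMap ℂ ConvSeries) 2]
  have e2 : (4 : ConvSeries) = algebraMap ℂ ConvSeries 4 :=
    (map_ofNat (algebraMap ℂ ConvSeries) 4).symm
  have e3 : ∀ f : ConvSeries, PowerSeries.X * twist Complex.I f =
      twist Complex.I (PowerSeries.X * f) := fun f => by rw [map_mul, twist_X]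
  have e4 : ∀ f : ConvSeries, PowerSeries.X * twist (-Complex.I) f =
      twist (-Complex.I) (PowerSeries.X * f) := fun f => by rw [map_mul, twist_X]
  unfold SatisfiesEq
  rw [e1, e2, mul_assoc (algebraMap ℂ ConvSeries 4), mul_sub PowerSeries.X, e3, e4, ofSeq_mul,
    X_mul_ofSeq]
  simp only [twist_ofSeq, ofSeq_add, ofSeq_sub, algebraMap_mul_ofSeq, z_mul_ofSeq]
  rw [ofSeq_injective.eq_iff, funext_iff]
  refine forall_congr' fun n => ?_
  set g := shift (seqMul Y V) n with hg
  have hsin : ∀ x : ℝ, Complex.exp (Complex.I * x) - Complex.exp (-Complex.I * x) =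
      2 * Complex.I * Complex.sin x := fun x => by
    rw [Complex.sin]
    rw [show -Complex.I * (x : ℂ) = -x * Complex.I by ring,
      show Complex.I * (x : ℂ) = x * Complex.I by ring]
    linear_combination (Complex.exp (x * Complex.I) - Complex.exp (-(x : ℂ) * Complex.I)) *
      Complex.I_mul_I
  have hcos : ∀ x : ℝ, Complex.exp (Complex.I * x) + Complex.exp (-Complex.I * x) =
      2 * Complex.cos x := fun x => by
    rw [Complex.cos]
    rw [show -Complex.I * (x : ℂ) = -x * Complex.I by ring,
      show Complex.I * (x : ℂ) = x * Complex.I by ring]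
    ring
  have hint : ∀ x ∈ Ico 0 Real.pi, (const * (((1 - 2 * u) * Complex.I) •
      (ConvFun.twist Complex.I (V n) + ConvFun.twist (-Complex.I) (V n)) -
      (4 : ℂ) • (ConvFun.twist Complex.I g - ConvFun.twist (-Complex.I) g)) : ConvFun) x =
      2 * Complex.I * ∫ b in (0 : ℝ)..x, ((1 - 2 * u) * Complex.cos b * V n b -
        4 * Complex.sin b * g b) := fun x hx => by
    rw [const_mul_apply _ hx, ← intervalIntegral.integral_const_mul]
    refine intervalIntegral.integral_congr fun b hb => ?_
    rw [uIcc_of_le hx.1] at hb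
    have hb' : b ∈ Ico 0 Real.pi := ⟨hb.1, hb.2.trans_lt hx.2⟩
    simp only [ConvFun.sub_apply, ConvFun.add_apply, ConvFun.smul_apply, ConvFun.twist_apply _ _ hb']
    linear_combination (1 - 2 * u) * Complex.I * V n b * hcos b - 4 * g b * hsin b
  have hl : ∀ x ∈ Ico 0 Real.pi, (ConvFun.twist Complex.I (V n) -
      ConvFun.twist (-Complex.I) (V n) : ConvFun) x = 2 * Complex.I * (Complex.sin x * V n x) :=
    fun x hx => by
      simp only [ConvFun.sub_apply, ConvFun.twist_apply _ _ hx]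
      linear_combination V n x * hsin x
  have h2I : (2 * Complex.I : ℂ) ≠ 0 := by simp
  constructor
  · intro h x hx
    have := congrArg (fun f : ConvFun => f x) h
    simp only [Pi.sub_apply, Pi.add_apply] at this
    rw [hl x hx] at this
    exact mul_left_cancel₀ h2I (this.trans (hint x hx))
  · intro h
    refine ConvFun.ext fun x hx => ?_
    simp only [Pi.sub_apply, Pi.add_apply]
    rw [hl x hx, h x hx]
    exact (hint x hx).symm

/-- The coefficients of the Bessel series solving the quadratic convolution equation. -/
def besselY (n : ℕ) : ConvFun :=
  mk (fun x => (-2) ^ n * (x : ℂ) ^ (2 * n) / (n.factorial * (n + 1).factorial)) (by fun_prop)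

theorem besselY_apply (n : ℕ) {x : ℝ} (hx : x ∈ Ico 0 Real.pi) :
    besselY n x = (-2) ^ n * (x : ℂ) ^ (2 * n) / (n.factorial * (n + 1).factorial) :=
  mk_apply _ (by fun_prop) hx

theorem z_pow_succ (k : ℕ) : ConvRing.z ^ (k + 1) =
    ((mk (fun x => (x : ℂ) ^ k / k.factorial) (by fun_prop) : ConvFun) : ConvRing) := by
  induction k with
  | zero =>
    rw [zero_add, pow_one, ConvRing.z]
    congr 1
    ext x hx
    simp [const_apply hx, mk_apply _ _ hx]
  | succ k ih =>
    rw [pow_succ', ih, ConvRing.z, ← inr_mul]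
    congr 1
    ext x hx
    rw [const_mul_apply _ hx, mk_apply _ _ hx]
    have : ∫ b in (0 : ℝ)..x, (mk (fun x => (x : ℂ) ^ k / k.factorial) (by fun_prop) : ConvFun) b =
        ∫ b in (0 : ℝ)..x, ((b ^ k / k.factorial : ℝ) : ℂ) := by
      refine intervalIntegral.integral_congr fun b hb => ?_
      rw [uIcc_of_le hx.1] at hb
      rw [mk_apply _ _ ⟨hb.1, hb.2.trans_lt hx.2⟩]
      push_cast; rfl
    rw [this, intervalIntegral.integral_ofReal, intervalIntegral.integral_div, integral_pow,
      Nat.factorial_succ]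
    have : (k.factorial : ℂ) ≠ 0 := by exact_mod_cast k.factorial_ne_zero
    have : (k : ℂ) + 1 ≠ 0 := by exact_mod_cast k.succ_ne_zero
    push_cast
    field_simp
    simp

theorem besselY_eq (n : ℕ) : (besselY n : ConvRing) =
    algebraMap ℂ ConvRing ((-2) ^ n * catalan n) * ConvRing.z ^ (2 * n + 1) := by
  rw [z_pow_succ, ← Algebra.smul_def, ← inr_smul]
  congr 1
  ext x hx
  rw [ConvFun.smul_apply, mk_apply _ _ hx, besselY_apply _ hx]
  have h := succ_mul_catalan_eq_centralBinom n
  have h2 := Nat.centralBinom_eq_two_mul_choose n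
  have h3 := Nat.choose_mul_factorial_mul_factorial (show n ≤ 2 * n by omega)
  rw [← h2, ← h, show 2 * n - n = n by omega] at h3
  have h4 : ((2 * n).factorial : ℂ) = (n + 1) * catalan n * n.factorial * n.factorial := by
    exact_mod_cast h3.symm
  have h5 : ((2 * n).factorial : ℂ) ≠ 0 := by exact_mod_cast (2 * n).factorial_ne_zero
  have h6 : (n.factorial : ℂ) ≠ 0 := by exact_mod_cast n.factorial_ne_zero
  have h7 : (n : ℂ) + 1 ≠ 0 := by exact_mod_cast n.succ_ne_zero
  rw [Nat.factorial_succ]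
  push_cast
  field_simp
  rw [h4]
  ring

theorem ofSeq_besselY : ofSeq besselY =
    z - 2 * PowerSeries.X * z * ofSeq besselY ^ 2 := by
  have h : 2 * PowerSeries.X * z * ofSeq besselY ^ 2 =
      algebraMap ℂ ConvSeries 2 * (PowerSeries.X * (z * (ofSeq besselY * ofSeq besselY))) := by
    rw [map_ofNat]; ring
  rw [h, ofSeq_mul, z_mul_ofSeq, X_mul_ofSeq, algebraMap_mul_ofSeq, z_eq, ofSeq_sub]
  congr 1
  funext n
  apply Unitization.inr_injective (R := ℂ)
  cases n with
  | zero =>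
    simp only [shift, Pi.sub_apply, if_true, smul_zero, sub_zero]
    rw [besselY_eq, ← ConvRing.z]
    simp
  | succ n =>
    simp only [shift, Pi.sub_apply, if_neg n.succ_ne_zero, zero_sub, seqMul, inr_neg, inr_smul,
      inr_mul, inr_sum, besselY_eq, Algebra.smul_def]
    rw [← ConvRing.z]
    have : ∀ p ∈ Finset.HasAntidiagonal.antidiagonal n,
        algebraMap ℂ ConvRing ((-2) ^ p.1 * catalan p.1) * ConvRing.z ^ (2 * p.1 + 1) *
        (algebraMap ℂ ConvRing ((-2) ^ p.2 * catalan p.2) * ConvRing.z ^ (2 * p.2 + 1)) =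
        algebraMap ℂ ConvRing ((-2) ^ n * (catalan p.1 * catalan p.2)) *
          ConvRing.z ^ (2 * n + 2) := fun p hp => by
      rw [Finset.HasAntidiagonal.mem_antidiagonal] at hp
      rw [← hp]
      simp only [map_mul, map_pow]
      ring
    rw [Finset.sum_congr rfl this, ← Finset.sum_mul, ← map_sum, ← Finset.mul_sum, catalan_succ']
    simp only [Nat.cast_sum, Nat.cast_mul]
    generalize ∑ i ∈ Finset.HasAntidiagonal.antidiagonal n,
      (catalan i.1 : ℂ) * (catalan i.2 : ℂ) = S
    rw [show (-2) ^ (n + 1) * S = -(2 * ((-2) ^ n * S)) by ring, map_neg, map_mul]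
    ring

end ConvSeries

/-! ### Even and odd entire power series -/

/-- The entire function `∑ p, a p * x ^ (2 p + m)`. -/
def parSeries (a : ℕ → ℝ) (m : ℕ) (x : ℝ) : ℝ := ∑' p, a p * x ^ (2 * p + m)

/-- The coefficients decay like those of the exponential series. -/
def ExpDecay (a : ℕ → ℝ) : Prop := ∃ K C : ℝ, 0 ≤ C ∧ ∀ p, |a p| ≤ K * (C ^ p / p.factorial)

theorem ExpDecay.norm_le {a : ℕ → ℝ} (ha : ExpDecay a) (m : ℕ) {R : ℝ} :
    ∃ g : ℕ → ℝ, Summable g ∧ ∀ p, ∀ x ∈ Icc (-R) R, ‖a p * x ^ (2 * p + m)‖ ≤ g p := by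
  obtain ⟨K, C, hC, h⟩ := ha
  refine ⟨fun p => K * R ^ m * ((C * R ^ 2) ^ p / p.factorial),
    (Real.summable_pow_div_factorial _).mul_left _, fun p x hx => ?_⟩
  have hx' : |x| ≤ R := abs_le.2 hx
  rw [norm_mul, Real.norm_eq_abs, norm_pow, Real.norm_eq_abs]
  calc |a p| * |x| ^ (2 * p + m) ≤ (K * (C ^ p / p.factorial)) * R ^ (2 * p + m) :=
        mul_le_mul (h p) (pow_le_pow_left₀ (abs_nonneg _) hx' _) (by positivity)
          ((abs_nonneg _).trans (h p))
    _ = _ := by simp only [mul_pow]; rw [← pow_mul, pow_add]; ring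

theorem ExpDecay.summable {a : ℕ → ℝ} (ha : ExpDecay a) (m : ℕ) (x : ℝ) :
    Summable fun p => a p * x ^ (2 * p + m) := by
  obtain ⟨g, hg, h⟩ := ha.norm_le m (R := |x|)
  exact Summable.of_norm_bounded hg fun p => h p x (abs_le.1 le_rfl)

theorem ExpDecay.continuous {a : ℕ → ℝ} (ha : ExpDecay a) (m : ℕ) :
    Continuous (parSeries a m) := by
  rw [continuous_iff_continuousAt]
  intro x
  obtain ⟨g, hg, h⟩ := ha.norm_le m (R := |x| + 1)
  have : ContinuousOn (parSeries a m) (Icc (-(|x| + 1)) (|x| + 1)) :=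
    continuousOn_tsum (fun p => by fun_prop) hg h
  refine this.continuousAt (Icc_mem_nhds ?_ ?_)
  · linarith [neg_abs_le x]
  · linarith [le_abs_self x]

theorem ExpDecay.mono {a b : ℕ → ℝ} (ha : ExpDecay a) (h : ∀ p, |b p| ≤ |a p|) : ExpDecay b := by
  obtain ⟨K, C, hC, h'⟩ := ha
  exact ⟨K, C, hC, fun p => (h p).trans (h' p)⟩

theorem ExpDecay.integrate {a : ℕ → ℝ} (ha : ExpDecay a) (m : ℕ) :
    ExpDecay fun p => a p / (2 * p + m + 1) := by
  refine ha.mono fun p => ?_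
  rw [abs_div]
  refine div_le_self (abs_nonneg _) ?_
  rw [abs_of_nonneg (by positivity)]
  have : (0 : ℝ) ≤ 2 * p + m := by positivity
  linarith

theorem ExpDecay.integral {a : ℕ → ℝ} (ha : ExpDecay a) (m : ℕ) {x : ℝ} (hx : 0 ≤ x) :
    ∫ b in (0 : ℝ)..x, parSeries a m b = parSeries (fun p => a p / (2 * p + m + 1)) (m + 1) x := by
  obtain ⟨g, hg, h⟩ := ha.norm_le m (R := x)
  have hs := intervalIntegral.hasSum_integral_of_dominated_convergence (μ := volume) (a := 0)
    (b := x) (F := fun p b => a p * b ^ (2 * p + m)) (f := parSeries a m)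
    (fun p _ => g p) (fun p => by fun_prop) (fun p => Eventually.of_forall fun b hb => h p b ?_)
    (Eventually.of_forall fun _ _ => hg) (by simp)
    (Eventually.of_forall fun b _ => (ha.summable m b).hasSum)
  · rw [← hs.tsum_eq]
    refine tsum_congr fun p => ?_
    rw [intervalIntegral.integral_const_mul, integral_pow]
    push_cast
    simp
    ring
  · rw [uIoc_of_le hx] at hb
    exact ⟨by linarith [hb.1], hb.2⟩

theorem ExpDecay.parSeries_eq {a : ℕ → ℝ} (ha : ExpDecay a) (m : ℕ) (x : ℝ) :
    parSeries a m x = a 0 * x ^ m + ∑' p, a (p + 1) * x ^ (2 * p + m + 2) := by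
  rw [parSeries, (ha.summable m x).tsum_eq_zero_add]
  simp only [mul_zero, zero_add]
  congr 1
  exact tsum_congr fun p => by ring_nf

namespace ConvFun

/-- The restriction to `[0, π)` of a continuous real function. -/
def ofReal (f : ℝ → ℝ) (hf : ContinuousOn f (Ico 0 Real.pi)) : ConvFun :=
  mk (fun x => (f x : ℂ)) (Complex.continuous_ofReal.comp_continuousOn hf)

theorem ofReal_apply (f : ℝ → ℝ) (hf : ContinuousOn f (Ico 0 Real.pi)) {x : ℝ}
    (hx : x ∈ Ico 0 Real.pi) : ofReal f hf x = f x := mk_apply _ _ hx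

theorem const_mul_ofReal_apply (f : ℝ → ℝ) (hf : ContinuousOn f (Ico 0 Real.pi)) {x : ℝ}
    (hx : x ∈ Ico 0 Real.pi) : (const * ofReal f hf) x = (∫ b in (0 : ℝ)..x, f b : ℝ) := by
  rw [const_mul_apply _ hx, ← intervalIntegral.integral_ofReal]
  refine intervalIntegral.integral_congr fun b hb => ?_
  rw [uIcc_of_le hx.1] at hb
  exact ofReal_apply f hf ⟨hb.1, hb.2.trans_lt hx.2⟩

/-- The restriction to `[0, π)` of an entire power series. -/
def ofSeries (a : ℕ → ℝ) (m : ℕ) (ha : ExpDecay a) : ConvFun :=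
  ofReal (parSeries a m) (ha.continuous m).continuousOn

theorem ofSeries_apply {a : ℕ → ℝ} {m : ℕ} (ha : ExpDecay a) {x : ℝ} (hx : x ∈ Ico 0 Real.pi) :
    ofSeries a m ha x = parSeries a m x := ofReal_apply _ _ hx

theorem const_mul_ofSeries {a : ℕ → ℝ} {m : ℕ} (ha : ExpDecay a) :
    const * ofSeries a m ha = ofSeries _ (m + 1) (ha.integrate m) := by
  ext x hx
  rw [ofSeries, const_mul_ofReal_apply _ _ hx, ofSeries_apply _ hx, ha.integral m hx.1]

theorem const_mul_const_mul_ofSeries_apply {a : ℕ → ℝ} {m : ℕ} (ha : ExpDecay a) {x : ℝ}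
    (hx : x ∈ Ico 0 Real.pi) : (const * (const * ofSeries a m ha)) x =
      (∑' p : ℕ, a p / ((2 * p + m + 1) * (2 * p + m + 2)) * x ^ (2 * p + m + 2) : ℝ) := by
  rw [const_mul_ofSeries, const_mul_ofSeries, ofSeries_apply _ hx, parSeries]
  congr 1
  refine tsum_congr fun p => ?_
  push_cast
  rw [div_div, add_assoc (2 * p), add_assoc ((2 : ℝ) * p) m 1, add_assoc, add_assoc]
  norm_num
  left
  ring

end ConvFun

namespace ConvSeries

open ConvFun Unitization

theorem series_recurrence (u : ℝ) (m : ℕ) (a : ℕ → ℕ → ℝ) (ha : ∀ n, ExpDecay (a n)) (s : ℕ → ℝ)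
    (h00 : a 0 0 = s 0)
    (h10 : ∀ n : ℕ, a (n + 1) 0 + 8 * (a n 0 / ((2 * n + m + 1) * (2 * n + m + 2))) = s (n + 1))
    (h01 : ∀ p : ℕ, a 0 (p + 1) + 4 * u ^ 2 * (a 0 p / ((2 * p + m + 1) * (2 * p + m + 2))) = 0)
    (h11 : ∀ n p : ℕ, a (n + 1) (p + 1) + 4 * u ^ 2 * (a (n + 1) p /
        ((2 * p + 2 * (n + 1) + m + 1) * (2 * p + 2 * (n + 1) + m + 2))) + 8 * (a n (p + 1) /
        ((2 * (p + 1) + 2 * n + m + 1) * (2 * (p + 1) + 2 * n + m + 2))) = 0) (n : ℕ) :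
    ofSeries (a n) (2 * n + m) (ha n) +
      (4 * (u : ℂ) ^ 2) • (const * (const * ofSeries (a n) (2 * n + m) (ha n))) +
      (8 : ℂ) • (const * (const * shift (fun n => ofSeries (a n) (2 * n + m) (ha n)) n)) =
      mk (fun x => s n * x ^ (2 * n + m)) (by fun_prop) := by
  ext x hx
  simp only [ConvFun.add_apply, ConvFun.smul_apply]
  rw [const_mul_const_mul_ofSeries_apply _ hx, ofSeries_apply _ hx, mk_apply _ _ hx,
    (ha n).parSeries_eq]
  have hsum : ∀ n, Summable fun p : ℕ => a n p /
      ((2 * p + (2 * n + m : ℕ) + 1) * (2 * p + (2 * n + m : ℕ) + 2)) *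
        x ^ (2 * p + (2 * n + m) + 2) := fun n => by
    have := (((ha n).integrate (2 * n + m)).integrate (2 * n + m + 1)).summable (2 * n + m + 2) x
    refine this.congr fun p => ?_
    push_cast
    rw [div_div]
    ring_nf
  have hsum1 : ∀ n, Summable fun p : ℕ => a n (p + 1) * x ^ (2 * p + (2 * n + m) + 2) := fun n => by
    refine ((summable_nat_add_iff 1).2 ((ha n).summable (2 * n + m) x)).congr fun p => ?_
    ring_nf
  have key : ∀ t : ℂ, (∀ w : ℝ, t = w → a n 0 * x ^ (2 * n + m) + ((∑' p : ℕ, a n (p + 1) *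
      x ^ (2 * p + (2 * n + m) + 2)) + 4 * u ^ 2 * (∑' p : ℕ, a n p /
      ((2 * p + (2 * n + m : ℕ) + 1) * (2 * p + (2 * n + m : ℕ) + 2)) *
        x ^ (2 * p + (2 * n + m) + 2))) + 8 * w = s n * x ^ (2 * n + m)) → (∃ w : ℝ, t = w) →
      ((a n 0 * x ^ (2 * n + m) + ∑' p : ℕ, a n (p + 1) *
      x ^ (2 * p + (2 * n + m) + 2) : ℝ) : ℂ) + 4 * (u : ℂ) ^ 2 * ((∑' p : ℕ, a n p /
      ((2 * p + (2 * n + m : ℕ) + 1) * (2 * p + (2 * n + m : ℕ) + 2)) *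
        x ^ (2 * p + (2 * n + m) + 2) : ℝ) : ℂ) + 8 * t = s n * x ^ (2 * n + m) := by
    rintro t h ⟨w, rfl⟩
    have := congrArg (fun y : ℝ => (y : ℂ)) (h w rfl)
    simp only [Complex.ofReal_add, Complex.ofReal_mul, Complex.ofReal_pow, Complex.ofReal_ofNat] at this ⊢
    rw [← this]
    ring
  rw [← tsum_mul_left, ← (hsum1 n).tsum_add ((hsum n).mul_left _)] at key
  cases n with
  | zero =>
    refine key _ (fun w hw => ?_) ⟨0, by simp [shift]⟩
    have hw0 : w = 0 := by
      have : (w : ℂ) = 0 := by rw [← hw]; simp [shift]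
      exact_mod_cast this
    have hz : ∀ p : ℕ, a 0 (p + 1) * x ^ (2 * p + (2 * 0 + m) + 2) + 4 * u ^ 2 * (a 0 p /
      ((2 * p + (2 * 0 + m : ℕ) + 1) * (2 * p + (2 * 0 + m : ℕ) + 2)) *
        x ^ (2 * p + (2 * 0 + m) + 2)) = 0 := fun p => by
      have := h01 p
      simp only [mul_zero, zero_add]
      linear_combination x ^ (2 * p + m + 2) * this
    rw [hw0, tsum_congr hz, tsum_zero, h00]
    ring
  | succ n =>
    refine key _ (fun w hw => ?_)
      ⟨_, by simp only [shift]; exact const_mul_const_mul_ofSeries_apply _ hx⟩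
    simp only [shift] at hw
    rw [const_mul_const_mul_ofSeries_apply _ hx, Complex.ofReal_inj] at hw
    have hs := (summable_nat_add_iff 1).2 (hsum n)
    rw [← hw, (hsum n).tsum_eq_zero_add, mul_add (8 : ℝ), ← tsum_mul_left, add_add_add_comm,
      ← Summable.tsum_add _ (hs.mul_left _)]
    · have hz : ∀ p : ℕ, a (n + 1) (p + 1) * x ^ (2 * p + (2 * (n + 1) + m) + 2) +
          4 * u ^ 2 * (a (n + 1) p / ((2 * p + (2 * (n + 1) + m : ℕ) + 1) *
          (2 * p + (2 * (n + 1) + m : ℕ) + 2)) * x ^ (2 * p + (2 * (n + 1) + m) + 2)) +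
          8 * (a n (p + 1) / ((2 * (p + 1 : ℕ) + (2 * n + m : ℕ) + 1) *
          (2 * (p + 1 : ℕ) + (2 * n + m : ℕ) + 2)) * x ^ (2 * (p + 1) + (2 * n + m) + 2)) = 0 :=
        fun p => by
          have := h11 n p
          push_cast
          rw [show 2 * (p + 1) + (2 * n + m) + 2 = 2 * p + (2 * (n + 1) + m) + 2 by ring]
          rw [← add_assoc, ← add_assoc]
          linear_combination x ^ (2 * p + (2 * (n + 1) + m) + 2) * this
      rw [tsum_congr hz, tsum_zero, ← h10]
      push_cast
      ring_nf
    · exact (hsum1 (n + 1)).add ((hsum (n + 1)).mul_left _)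

end ConvSeries

/-! ### The two auxiliary series -/

open Nat in
/-- The coefficients of `cos (√(8r + 4u²) α)`. -/
def cosCoef (u : ℝ) (n p : ℕ) : ℝ :=
  (-8) ^ n * (-(4 * u ^ 2)) ^ p * (n + p).choose n / (2 * n + 2 * p)!

open Nat in
/-- The coefficients of `α` times the inverse Laplace transform of `arctan (2u / √(s² + 8r))`. -/
def atanCoef (u : ℝ) (n p : ℕ) : ℝ :=
  2 * u * u ^ (2 * p) * (-2) ^ (n + p) / ((n + p)! * n ! * (2 * p + 1)‼)

theorem expDecay_cosCoef (u : ℝ) (n : ℕ) : ExpDecay (cosCoef u n) := by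
  refine ⟨8 ^ n, 4 * u ^ 2, by positivity, fun p => ?_⟩
  have h1 : ((n + p).choose n : ℝ) * (p.factorial) ≤ (2 * n + 2 * p).factorial := by
    have h := Nat.choose_mul_factorial_mul_factorial (Nat.le_add_right n p)
    rw [Nat.add_sub_cancel_left] at h
    have h2 : (n + p).factorial ≤ (2 * n + 2 * p).factorial := Nat.factorial_le (by omega)
    have h3 : (n + p).choose n * p.factorial ≤ (n + p).factorial := by
      rw [← h]
      exact Nat.mul_le_mul_right _ (Nat.le_mul_of_pos_right _ n.factorial_pos)
    exact_mod_cast h3.trans h2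
  have e : |cosCoef u n p| = 8 ^ n * (4 * u ^ 2) ^ p *
      ((n + p).choose n / (2 * n + 2 * p).factorial) := by
    rw [cosCoef, abs_div, abs_mul, abs_mul, abs_pow, abs_pow, abs_neg, abs_neg,
      abs_of_nonneg (by positivity : (0 : ℝ) ≤ 4 * u ^ 2), Nat.abs_cast, Nat.abs_cast,
      abs_of_pos (by norm_num : (0 : ℝ) < 8)]
    ring
  rw [e, ← mul_div_assoc, mul_div_assoc, mul_assoc]
  refine mul_le_mul_of_nonneg_left ?_ (by positivity)
  rw [div_eq_mul_one_div ((4 * u ^ 2) ^ p)]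
  refine mul_le_mul_of_nonneg_left ?_ (by positivity)
  rw [div_le_div_iff₀ (by positivity) (by positivity), one_mul]
  exact h1

theorem expDecay_atanCoef (u : ℝ) (n : ℕ) : ExpDecay (atanCoef u n) := by
  refine ⟨2 * |u| * 2 ^ n, 2 * u ^ 2, by positivity, fun p => ?_⟩
  have h1 : (p.factorial : ℝ) ≤ ((n + p).factorial * n.factorial * (2 * p + 1).doubleFactorial : ℝ) := by
    have h2 : p.factorial ≤ (n + p).factorial := Nat.factorial_le (by omega)
    have : p.factorial ≤ (n + p).factorial * n.factorial * (2 * p + 1).doubleFactorial :=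
      h2.trans ((Nat.le_mul_of_pos_right _ n.factorial_pos).trans
        (Nat.le_mul_of_pos_right _ (Nat.doubleFactorial_pos _)))
    exact_mod_cast this
  rw [atanCoef, abs_div, abs_mul, abs_mul, abs_mul, abs_pow, abs_pow, abs_neg,
    abs_of_pos (by norm_num : (0 : ℝ) < 2), pow_mul, sq_abs,
    abs_of_nonneg (by positivity : (0 : ℝ) ≤ ((n + p).factorial * n.factorial *
      (2 * p + 1).doubleFactorial : ℝ)), mul_pow, pow_add]
  calc 2 * |u| * (u ^ 2) ^ p * (2 ^ n * 2 ^ p) / ((n + p).factorial * n.factorial *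
      (2 * p + 1).doubleFactorial : ℝ) ≤ 2 * |u| * (u ^ 2) ^ p * (2 ^ n * 2 ^ p) / p.factorial :=
        div_le_div_of_nonneg_left (by positivity) (by positivity) h1
    _ = _ := by ring

/-- The series `cos (√(8r + 4u²) α)`. -/
def cosSeries (u : ℝ) (n : ℕ) : ConvFun := ConvFun.ofSeries _ (2 * n + 0) (expDecay_cosCoef u n)

/-- The series `α` times the inverse Laplace transform of `arctan (2u / √(s² + 8r))`. -/
def atanSeries (u : ℝ) (n : ℕ) : ConvFun := ConvFun.ofSeries _ (2 * n + 1) (expDecay_atanCoef u n)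

namespace ConvSeries

open ConvFun Unitization

theorem discr_mul_ofSeq (u : ℝ) (f : ℕ → ConvFun) :
    (1 + 4 * (algebraMap ℂ ConvSeries u) ^ 2 * z ^ 2 + 8 * PowerSeries.X * z ^ 2) * ofSeq f =
    ofSeq fun n => f n + (4 * (u : ℂ) ^ 2) • (const * (const * f n)) +
      (8 : ℂ) • (const * (const * shift f n)) := by
  have h4 : (4 : ConvSeries) = algebraMap ℂ ConvSeries 4 := (map_ofNat (algebraMap ℂ ConvSeries) 4).symm
  have h8 : (8 : ConvSeries) = algebraMap ℂ ConvSeries 8 := (map_ofNat (algebraMap ℂ ConvSeries) 8).symm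
  have : (1 + 4 * (algebraMap ℂ ConvSeries u) ^ 2 * z ^ 2 + 8 * PowerSeries.X * z ^ 2) * ofSeq f =
      ofSeq f + algebraMap ℂ ConvSeries (4 * (u : ℂ) ^ 2) * (z * (z * ofSeq f)) +
      algebraMap ℂ ConvSeries 8 * (z * (z * (PowerSeries.X * ofSeq f))) := by
    rw [map_mul, map_pow, ← h4, ← h8]
    ring
  rw [this, X_mul_ofSeq]
  simp only [z_mul_ofSeq, algebraMap_mul_ofSeq, ofSeq_add]
  rfl

theorem discr_mul_cosSeries (u : ℝ) :
    (1 + 4 * (algebraMap ℂ ConvSeries u) ^ 2 * z ^ 2 + 8 * PowerSeries.X * z ^ 2) *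
      ofSeq (cosSeries u) = z := by
  rw [discr_mul_ofSeq, z_eq]
  congr 1
  funext n
  refine (series_recurrence u 0 (cosCoef u) (expDecay_cosCoef u)
    (fun n => if n = 0 then 1 else 0) ?_ ?_ ?_ ?_ n).trans ?_
  · simp [cosCoef]
  · intro n
    rw [if_neg n.succ_ne_zero]
    simp only [cosCoef, pow_zero, add_zero, mul_zero, Nat.choose_self, Nat.cast_one, mul_one,
      CharP.cast_eq_zero]
    rw [show 2 * (n + 1) = (2 * n + 1) + 1 by ring, Nat.factorial_succ, Nat.factorial_succ]
    push_cast
    field_simp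
    ring
  · intro p
    simp only [cosCoef, pow_zero, zero_add, mul_zero, Nat.choose_zero_right, Nat.cast_one, mul_one,
      one_mul, CharP.cast_eq_zero, add_zero]
    rw [show 2 * (p + 1) = (2 * p + 1) + 1 by ring, Nat.factorial_succ, Nat.factorial_succ]
    push_cast
    field_simp
    ring
  · intro n p
    simp only [cosCoef, CharP.cast_eq_zero, add_zero]
    rw [show 2 * (n + 1) + 2 * (p + 1) = (2 * n + 2 * p + 3) + 1 by ring, Nat.factorial_succ,
      show 2 * n + 2 * p + 3 = (2 * n + 2 * p + 2) + 1 by ring, Nat.factorial_succ,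
      show 2 * (n + 1) + 2 * p = 2 * n + 2 * p + 2 by ring,
      show 2 * n + 2 * (p + 1) = 2 * n + 2 * p + 2 by ring,
      show n + 1 + (p + 1) = (n + p + 1) + 1 by ring, Nat.choose_succ_succ,
      show n + 1 + p = n + p + 1 by ring, show n + (p + 1) = n + p + 1 by ring]
    push_cast
    field_simp
    ring
  · split_ifs with h
    · subst h
      ext x hx
      simp [mk_apply _ _ hx, const_apply hx]
    · ext x hx
      simp [mk_apply _ _ hx]

theorem const_mul_monomial (c : ℂ) (k : ℕ) : const * mk (fun x => c * (x : ℂ) ^ k) (by fun_prop) =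
    mk (fun x => c / (k + 1) * (x : ℂ) ^ (k + 1)) (by fun_prop) := by
  ext x hx
  rw [const_mul_apply _ hx, mk_apply _ _ hx]
  have : ∫ b in (0 : ℝ)..x, (mk (fun x => c * (x : ℂ) ^ k) (by fun_prop) : ConvFun) b =
      ∫ b in (0 : ℝ)..x, c * ((b ^ k : ℝ) : ℂ) := by
    refine intervalIntegral.integral_congr fun b hb => ?_
    rw [uIcc_of_le hx.1] at hb
    rw [mk_apply _ _ ⟨hb.1, hb.2.trans_lt hx.2⟩]
    push_cast; rfl
  rw [this, intervalIntegral.integral_const_mul, intervalIntegral.integral_ofReal, integral_pow]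
  push_cast
  simp
  ring

theorem discr_mul_atanSeries (u : ℝ) :
    (1 + 4 * (algebraMap ℂ ConvSeries u) ^ 2 * z ^ 2 + 8 * PowerSeries.X * z ^ 2) *
      ofSeq (atanSeries u) = 2 * algebraMap ℂ ConvSeries u * z ^ 2 *
        (1 - 4 * PowerSeries.X * mulVar (ofSeq besselY)) := by
  have h2 : (2 : ConvSeries) = algebraMap ℂ ConvSeries 2 := (map_ofNat (algebraMap ℂ ConvSeries) 2).symm
  have h8 : (8 : ConvSeries) = algebraMap ℂ ConvSeries 8 := (map_ofNat (algebraMap ℂ ConvSeries) 8).symm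
  have : 2 * algebraMap ℂ ConvSeries u * z ^ 2 *
        (1 - 4 * PowerSeries.X * mulVar (ofSeq besselY)) =
      algebraMap ℂ ConvSeries (2 * u) * (z * z) - algebraMap ℂ ConvSeries (8 * u) *
        (z * (z * (PowerSeries.X * mulVar (ofSeq besselY)))) := by
    rw [map_mul, map_mul, ← h2, ← h8]
    ring
  rw [discr_mul_ofSeq, this, mulVar_ofSeq, X_mul_ofSeq]
  conv_rhs => rw [z_eq]
  rw [← z_eq]
  conv_rhs => enter [1, 2, 2]; rw [z_eq]
  simp only [z_mul_ofSeq, algebraMap_mul_ofSeq, ofSeq_sub]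
  congr 1
  funext n
  refine (series_recurrence u 1 (atanCoef u) (expDecay_atanCoef u)
    (fun n => match n with
      | 0 => 2 * u
      | n + 1 => -(8 * u * (-2) ^ n / (n.factorial * (n + 1).factorial) /
        ((2 * n + 2) * (2 * n + 3)))) ?_ ?_ ?_ ?_ n).trans ?_
  · simp [atanCoef]
  · intro n
    simp only [atanCoef, pow_zero, add_zero, mul_zero, Nat.doubleFactorial,
      Nat.cast_one, mul_one]
    rw [Nat.factorial_succ]
    push_cast
    field_simp
    ring
  · intro p
    simp only [atanCoef, zero_add, Nat.factorial_zero, Nat.cast_one, mul_one]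
    rw [show 2 * (p + 1) + 1 = (2 * p + 1) + 2 by ring, Nat.doubleFactorial_add_two,
      Nat.factorial_succ]
    push_cast
    field_simp
    ring
  · intro n p
    simp only [atanCoef]
    rw [show 2 * (p + 1) + 1 = (2 * p + 1) + 2 by ring, Nat.doubleFactorial_add_two,
      show n + 1 + (p + 1) = n + p + 1 + 1 by ring, show n + 1 + p = n + p + 1 by ring,
      show n + (p + 1) = n + p + 1 by ring, Nat.factorial_succ (n + p + 1), Nat.factorial_succ n]
    push_cast
    field_simp
    ring
  · cases n with
    | zero =>
      ext x hx
      simp [shift, mk_apply _ _ hx, ← mulVar_const, mulVar_apply _ hx, const_apply hx]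
    | succ n =>
      have e : ConvFun.mulVar (besselY n) =
          mk (fun x => (-2) ^ n / (n.factorial * (n + 1).factorial) * (x : ℂ) ^ (2 * n + 1))
            (by fun_prop) := by
        ext x hx
        rw [mulVar_apply _ hx, besselY_apply _ hx, mk_apply _ _ hx]
        ring
      ext x hx
      simp only [shift, Pi.sub_apply, e, const_mul_monomial]
      rw [ConvFun.sub_apply, ConvFun.smul_apply, ConvFun.smul_apply, mk_apply _ _ hx,
        mk_apply _ _ hx, if_neg n.succ_ne_zero, mul_zero, ConvFun.zero_apply]
      push_cast
      rw [show (2 * (n : ℂ) + 1 + 1) = 2 * n + 2 by ring,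
        show (2 * (n : ℂ) + 2 + 1) = 2 * n + 3 by ring]
      have h3 : (2 * (n : ℂ) + 2) ≠ 0 := by exact_mod_cast (2 * n + 1).succ_ne_zero
      have h4 : (2 * (n : ℂ) + 3) ≠ 0 := by exact_mod_cast (2 * n + 2).succ_ne_zero
      have h5 : (n.factorial : ℂ) ≠ 0 := by exact_mod_cast n.factorial_ne_zero
      have h6 : ((n + 1).factorial : ℂ) ≠ 0 := by exact_mod_cast (n + 1).factorial_ne_zero
      field_simp
      ring

/-- `cos (√(8r + 4u²) α) - cot α · q(α)`, where `q` is `atanSeries`. -/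
def kernelFun (u : ℝ) (n : ℕ) (x : ℝ) : ℝ :=
  parSeries (cosCoef u n) (2 * n) x -
    Real.cos x * parSeries (atanCoef u n) (2 * n) x / Real.sinc x

theorem parSeries_add_one (a : ℕ → ℝ) (m : ℕ) (x : ℝ) :
    parSeries a (m + 1) x = x * parSeries a m x := by
  rw [parSeries, parSeries, ← tsum_mul_left]
  exact tsum_congr fun p => by ring

theorem mul_sinc (x : ℝ) : x * Real.sinc x = Real.sin x := by
  by_cases h : x = 0
  · simp [h]
  · rw [Real.sinc_of_ne_zero h, mul_div_cancel₀ _ h]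

theorem sinc_ne_zero {x : ℝ} (hx : x ∈ Ico 0 Real.pi) : Real.sinc x ≠ 0 := by
  rcases hx.1.eq_or_lt with h | h
  · simp [← h]
  · intro h0
    have := mul_sinc x
    rw [h0, mul_zero] at this
    exact (Real.sin_pos_of_pos_of_lt_pi h hx.2).ne this

theorem continuousOn_kernelFun (u : ℝ) (n : ℕ) :
    ContinuousOn (kernelFun u n) (Ico 0 Real.pi) := by
  refine ((expDecay_cosCoef u n).continuous _).continuousOn.sub (ContinuousOn.div ?_ ?_ ?_)
  · exact (Real.continuous_cos.mul ((expDecay_atanCoef u n).continuous _)).continuousOn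
  · exact Real.continuous_sinc.continuousOn
  · exact fun x hx => sinc_ne_zero hx

theorem sin_mul_kernelFun (u : ℝ) (n : ℕ) {x : ℝ} (hx : x ∈ Ico 0 Real.pi) :
    Real.sin x * kernelFun u n x = Real.sin x * parSeries (cosCoef u n) (2 * n) x -
      Real.cos x * parSeries (atanCoef u n) (2 * n + 1) x := by
  rw [kernelFun, parSeries_add_one, ← mul_sinc]
  have := sinc_ne_zero hx
  field_simp

/-- The kernel of the multiplicative convolution equation. -/
def kernel (u : ℝ) (n : ℕ) : ConvFun := ofReal (kernelFun u n) (continuousOn_kernelFun u n)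

theorem twist_kernel (u : ℝ) : twist Complex.I (ofSeq (kernel u)) -
    twist (-Complex.I) (ofSeq (kernel u)) =
    (twist Complex.I (ofSeq (cosSeries u)) -
      algebraMap ℂ ConvSeries Complex.I * twist Complex.I (ofSeq (atanSeries u))) -
    (twist (-Complex.I) (ofSeq (cosSeries u)) +
      algebraMap ℂ ConvSeries Complex.I * twist (-Complex.I) (ofSeq (atanSeries u))) := by
  simp only [twist_ofSeq, ofSeq_sub, ofSeq_add, algebraMap_mul_ofSeq]
  congr 1
  funext n
  ext x hx
  have h := congrArg (fun y : ℝ => (y : ℂ)) (sin_mul_kernelFun u n hx)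
  simp only [Complex.ofReal_mul, Complex.ofReal_sub, Complex.ofReal_sin, Complex.ofReal_cos] at h
  simp only [Pi.sub_apply, Pi.add_apply, ConvFun.sub_apply, ConvFun.add_apply, ConvFun.smul_apply,
    ConvFun.twist_apply _ _ hx, cosSeries, atanSeries, ofSeries_apply _ hx, kernel,
    ofReal_apply _ _ hx, add_zero]
  rw [Complex.sin, Complex.cos, show -(x : ℂ) * Complex.I = -Complex.I * x by ring,
    mul_comm (x : ℂ) Complex.I] at h
  linear_combination (2 * Complex.I) * h + (Complex.exp (Complex.I * x) -
    Complex.exp (-Complex.I * x)) * (kernelFun u n x - parSeries (cosCoef u n) (2 * n) x) *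
    Complex.I_mul_I

/-- If `V` satisfies the integral equation, then so does `α V - kernel * V`. -/
theorem integral_eq_sub {u : ℝ} {V : ℕ → ConvFun}
    (hV : ∀ n, ∀ x ∈ Ico 0 Real.pi, Complex.sin x * V n x =
      ∫ b in (0 : ℝ)..x, ((1 - 2 * u) * Complex.cos b * V n b -
        4 * Complex.sin b * shift (seqMul besselY V) n b)) (n : ℕ) {x : ℝ}
    (hx : x ∈ Ico 0 Real.pi) :
    Complex.sin x * (ConvFun.mulVar (V n) - seqMul (kernel u) V n) x =
      ∫ b in (0 : ℝ)..x, ((1 - 2 * u) * Complex.cos b *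
        (ConvFun.mulVar (V n) - seqMul (kernel u) V n) b -
        4 * Complex.sin b * shift (seqMul besselY
          fun n => ConvFun.mulVar (V n) - seqMul (kernel u) V n) n b) := by
  rw [← satisfiesEq_ofSeq_iff] at hV
  have hσz : ∀ w, IsLeftRegular (twist w z) := fun w => by
    rw [z, twist_C]; exact regular_C (ConvRing.regular_twist_z w)
  have hz : IsLeftRegular z := regular_C ConvRing.regular_z
  have key := SatisfiesEq.sub mulVar (twist Complex.I) (twist (-Complex.I))
    (c := ofSeq (cosSeries u)) (q := ofSeq (atanSeries u)) (M := ofSeq (kernel u))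
    (hσz _) (hσz _) hz (twist_z_mul _)
    (by simpa using twist_z_mul (-Complex.I)) (mulVar_twist _) (mulVar_twist _) mulVar_z mulVar_X
    (mulVar.map_algebraMap _) (twist_X _) (twist_X _) (AlgHom.commutes _ _) (AlgHom.commutes _ _)
    ofSeq_besselY (regular_discr _) (discr_mul_cosSeries u) (discr_mul_atanSeries u)
    (twist_kernel u) hV
  rw [mulVar_ofSeq, ofSeq_mul, ofSeq_sub] at key
  exact (satisfiesEq_ofSeq_iff _ _ _).1 key n x hx

/-- Uniqueness for the integral equation. -/
theorem eq_zero_of_integral_eq {u : ℝ} (hu : u < 0) {D : ℕ → ConvFun}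
    (hD : ∀ n, ∀ x ∈ Ico 0 Real.pi, Complex.sin x * D n x =
      ∫ b in (0 : ℝ)..x, ((1 - 2 * u) * Complex.cos b * D n b -
        4 * Complex.sin b * shift (seqMul besselY D) n b))
    (hb : ∀ n, ∃ K : ℝ, ∀ x ∈ Ioo 0 (Real.pi / 2), ‖D n x‖ ≤ K * x ^ (1 - 2 * u)) (n : ℕ) :
    D n = 0 := by
  induction n using Nat.strong_induction_on with
  | _ n ih =>
  have hsh : shift (seqMul besselY D) n = 0 := by
    cases n with
    | zero => rfl
    | succ n =>
      simp only [shift, seqMul]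
      refine Finset.sum_eq_zero fun p hp => ?_
      rw [Finset.HasAntidiagonal.mem_antidiagonal] at hp
      rw [ih p.2 (by omega), mul_zero]
  set E : ConvFun := mk (fun b => (1 - 2 * u) * Complex.cos b * D n b)
    (ContinuousOn.mul (by fun_prop) (D n).continuousOn) with hE
  have hEx : ∀ b ∈ Ico 0 Real.pi, E b = (1 - 2 * u) * Complex.cos b * D n b := fun b hb =>
    mk_apply _ _ hb
  have h1 : ∀ x ∈ Ico 0 Real.pi, Complex.sin x * D n x = ∫ b in (0 : ℝ)..x, E b := fun x hx => by
    rw [hD n x hx, hsh]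
    refine intervalIntegral.integral_congr fun b hb => ?_
    rw [uIcc_of_le hx.1] at hb
    rw [hEx b ⟨hb.1, hb.2.trans_lt hx.2⟩]
    simp
  set G : ℝ → ℂ := fun x => ((Real.sin x ^ (-(1 - 2 * u)) : ℝ) : ℂ) * ∫ b in (0 : ℝ)..x, E b
  have hG : ∀ x ∈ Ioo 0 Real.pi, HasDerivAt G 0 x := fun x hx => by
    have hs := Real.sin_pos_of_pos_of_lt_pi hx.1 hx.2
    have hd := ((Real.hasDerivAt_sin x).rpow_const (p := -(1 - 2 * u)) (Or.inl hs.ne')).ofReal_comp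
    have := hd.mul (hasDerivAt_integral E hx)
    refine this.congr_deriv ?_
    rw [← h1 x (Ioo_subset_Ico_self hx), hEx x (Ioo_subset_Ico_self hx),
      show -(1 - 2 * u) = (-(1 - 2 * u) - 1) + 1 by ring, Real.rpow_add_one hs.ne']
    push_cast
    ring_nf
  have hGc : ∀ x ∈ Ioo 0 Real.pi, ∀ y ∈ Ioo 0 Real.pi, G x = G y := fun x hx y hy =>
    isOpen_Ioo.is_const_of_deriv_eq_zero isPreconnected_Ioo
      (fun t ht => (hG t ht).differentiableAt.differentiableWithinAt)
      (fun t ht => (hG t ht).deriv) hx hy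
  have hGD : ∀ x ∈ Ioo 0 Real.pi, G x = ((Real.sin x ^ (2 * u) : ℝ) : ℂ) * D n x := fun x hx => by
    have hs := Real.sin_pos_of_pos_of_lt_pi hx.1 hx.2
    simp only [G]
    rw [← h1 x (Ioo_subset_Ico_self hx), show 2 * u = -(1 - 2 * u) + 1 by ring,
      Real.rpow_add_one hs.ne']
    push_cast
    ring_nf
  obtain ⟨K, hK⟩ := hb n
  have hlim : Tendsto G (𝓝[>] 0) (𝓝 0) := by
    have hb : ∀ x ∈ Ioo 0 (Real.pi / 2), ‖G x‖ ≤ (2 / Real.pi) ^ (2 * u) * K * x := fun x hx => by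
      have hx' : x ∈ Ioo 0 Real.pi := ⟨hx.1, by linarith [hx.2, Real.pi_pos]⟩
      have hs : 2 / Real.pi * x ≤ Real.sin x := Real.mul_le_sin hx.1.le hx.2.le
      have hp : 0 < 2 / Real.pi * x := mul_pos (by positivity) hx.1
      rw [hGD x hx', norm_mul, Complex.norm_real, Real.norm_eq_abs,
        abs_of_nonneg (Real.rpow_nonneg (hp.le.trans hs) _)]
      calc Real.sin x ^ (2 * u) * ‖D n x‖ ≤ (2 / Real.pi * x) ^ (2 * u) * (K * x ^ (1 - 2 * u)) :=
            mul_le_mul (Real.rpow_le_rpow_of_nonpos hp hs (by linarith)) (hK x hx)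
              (norm_nonneg _) (Real.rpow_nonneg hp.le _)
        _ = (2 / Real.pi) ^ (2 * u) * K * (x ^ (2 * u) * x ^ (1 - 2 * u)) := by
            rw [Real.mul_rpow (by positivity) hx.1.le]; ring
        _ = _ := by rw [← Real.rpow_add hx.1]; simp
    refine squeeze_zero_norm' (a := fun x => (2 / Real.pi) ^ (2 * u) * K * x) ?_ ?_
    · filter_upwards [Ioo_mem_nhdsGT (by positivity : 0 < Real.pi / 2)] with x hx using hb x hx
    · have : Tendsto (fun x : ℝ => (2 / Real.pi) ^ (2 * u) * K * x) (𝓝 0) (𝓝 0) := by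
        simpa using (tendsto_id (α := ℝ) (x := 𝓝 0)).const_mul ((2 / Real.pi) ^ (2 * u) * K)
      exact this.mono_left nhdsWithin_le_nhds
  have hG0 : ∀ x ∈ Ioo 0 Real.pi, G x = 0 := fun x hx => by
    refine tendsto_nhds_unique (tendsto_const_nhds.congr' ?_) hlim
    filter_upwards [Ioo_mem_nhdsGT Real.pi_pos] with y hy using hGc x hx y hy
  refine (eq_zero_of_const_mul 0 (D n) ?_).2
  rw [zero_smul, zero_add]
  ext x hx
  rw [const_mul_apply _ hx]
  have : ∀ᵐ b : ℝ, b ∈ uIoc 0 x → D n b = 0 := by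
    refine Eventually.of_forall fun b hb => ?_
    rw [uIoc_of_le hx.1] at hb
    have hb' : b ∈ Ioo 0 Real.pi := ⟨hb.1, hb.2.trans_lt hx.2⟩
    have h0 := hG0 b hb'
    rw [hGD b hb', mul_eq_zero] at h0
    refine h0.resolve_left ?_
    have hs := Real.sin_pos_of_pos_of_lt_pi hb'.1 hb'.2
    exact_mod_cast (Real.rpow_pos_of_pos hs _).ne'
  rw [intervalIntegral.integral_congr_ae this]
  simp

end ConvSeries

/-! ### Integrability of powers of the sine, and an asymptotic formula -/

theorem intervalIntegrable_sin_rpow {p : ℝ} (hp : -1 < p) :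
    IntervalIntegrable (fun x => Real.sin x ^ p) volume 0 Real.pi := by
  have h1 : IntervalIntegrable (fun x => Real.sin x ^ p) volume 0 (Real.pi / 2) := by
    rcases le_or_gt 0 p with h | h
    · exact (Real.continuous_sin.rpow_const fun _ => Or.inr h).intervalIntegrable _ _
    have hi : IntervalIntegrable (fun x : ℝ => (2 / Real.pi) ^ p * x ^ p) volume 0 (Real.pi / 2) :=
      (intervalIntegral.intervalIntegrable_rpow' hp).const_mul _
    refine hi.mono_fun (by fun_prop : Measurable fun x : ℝ => Real.sin x ^ p).aestronglyMeasurable ?_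
    rw [uIoc_of_le (by positivity)]
    filter_upwards [ae_restrict_mem measurableSet_Ioc] with x hx
    have hs : 2 / Real.pi * x ≤ Real.sin x := Real.mul_le_sin hx.1.le hx.2
    have hp' : 0 < 2 / Real.pi * x := mul_pos (by positivity) hx.1
    rw [← Real.mul_rpow (by positivity) hx.1.le, Real.norm_of_nonneg (Real.rpow_nonneg hp'.le _),
      Real.norm_of_nonneg (Real.rpow_nonneg (hp'.le.trans hs) _)]
    exact Real.rpow_le_rpow_of_nonpos hp' hs h.le
  refine h1.trans ?_
  have := h1.comp_sub_left Real.pi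
  simp only [Real.sin_pi_sub, sub_zero] at this
  rw [show Real.pi - Real.pi / 2 = Real.pi / 2 by ring] at this
  exact this.symm

theorem integrableOn_rpow_div_one_add {p : ℝ} (hp0 : 0 < p) (hp1 : p < 1) :
    IntegrableOn (fun x : ℝ => x ^ (p - 1) / (1 + x)) (Ioi 0) := by
  rw [← Ioc_union_Ioi_eq_Ioi zero_le_one]
  refine IntegrableOn.union ?_ ?_
  · have hi : IntegrableOn (fun x : ℝ => x ^ (p - 1)) (Ioc 0 1) :=
      (intervalIntegral.intervalIntegrable_rpow' (by linarith)).1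
    refine Integrable.mono' hi
      (by fun_prop : Measurable fun x : ℝ => x ^ (p - 1) / (1 + x)).aestronglyMeasurable ?_
    filter_upwards [ae_restrict_mem measurableSet_Ioc] with x hx
    have := hx.1
    rw [Real.norm_of_nonneg (by positivity)]
    exact div_le_self (by positivity) (by linarith)
  · have hi : IntegrableOn (fun x : ℝ => x ^ (p - 2)) (Ioi 1) :=
      integrableOn_Ioi_rpow_of_lt (by linarith) one_pos
    refine Integrable.mono' hi
      (by fun_prop : Measurable fun x : ℝ => x ^ (p - 1) / (1 + x)).aestronglyMeasurable ?_
    filter_upwards [ae_restrict_mem measurableSet_Ioi] with x hx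
    have hx0 : (0 : ℝ) < x := one_pos.trans hx
    rw [Real.norm_of_nonneg (by positivity), div_le_iff₀ (by positivity),
      show p - 1 = (p - 2) + 1 by ring, Real.rpow_add_one hx0.ne']
    exact mul_le_mul_of_nonneg_left (by linarith) (by positivity)

/-- The behaviour at `0` of the Stieltjes transform of a density with a power singularity. -/
theorem tendsto_stieltjes {p : ℝ} (hp0 : 0 < p) (hp1 : p < 1) {κ h : ℝ → ℝ} {k0 h0 A B : ℝ}
    (hκm : Measurable κ) (hhm : Measurable h) (hκA : ∀ x, |κ x| ≤ A) (hhB : ∀ x, |h x| ≤ B)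
    (hκ : Tendsto κ (𝓝[>] 0) (𝓝 k0)) (hh : Tendsto h (𝓝[>] 0) (𝓝 h0)) :
    Tendsto (fun ε : ℝ => ε ^ (1 - p) * ∫ t in Ioi 0, κ (ε + t) / (ε + t) * (t ^ (p - 1) * h t))
      (𝓝[>] 0) (𝓝 (k0 * h0 * ∫ x in Ioi (0 : ℝ), x ^ (p - 1) / (1 + x))) := by
  have hA : 0 ≤ A := (abs_nonneg _).trans (hκA 0)
  have hcv : ∀ ε ∈ Ioi (0 : ℝ), ε ^ (1 - p) * ∫ t in Ioi 0, κ (ε + t) / (ε + t) *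
      (t ^ (p - 1) * h t) =
      ∫ x in Ioi (0 : ℝ), κ (ε * (1 + x)) * h (ε * x) * (x ^ (p - 1) / (1 + x)) := fun ε hε => by
    have hε' : 0 < ε := hε
    have := integral_comp_mul_left_Ioi'
      (fun t => κ (ε + t) / (ε + t) * (t ^ (p - 1) * h t)) 0 hε'
    rw [mul_zero] at this
    rw [← this, smul_eq_mul, ← mul_assoc, ← integral_const_mul]
    refine setIntegral_congr_fun measurableSet_Ioi fun x hx => ?_
    have hx' : 0 < x := hx
    rw [show ε + ε * x = ε * (1 + x) by ring, Real.mul_rpow hε'.le hx'.le]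
    have e : ε ^ (1 - p) * ε ^ (p - 1) = 1 := by
      rw [← Real.rpow_add hε']; simp
    have h1 : (1 + x) ≠ 0 := by positivity
    field_simp
    linear_combination κ (ε * (1 + x)) * h (ε * x) * e
  rw [← integral_const_mul]
  refine Tendsto.congr' (f₁ := fun ε => ∫ x in Ioi (0 : ℝ),
    κ (ε * (1 + x)) * h (ε * x) * (x ^ (p - 1) / (1 + x))) ?_ ?_
  · filter_upwards [self_mem_nhdsWithin] with ε hε using (hcv ε hε).symm
  refine tendsto_integral_filter_of_dominated_convergence
    (fun x => A * B * (x ^ (p - 1) / (1 + x))) ?_ ?_ ?_ ?_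
  · exact Eventually.of_forall fun ε => by fun_prop
  · refine Eventually.of_forall fun ε => ?_
    filter_upwards [ae_restrict_mem measurableSet_Ioi] with x hx
    have hx' : (0 : ℝ) < x := hx
    rw [norm_mul, norm_mul, Real.norm_of_nonneg (by positivity : 0 ≤ x ^ (p - 1) / (1 + x))]
    refine mul_le_mul_of_nonneg_right ?_ (by positivity)
    exact mul_le_mul (hκA _) (hhB _) (abs_nonneg _) hA
  · exact (integrableOn_rpow_div_one_add hp0 hp1).const_mul _
  · filter_upwards [ae_restrict_mem measurableSet_Ioi] with x hx
    have hx' : (0 : ℝ) < x := hx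
    have hmul : ∀ c : ℝ, 0 < c → Tendsto (fun ε : ℝ => ε * c) (𝓝[>] 0) (𝓝[>] 0) := fun c hc => by
      refine tendsto_nhdsWithin_iff.2 ⟨?_, ?_⟩
      · have : Tendsto (fun ε : ℝ => ε * c) (𝓝 0) (𝓝 (0 * c)) := tendsto_id.mul_const c
        rw [zero_mul] at this
        exact this.mono_left nhdsWithin_le_nhds
      · filter_upwards [self_mem_nhdsWithin] with ε hε
        exact mul_pos hε hc
    exact ((hκ.comp (hmul (1 + x) (by positivity))).mul (hh.comp (hmul x hx'))).mul_const _

/-! ### The integral equation of the generating function of a path -/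

/-- The coefficients of the Bessel series, as real functions. -/
def besselFun (n : ℕ) (x : ℝ) : ℝ := (-2) ^ n * x ^ (2 * n) / (n.factorial * (n + 1).factorial)

/-- The inner integral of the equation of the generating function of a path. -/
def innerConv (u : ℝ) (w : ℕ → ℝ → ℝ) (n : ℕ) (s : ℝ) : ℝ :=
  ∑ p ∈ Finset.HasAntidiagonal.antidiagonal n,
    ∫ b in (0 : ℝ)..s, besselFun p.1 (s - b) * (Real.sin b ^ (-(2 * u)) * w p.2 b)

/-- The integral equation of the generating function of a path. -/
structure IsPathSolution (u : ℝ) (w : ℕ → ℝ → ℝ) : Prop where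
  cont : ∀ n, ContinuousOn (w n) (Icc 0 Real.pi)
  zero : ∀ x ∈ Icc 0 Real.pi, w 0 x = 1
  succ : ∀ n, ∀ x ∈ Icc 0 Real.pi, w (n + 1) x =
    -4 * ∫ s in (0 : ℝ)..x, Real.sin s ^ (2 * u) * innerConv u w n s

/-- The inner integral, shifted by one. -/
def innerShift (u : ℝ) (w : ℕ → ℝ → ℝ) : ℕ → ℝ → ℝ
  | 0 => 0
  | n + 1 => innerConv u w n

namespace IsPathSolution

variable {u : ℝ} {w : ℕ → ℝ → ℝ}

/-- The product of the solution with the integrating factor. -/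
def prodFun (u : ℝ) (w : ℕ → ℝ → ℝ) (n : ℕ) (x : ℝ) : ℝ := Real.sin x ^ (-(2 * u)) * w n x

/-- The derivative of `prodFun`. -/
def derivFun (u : ℝ) (w : ℕ → ℝ → ℝ) (n : ℕ) (x : ℝ) : ℝ :=
  -(2 * u) * Real.sin x ^ (-(2 * u) - 1) * Real.cos x * w n x - 4 * innerShift u w n x

theorem continuousOn_prodFun (hw : IsPathSolution u w) (hu : u < 0) (n : ℕ) :
    ContinuousOn (prodFun u w n) (Icc 0 Real.pi) :=
  ((Real.continuous_sin.rpow_const fun _ => Or.inr (by linarith)).continuousOn).mul (hw.cont n)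

open ConvFun ConvSeries

/-- The product of the solution with the integrating factor, in the convolution algebra. -/
def prod (hw : IsPathSolution u w) (hu : u < 0) (n : ℕ) : ConvFun :=
  ofReal (prodFun u w n) ((hw.continuousOn_prodFun hu n).mono Ico_subset_Icc_self)

theorem prod_apply (hw : IsPathSolution u w) (hu : u < 0) (n : ℕ) {x : ℝ}
    (hx : x ∈ Ico 0 Real.pi) : hw.prod hu n x = prodFun u w n x := ofReal_apply _ _ hx

theorem innerShift_eq (hw : IsPathSolution u w) (hu : u < 0) (n : ℕ) {x : ℝ}
    (hx : x ∈ Ico 0 Real.pi) :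
    (innerShift u w n x : ℂ) = shift (seqMul besselY (hw.prod hu)) n x := by
  cases n with
  | zero => simp [innerShift, shift]
  | succ n =>
    simp only [innerShift, shift, innerConv, seqMul, ConvFun.sum_apply, Complex.ofReal_sum]
    refine Finset.sum_congr rfl fun p _ => ?_
    rw [← intervalIntegral.integral_ofReal, mul_apply _ _ hx]
    refine intervalIntegral.integral_congr fun b hb => ?_
    rw [uIcc_of_le hx.1] at hb
    rw [prod_apply _ _ _ ⟨hb.1, hb.2.trans_lt hx.2⟩,
      besselY_apply _ ⟨by linarith [hb.2], by linarith [hb.1, hx.2]⟩, besselFun, prodFun]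
    push_cast
    ring

theorem continuousOn_innerShift (hw : IsPathSolution u w) (hu : u < 0) (n : ℕ) :
    ContinuousOn (innerShift u w n) (Ico 0 Real.pi) := by
  have h := (shift (seqMul besselY (hw.prod hu)) n).continuousOn
  have h2 := Complex.continuous_re.comp_continuousOn h
  refine h2.congr fun x hx => ?_
  rw [Function.comp, ← hw.innerShift_eq hu n hx, Complex.ofReal_re]

theorem exists_bound_innerShift (hw : IsPathSolution u w) (hu : u < 0) (n : ℕ) :
    ∃ C, ∀ x ∈ Ico 0 Real.pi, |innerShift u w n x| ≤ C := by
  cases n with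
  | zero => exact ⟨0, fun x _ => by simp [innerShift]⟩
  | succ n =>
    have hb : ∀ i, ∃ C, ∀ x ∈ Icc 0 Real.pi, ‖besselFun i x‖ ≤ C := fun i =>
      isCompact_Icc.exists_bound_of_continuousOn (by unfold besselFun; fun_prop)
    have hp : ∀ i, ∃ C, ∀ x ∈ Icc 0 Real.pi, ‖prodFun u w i x‖ ≤ C := fun i =>
      isCompact_Icc.exists_bound_of_continuousOn (hw.continuousOn_prodFun hu i)
    choose B hB using hb
    choose P hP using hp
    refine ⟨∑ p ∈ Finset.HasAntidiagonal.antidiagonal n, B p.1 * P p.2 * Real.pi, fun x hx => ?_⟩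
    simp only [innerShift, innerConv]
    refine (Finset.abs_sum_le_sum_abs _ _).trans (Finset.sum_le_sum fun p _ => ?_)
    have h0 : (0 : ℝ) ∈ Icc 0 Real.pi := ⟨le_rfl, Real.pi_pos.le⟩
    have hB0 := (norm_nonneg _).trans (hB p.1 0 h0)
    have hP0 := (norm_nonneg _).trans (hP p.2 0 h0)
    have := intervalIntegral.norm_integral_le_of_norm_le_const (a := 0) (b := x)
      (f := fun b => besselFun p.1 (x - b) * (Real.sin b ^ (-(2 * u)) * w p.2 b))
      (C := B p.1 * P p.2) fun b hb => by
        rw [uIoc_of_le hx.1] at hb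
        rw [norm_mul]
        exact mul_le_mul (hB _ _ ⟨by linarith [hb.2], by linarith [hb.1, hx.2]⟩)
          (hP _ _ ⟨hb.1.le, hb.2.trans hx.2.le⟩) (norm_nonneg _) hB0
    rw [sub_zero, abs_of_nonneg hx.1] at this
    exact this.trans (mul_le_mul_of_nonneg_left hx.2.le (by positivity))

theorem intervalIntegrable_innerShift (hw : IsPathSolution u w) (hu : u < 0) (n : ℕ) :
    IntervalIntegrable (innerShift u w n) volume 0 Real.pi := by
  obtain ⟨C, hC⟩ := hw.exists_bound_innerShift hu n
  rw [intervalIntegrable_iff_integrableOn_Ico_of_le Real.pi_pos.le]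
  refine Integrable.mono' (g := fun _ => C) (integrableOn_const (by simp))
    ((hw.continuousOn_innerShift hu n).aestronglyMeasurable measurableSet_Ico) ?_
  filter_upwards [ae_restrict_mem measurableSet_Ico] with x hx using hC x hx

theorem intervalIntegrable_derivFun (hw : IsPathSolution u w) (hu : u < 0) (n : ℕ) :
    IntervalIntegrable (derivFun u w n) volume 0 Real.pi := by
  unfold derivFun
  refine IntervalIntegrable.sub ?_ ((hw.intervalIntegrable_innerShift hu n).const_mul _)
  refine IntervalIntegrable.mul_continuousOn (IntervalIntegrable.mul_continuousOn
    ((intervalIntegrable_sin_rpow (by linarith)).const_mul _) (by fun_prop)) ?_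
  rw [uIcc_of_le Real.pi_pos.le]
  exact hw.cont n

theorem hasDerivAt_prodFun (hw : IsPathSolution u w) (hu : u < 0) (hu' : -(1 / 2) < u) (n : ℕ)
    {x : ℝ} (hx : x ∈ Ioo 0 Real.pi) : HasDerivAt (prodFun u w n) (derivFun u w n x) x := by
  have hs := Real.sin_pos_of_pos_of_lt_pi hx.1 hx.2
  have hd := (Real.hasDerivAt_sin x).rpow_const (p := -(2 * u)) (Or.inl hs.ne')
  have hwd : HasDerivAt (w n) (-4 * (Real.sin x ^ (2 * u) * innerShift u w n x)) x := by
    cases n with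
    | zero =>
      simp only [innerShift, Pi.zero_apply, mul_zero]
      refine (hasDerivAt_const x (1 : ℝ)).congr_of_eventuallyEq ?_
      filter_upwards [Icc_mem_nhds hx.1 hx.2] with y hy using hw.zero y hy
    | succ n =>
      have hev : w (n + 1) =ᶠ[𝓝 x] fun x => -4 * ∫ s in (0 : ℝ)..x,
          Real.sin s ^ (2 * u) * innerConv u w n s := by
        filter_upwards [Icc_mem_nhds hx.1 hx.2] with y hy using hw.succ n y hy
      refine HasDerivAt.congr_of_eventuallyEq (HasDerivAt.const_mul _ ?_) hev
      have hcS := hw.continuousOn_innerShift hu (n + 1)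
      have hcs : ContinuousOn (fun s => Real.sin s ^ (2 * u)) (Ioo 0 Real.pi) := fun y hy =>
        (Real.continuous_sin.continuousAt.rpow_const (Or.inl
          (Real.sin_pos_of_pos_of_lt_pi hy.1 hy.2).ne')).continuousWithinAt
      have hc : ContinuousOn (fun s => Real.sin s ^ (2 * u) * innerConv u w n s)
          (Ioo 0 Real.pi) := hcs.mul (hcS.mono Ioo_subset_Ico_self)
      refine intervalIntegral.integral_hasDerivAt_right ?_
        (hc.stronglyMeasurableAtFilter isOpen_Ioo x hx)
        (hc.continuousAt (isOpen_Ioo.mem_nhds hx))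
      refine IntervalIntegrable.mul_continuousOn ?_ ?_
      · refine (intervalIntegrable_sin_rpow (by linarith : -1 < 2 * u)).mono_set ?_
        rw [uIcc_of_le hx.1.le, uIcc_of_le Real.pi_pos.le]
        exact Icc_subset_Icc_right hx.2.le
      · rw [uIcc_of_le hx.1.le]
        exact hcS.mono (Icc_subset_Ico_right hx.2)
  refine (hd.mul hwd).congr_deriv ?_
  rw [derivFun]
  have : Real.sin x ^ (-(2 * u)) * Real.sin x ^ (2 * u) = 1 := by
    rw [← Real.rpow_add hs]; simp
  linear_combination (-4 * innerShift u w n x) * this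

theorem prodFun_zero (hu : u < 0) (n : ℕ) : prodFun u w n 0 = 0 := by
  simp [prodFun, Real.zero_rpow (by linarith : -(2 * u) ≠ 0)]

theorem integral_derivFun (hw : IsPathSolution u w) (hu : u < 0) (hu' : -(1 / 2) < u) (n : ℕ)
    {x : ℝ} (hx : x ∈ Icc 0 Real.pi) :
    ∫ b in (0 : ℝ)..x, derivFun u w n b = prodFun u w n x := by
  rw [intervalIntegral.integral_eq_sub_of_hasDerivAt_of_le hx.1
    ((hw.continuousOn_prodFun hu n).mono (Icc_subset_Icc_right hx.2))
    (fun y hy => hw.hasDerivAt_prodFun hu hu' n ⟨hy.1, hy.2.trans_le hx.2⟩), prodFun_zero hu,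
    sub_zero]
  refine (hw.intervalIntegrable_derivFun hu n).mono_set ?_
  rw [uIcc_of_le hx.1, uIcc_of_le Real.pi_pos.le]
  exact Icc_subset_Icc_right hx.2

theorem integral_eq (hw : IsPathSolution u w) (hu : u < 0) (hu' : -(1 / 2) < u) (n : ℕ) {x : ℝ}
    (hx : x ∈ Ico 0 Real.pi) : Complex.sin x * hw.prod hu n x =
      ∫ b in (0 : ℝ)..x, ((1 - 2 * u) * Complex.cos b * hw.prod hu n b -
        4 * Complex.sin b * shift (seqMul besselY (hw.prod hu)) n b) := by
  have hcP := (hw.continuousOn_prodFun hu n)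
  have hcS := hw.continuousOn_innerShift hu n
  have h : ∫ b in (0 : ℝ)..x, ((1 - 2 * u) * Real.cos b * prodFun u w n b -
      4 * Real.sin b * innerShift u w n b) = Real.sin x * prodFun u w n x := by
    rw [intervalIntegral.integral_eq_sub_of_hasDerivAt_of_le
      (f := fun x => Real.sin x * prodFun u w n x) hx.1]
    · simp
    · exact Real.continuous_sin.continuousOn.mul (hcP.mono (Icc_subset_Icc_right hx.2.le))
    · intro y hy
      have hy' : y ∈ Ioo 0 Real.pi := ⟨hy.1, hy.2.trans hx.2⟩
      refine ((Real.hasDerivAt_sin y).mul (hw.hasDerivAt_prodFun hu hu' n hy')).congr_deriv ?_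
      have hs := Real.sin_pos_of_pos_of_lt_pi hy'.1 hy'.2
      have : Real.sin y ^ (-(2 * u)) = Real.sin y ^ (-(2 * u) - 1) * Real.sin y := by
        rw [← Real.rpow_add_one hs.ne']; congr 1; ring
      rw [derivFun, prodFun, this]
      ring
    · apply ContinuousOn.intervalIntegrable
      rw [uIcc_of_le hx.1]
      exact ((by fun_prop : ContinuousOn (fun b => (1 - 2 * u) * Real.cos b) (Icc 0 x)).mul
        (hcP.mono (Icc_subset_Icc_right hx.2.le))).sub
        ((by fun_prop : ContinuousOn (fun b => 4 * Real.sin b) (Icc 0 x)).mul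
        (hcS.mono (Icc_subset_Ico_right hx.2)))
  rw [prod_apply _ _ _ hx, ← Complex.ofReal_sin, ← Complex.ofReal_mul, ← h,
    ← intervalIntegral.integral_ofReal]
  refine intervalIntegral.integral_congr fun b hb => ?_
  rw [uIcc_of_le hx.1] at hb
  have hb' : b ∈ Ico 0 Real.pi := ⟨hb.1, hb.2.trans_lt hx.2⟩
  rw [prod_apply _ _ _ hb', ← hw.innerShift_eq hu n hb']
  push_cast
  ring

/-- The multiplicative convolution equation. -/
theorem mul_prod_eq (hw : IsPathSolution u w) (hu : u < 0) (hu' : -(1 / 2) < u) (n : ℕ) :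
    ConvFun.mulVar (hw.prod hu n) = seqMul (kernel u) (hw.prod hu) n := by
  rw [← sub_eq_zero]
  refine eq_zero_of_integral_eq hu
    (D := fun n => ConvFun.mulVar (hw.prod hu n) - seqMul (kernel u) (hw.prod hu) n)
    (fun n x hx => integral_eq_sub (fun n x hx => hw.integral_eq hu hu' n hx) n hx) ?_ n
  intro n
  have hwb : ∀ i, ∃ C, ∀ x ∈ Icc 0 Real.pi, ‖w i x‖ ≤ C := fun i =>
    isCompact_Icc.exists_bound_of_continuousOn (hw.cont i)
  have hkb : ∀ i, ∃ C, ∀ x ∈ Icc 0 (Real.pi / 2), ‖kernel u i x‖ ≤ C := fun i =>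
    isCompact_Icc.exists_bound_of_continuousOn ((kernel u i).continuousOn.mono
      (Icc_subset_Ico_right (by linarith [Real.pi_pos])))
  choose C hC using hwb
  choose A hA using hkb
  have hπ := Real.pi_pos
  have hC0 : ∀ i, 0 ≤ C i := fun i => (norm_nonneg _).trans (hC i 0 ⟨le_rfl, hπ.le⟩)
  have hA0 : ∀ i, 0 ≤ A i := fun i => (norm_nonneg _).trans (hA i 0 ⟨le_rfl, by linarith⟩)
  have hV : ∀ i, ∀ x ∈ Ioo 0 (Real.pi / 2), ∀ b ∈ Icc 0 x,
      ‖hw.prod hu i b‖ ≤ C i * x ^ (-(2 * u)) := fun i x hx b hb => by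
    have hbπ : b ∈ Ico 0 Real.pi := ⟨hb.1, by linarith [hb.2, hx.2]⟩
    have hs0 : 0 ≤ Real.sin b := Real.sin_nonneg_of_nonneg_of_le_pi hb.1 hbπ.2.le
    rw [prod_apply _ _ _ hbπ, Complex.norm_real, prodFun, norm_mul, mul_comm,
      Real.norm_of_nonneg (Real.rpow_nonneg hs0 _)]
    refine mul_le_mul (hC i b (Ico_subset_Icc_self hbπ)) ?_ (Real.rpow_nonneg hs0 _) (hC0 i)
    exact Real.rpow_le_rpow hs0 ((Real.sin_le hb.1).trans hb.2) (by linarith)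
  refine ⟨C n + ∑ p ∈ Finset.HasAntidiagonal.antidiagonal n, A p.1 * C p.2, fun x hx => ?_⟩
  have hxπ : x ∈ Ico 0 Real.pi := ⟨hx.1.le, by linarith [hx.2]⟩
  have hxp : x ^ (1 - 2 * u) = x ^ (-(2 * u)) * x := by
    rw [← Real.rpow_add_one hx.1.ne']; congr 1; ring
  rw [ConvFun.sub_apply, ConvFun.mulVar_apply _ hxπ, seqMul, ConvFun.sum_apply, add_mul,
    Finset.sum_mul]
  refine (norm_sub_le _ _).trans (add_le_add ?_ ((norm_sum_le _ _).trans
    (Finset.sum_le_sum fun p _ => ?_)))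
  · rw [norm_mul, Complex.norm_real, Real.norm_of_nonneg hx.1.le, hxp, ← mul_assoc, mul_comm]
    exact mul_le_mul_of_nonneg_right (hV n x hx x ⟨hx.1.le, le_rfl⟩) hx.1.le
  · rw [mul_apply _ _ hxπ]
    refine (intervalIntegral.norm_integral_le_of_norm_le_const
      (C := A p.1 * (C p.2 * x ^ (-(2 * u)))) fun b hb => ?_).trans ?_
    · rw [uIoc_of_le hx.1.le] at hb
      rw [norm_mul]
      exact mul_le_mul (hA _ _ ⟨by linarith [hb.2], by linarith [hb.1, hx.2]⟩)
        (hV _ x hx b ⟨hb.1.le, hb.2⟩) (norm_nonneg _) (hA0 _)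
    · rw [sub_zero, abs_of_pos hx.1, hxp]
      apply le_of_eq
      ring

end IsPathSolution

theorem continuousOn_conv_of_integrable {F g : ℝ → ℂ} (hF : Continuous F) {A : ℝ} (hA : ∀ x, ‖F x‖ ≤ A) {a : ℝ}
    (hg : IntegrableOn g (Ioc 0 a)) : ContinuousOn (conv F g) (Icc 0 a) := by
  set g0 : ℝ → ℂ := (Ioc 0 a).indicator g
  have hg0 : Integrable g0 := hg.integrable_indicator measurableSet_Ioc
  have hcont : Continuous fun y => ∫ b, (Iic y).indicator (fun b => F (y - b) * g0 b) b := by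
    rw [continuous_iff_continuousAt]
    intro y
    refine continuousAt_of_dominated (bound := fun b => A * ‖g0 b‖) ?_ ?_ (hg0.norm.const_mul A) ?_
    · exact Eventually.of_forall fun x => ((by fun_prop : Continuous fun b =>
        F (x - b)).aestronglyMeasurable.mul hg0.aestronglyMeasurable).indicator measurableSet_Iic
    · refine Eventually.of_forall fun x => Eventually.of_forall fun b => ?_
      refine (norm_indicator_le_norm_self _ _).trans ?_
      rw [norm_mul]
      exact mul_le_mul_of_nonneg_right (hA _) (norm_nonneg _)
    · have : ∀ᵐ b : ℝ, b ≠ y := by simp [ae_iff, measure_singleton]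
      filter_upwards [this] with b hb
      rcases lt_or_gt_of_ne hb with h | h
      · refine ContinuousAt.congr (f := fun x => F (x - b) * g0 b) (by fun_prop) ?_
        filter_upwards [Ioi_mem_nhds h] with x hx
        rw [indicator_of_mem (show b ∈ Iic x from (mem_Ioi.1 hx).le)]
      · refine ContinuousAt.congr (f := fun _ => 0) continuousAt_const ?_
        filter_upwards [Iio_mem_nhds h] with x hx
        rw [indicator_of_notMem (show b ∉ Iic x from not_le.2 (mem_Iio.1 hx))]
  refine hcont.continuousOn.congr fun y hy => ?_
  simp only [conv]
  rw [intervalIntegral.integral_of_le hy.1, integral_indicator measurableSet_Iic]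
  have : ∀ b, F (y - b) * g0 b = (Ioc 0 a).indicator (fun b => F (y - b) * g b) b := fun b => by
    by_cases hb : b ∈ Ioc 0 a <;> simp [g0, hb]
  simp_rw [this]
  rw [setIntegral_indicator measurableSet_Ioc]
  congr 2
  ext b
  simp only [mem_inter_iff, mem_Iic, mem_Ioc]
  constructor
  · rintro ⟨h0, h1⟩; exact ⟨h1, h0, h1.trans hy.2⟩
  · rintro ⟨h1, h0, _⟩; exact ⟨h0, h1⟩

namespace IsPathSolution

open ConvFun ConvSeries

variable {u : ℝ} {w : ℕ → ℝ → ℝ}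

theorem conv_prod (hw : IsPathSolution u w) (hu : u < 0) (hu' : -(1 / 2) < u) (f : ConvFun) (n : ℕ)
    {a : ℝ} (ha : a ∈ Ico 0 Real.pi) :
    ContinuousOn (conv f fun x => (derivFun u w n x : ℂ)) (Icc 0 a) ∧
    ∀ x ∈ Icc 0 a, (f * hw.prod hu n) x =
      ∫ s in (0 : ℝ)..x, conv f (fun x => (derivFun u w n x : ℂ)) s := by
  have hsub : ∀ {x}, x ∈ Icc 0 a → x ∈ Ico 0 Real.pi := fun hx => ⟨hx.1, hx.2.trans_lt ha.2⟩
  set g : ℝ → ℂ := fun x => (derivFun u w n x : ℂ) with hgdef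
  have hgi : ∀ x ∈ Icc 0 a, IntegrableOn g (Ioc 0 x) := fun x hx => by
    have := (hw.intervalIntegrable_derivFun hu n).1
    exact (this.mono_set (Ioc_subset_Ioc_right (hsub hx).2.le)).ofReal
  set F : ℝ → ℂ := IccExtend ha.1 ((Icc 0 a).domRestrict f) with hFdef
  have hF : Continuous F :=
    ((f.continuousOn.mono (Icc_subset_Ico_right ha.2)).domRestrict).Icc_extend'
  have hfF : EqOn f F (Icc 0 a) := fun x hx => by rw [hFdef, IccExtend_of_mem _ _ hx]; rfl
  obtain ⟨A, hA⟩ := isCompact_Icc.exists_bound_of_continuousOn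
    (f.continuousOn.mono (Icc_subset_Ico_right ha.2))
  have hFA : ∀ x, ‖F x‖ ≤ A := fun x => hA _ (projIcc 0 a ha.1 x).2
  have hcg : EqOn (conv f g) (conv F g) (Icc 0 a) := fun x hx =>
    conv_congr hx.1 (hfF.mono (Icc_subset_Icc_right hx.2)) (fun _ _ => rfl)
  refine ⟨(continuousOn_conv_of_integrable hF hFA (hgi a ⟨ha.1, le_rfl⟩)).congr hcg, fun x hx => ?_⟩
  have h1 : ∀ G : ℝ → ℂ, ∀ y, conv (fun _ => 1) G y = ∫ s in (0 : ℝ)..y, G s := fun G y => by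
    simp [conv]
  have e1 : (f * hw.prod hu n) x = conv F (conv (fun _ => 1) g) x := by
    rw [mul_apply _ _ (hsub hx)]
    refine conv_congr hx.1 (hfF.mono (Icc_subset_Icc_right hx.2)) fun b hb => ?_
    have hb' : b ∈ Icc 0 a := ⟨hb.1, hb.2.trans hx.2⟩
    rw [h1, prod_apply _ _ _ (hsub hb'), hgdef, intervalIntegral.integral_ofReal,
      hw.integral_derivFun hu hu' n ⟨hb.1, (hsub hb').2.le⟩]
  have e2 : conv F (fun _ => 1) = conv (fun _ => 1) F := funext fun y => conv_comm _ _ _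
  rw [e1, conv_conv hF continuous_const hx.1 (hgi x hx), e2,
    ← conv_conv continuous_const hF hx.1 (hgi x hx), h1]
  refine intervalIntegral.integral_congr fun s hs => ?_
  rw [uIcc_of_le hx.1] at hs
  exact (hcg ⟨hs.1, hs.2.trans hx.2⟩).symm

theorem deriv_eq (hw : IsPathSolution u w) (hu : u < 0) (hu' : -(1 / 2) < u) (n : ℕ) {x : ℝ}
    (hx : x ∈ Ioo 0 Real.pi) : prodFun u w n x + x * derivFun u w n x =
      ∑ p ∈ Finset.HasAntidiagonal.antidiagonal n,
        ∫ b in (0 : ℝ)..x, kernelFun u p.1 (x - b) * derivFun u w p.2 b := by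
  obtain ⟨a, hxa, haπ⟩ := exists_between hx.2
  have ha : a ∈ Ico 0 Real.pi := ⟨hx.1.le.trans hxa.le, haπ⟩
  have hxx : x ∈ Icc 0 a := ⟨hx.1.le, hxa.le⟩
  have hN : Icc 0 a ∈ 𝓝 x := Icc_mem_nhds hx.1 hxa
  have key : ∀ y ∈ Icc 0 a, ((y * prodFun u w n y : ℝ) : ℂ) =
      ∑ p ∈ Finset.HasAntidiagonal.antidiagonal n, ∫ s in (0 : ℝ)..y,
        conv (kernel u p.1) (fun x => (derivFun u w p.2 x : ℂ)) s := fun y hy => by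
    have hy' : y ∈ Ico 0 Real.pi := ⟨hy.1, hy.2.trans_lt haπ⟩
    have := congrArg (fun f : ConvFun => f y) (hw.mul_prod_eq hu hu' n)
    simp only [mulVar_apply _ hy', seqMul, ConvFun.sum_apply, prod_apply _ _ _ hy'] at this
    rw [Complex.ofReal_mul, this]
    exact Finset.sum_congr rfl fun p _ => (hw.conv_prod hu hu' (kernel u p.1) p.2 ha).2 y hy
  have h1 : HasDerivAt (fun y => ((y * prodFun u w n y : ℝ) : ℂ))
      ((prodFun u w n x + x * derivFun u w n x : ℝ) : ℂ) x := by
    refine (((hasDerivAt_id x).mul (hw.hasDerivAt_prodFun hu hu' n hx)).congr_deriv ?_).ofReal_comp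
    simp
  have h2 : HasDerivAt (fun y => ∑ p ∈ Finset.HasAntidiagonal.antidiagonal n, ∫ s in (0 : ℝ)..y,
        conv (kernel u p.1) (fun x => (derivFun u w p.2 x : ℂ)) s)
      (∑ p ∈ Finset.HasAntidiagonal.antidiagonal n,
        conv (kernel u p.1) (fun x => (derivFun u w p.2 x : ℂ)) x) x := by
    refine HasDerivAt.fun_sum fun p _ => ?_
    have hc := (hw.conv_prod hu hu' (kernel u p.1) p.2 ha).1
    refine intervalIntegral.integral_hasDerivAt_right ?_ ?_ (hc.continuousAt hN)
    · apply ContinuousOn.intervalIntegrable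
      rw [uIcc_of_le hx.1.le]
      exact hc.mono (Icc_subset_Icc_right hxa.le)
    · exact (hc.mono Ioo_subset_Icc_self).stronglyMeasurableAtFilter isOpen_Ioo x ⟨hx.1, hxa⟩
  have h3 := h1.unique (h2.congr_of_eventuallyEq (by
    filter_upwards [hN] with y hy using key y hy))
  have h4 : ∀ p ∈ Finset.HasAntidiagonal.antidiagonal n,
      conv (kernel u p.1) (fun x => (derivFun u w p.2 x : ℂ)) x =
      ((∫ b in (0 : ℝ)..x, kernelFun u p.1 (x - b) * derivFun u w p.2 b : ℝ) : ℂ) := fun p _ => by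
    rw [conv, ← intervalIntegral.integral_ofReal]
    refine intervalIntegral.integral_congr fun b hb => ?_
    rw [uIcc_of_le hx.1.le] at hb
    rw [kernel, ofReal_apply _ _ ⟨by linarith [hb.2], by linarith [hb.1, hx.2]⟩]
    push_cast; rfl
  rw [Finset.sum_congr rfl h4, ← Complex.ofReal_sum] at h3
  exact_mod_cast h3

end IsPathSolution

/-! ### Asymptotics at `π` -/

theorem sinc_pos {x : ℝ} (hx : x ∈ Ico 0 Real.pi) : 0 < Real.sinc x := by
  rcases hx.1.eq_or_lt with h | h
  · simp [← h]
  · rw [Real.sinc_of_ne_zero h.ne']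
    exact div_pos (Real.sin_pos_of_pos_of_lt_pi h hx.2) h

theorem tendsto_rpow_nhdsGT_zero {p : ℝ} (hp : p < 1) :
    Tendsto (fun ε : ℝ => ε ^ (1 - p)) (𝓝[>] 0) (𝓝 0) := by
  have : ContinuousAt (fun ε : ℝ => ε ^ (1 - p)) 0 :=
    Real.continuousAt_rpow_const _ _ (Or.inr (by linarith))
  have h := this.tendsto
  rw [Real.zero_rpow (by linarith)] at h
  exact h.mono_left nhdsWithin_le_nhds

/-- The kernel near `π`, multiplied by the distance to `π`. -/
def kernelEnd (u : ℝ) (n : ℕ) (y : ℝ) : ℝ :=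
  y * parSeries (cosCoef u n) (2 * n) (Real.pi - y) +
    Real.cos y * parSeries (atanCoef u n) (2 * n + 1) (Real.pi - y) / Real.sinc y

theorem kernelEnd_eq (u : ℝ) (n : ℕ) {y : ℝ} (hy : y ∈ Ioo 0 Real.pi) :
    kernelEnd u n y / y = ConvSeries.kernelFun u n (Real.pi - y) := by
  have hs := Real.sin_pos_of_pos_of_lt_pi hy.1 hy.2
  have h := ConvSeries.sin_mul_kernelFun u n (x := Real.pi - y) ⟨by linarith [hy.2], by linarith [hy.1]⟩
  rw [Real.sin_pi_sub, Real.cos_pi_sub] at h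
  have hy0 := hy.1.ne'
  rw [kernelEnd, Real.sinc_of_ne_zero hy0]
  have : Real.sin y ≠ 0 := hs.ne'
  refine mul_left_cancel₀ this ?_
  rw [h]
  field_simp
  ring

theorem continuousOn_kernelEnd (u : ℝ) (n : ℕ) :
    ContinuousOn (kernelEnd u n) (Ico 0 Real.pi) := by
  have h1 := (expDecay_cosCoef u n).continuous (2 * n)
  have h2 := (expDecay_atanCoef u n).continuous (2 * n + 1)
  refine ContinuousOn.add (by fun_prop) (ContinuousOn.div (by fun_prop) ?_ fun y hy => ?_)
  · exact Real.continuous_sinc.continuousOn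
  · exact (sinc_pos hy).ne'

theorem kernelEnd_zero (u : ℝ) (n : ℕ) :
    kernelEnd u n 0 = parSeries (atanCoef u n) (2 * n + 1) Real.pi := by
  simp [kernelEnd]

theorem tendsto_nhdsGT_of_continuousOn {f : ℝ → ℝ} {a : ℝ} (ha : 0 < a)
    (hf : ContinuousOn f (Icc 0 a)) : Tendsto f (𝓝[>] 0) (𝓝 (f 0)) := by
  have := (hf 0 ⟨le_rfl, ha.le⟩).mono_left (nhdsWithin_mono 0 Ioc_subset_Icc_self)
  rwa [nhdsWithin_Ioc_eq_nhdsGT ha] at this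

/-- A function that is continuous on a compact interval, extended by zero. -/
theorem exists_extension {f : ℝ → ℝ} {a : ℝ} (ha : 0 < a) (hf : ContinuousOn f (Icc 0 a)) :
    ∃ (g : ℝ → ℝ) (A : ℝ), Measurable g ∧ (∀ x, |g x| ≤ A) ∧ (∀ x ∈ Icc 0 a, g x = f x) ∧
      (∀ x ∉ Icc 0 a, g x = 0) ∧ Tendsto g (𝓝[>] 0) (𝓝 (f 0)) := by
  classical
  obtain ⟨A, hA⟩ := isCompact_Icc.exists_bound_of_continuousOn hf
  have h0 : 0 ≤ A := (norm_nonneg _).trans (hA 0 ⟨le_rfl, ha.le⟩)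
  have h1 : ∀ x ∈ Icc 0 a, (Icc 0 a).piecewise f (fun _ => 0) x = f x := fun x hx =>
    piecewise_eq_of_mem _ _ _ hx
  have h2 : ∀ x ∉ Icc 0 a, (Icc 0 a).piecewise f (fun _ => 0) x = 0 := fun x hx =>
    piecewise_eq_of_notMem _ _ _ hx
  refine ⟨(Icc 0 a).piecewise f fun _ => 0, A,
    hf.measurable_piecewise continuousOn_const measurableSet_Icc, fun x => ?_, h1, h2, ?_⟩
  · by_cases hx : x ∈ Icc 0 a
    · rw [h1 x hx]; exact hA x hx
    · rw [h2 x hx, abs_zero]; exact h0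
  · refine (tendsto_nhdsGT_of_continuousOn ha hf).congr' ?_
    filter_upwards [Ioc_mem_nhdsGT ha] with x hx using (h1 x (Ioc_subset_Icc_self hx)).symm

namespace IsPathSolution

variable {u : ℝ} {w : ℕ → ℝ → ℝ}

/-- The Stieltjes constant. -/
def stieltjesConst (u : ℝ) : ℝ := ∫ x in Ioi (0 : ℝ), x ^ (-(2 * u) - 1) / (1 + x)

theorem tendsto_conv_end (hw : IsPathSolution u w) (hu : u < 0) (hu' : -(1 / 2) < u) (i j : ℕ) :
    Tendsto (fun ε : ℝ => ε ^ (1 - -(2 * u)) * ∫ b in (0 : ℝ)..(Real.pi - ε),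
      ConvSeries.kernelFun u i (Real.pi - ε - b) * derivFun u w j b) (𝓝[>] 0)
      (𝓝 (parSeries (atanCoef u i) (2 * i + 1) Real.pi * (-(2 * u) * w j 0) *
        stieltjesConst u)) := by
  have hπ := Real.pi_pos
  obtain ⟨κ, A, hκm, hκA, hκ1, -, hκ0⟩ := exists_extension (a := 3 * Real.pi / 4) (by positivity)
    ((continuousOn_kernelEnd u i).mono (Icc_subset_Ico_right (by linarith)))
  set hf : ℝ → ℝ := fun t => -(2 * u) * Real.sinc t ^ (-(2 * u) - 1) * Real.cos t * w j t -
    4 * (t ^ (1 - -(2 * u)) * innerShift u w j t) with hfdef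
  have hfc : ContinuousOn hf (Icc 0 (Real.pi / 2)) := by
    have hs : Icc 0 (Real.pi / 2) ⊆ Ico 0 Real.pi := Icc_subset_Ico_right (by linarith)
    refine ContinuousOn.sub (ContinuousOn.mul (ContinuousOn.mul (continuousOn_const.mul ?_)
      (by fun_prop)) ((hw.cont j).mono (Icc_subset_Icc_right (by linarith))))
      (continuousOn_const.mul (ContinuousOn.mul ?_ ((hw.continuousOn_innerShift hu j).mono hs)))
    · exact Real.continuous_sinc.continuousOn.rpow_const fun x hx => Or.inl (sinc_pos (hs hx)).ne'
    · exact continuousOn_id.rpow_const fun x hx => Or.inr (by linarith)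
  obtain ⟨h, B, hhm, hhB, hh1, hh2, hh0⟩ := exists_extension (a := Real.pi / 2) (by positivity) hfc
  have hmain := tendsto_stieltjes (p := -(2 * u)) (by linarith) (by linarith) hκm hhm hκA hhB hκ0 hh0
  have hf0 : hf 0 = -(2 * u) * w j 0 := by
    have : (0 : ℝ) ^ (1 - -(2 * u)) = 0 := Real.zero_rpow (by linarith)
    rw [hfdef]
    simp only [this, Real.sinc_zero, Real.one_rpow, Real.cos_zero]
    ring
  rw [kernelEnd_zero, hf0] at hmain
  obtain ⟨D, hD⟩ := isCompact_Icc.exists_bound_of_continuousOn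
    ((ConvSeries.continuousOn_kernelFun u i).mono
      (Icc_subset_Ico_right (by linarith : Real.pi / 2 < Real.pi)))
  have hD0 : 0 ≤ D := (norm_nonneg _).trans (hD 0 ⟨le_rfl, by linarith⟩)
  have hdi := hw.intervalIntegrable_derivFun hu j
  have hdh : ∀ t ∈ Ioc 0 (Real.pi / 2), t ^ (-(2 * u) - 1) * h t = derivFun u w j t := fun t ht => by
    have hts : 0 < Real.sinc t := sinc_pos ⟨ht.1.le, by linarith [ht.2]⟩
    rw [hh1 t (Ioc_subset_Icc_self ht), hfdef, derivFun, ← ConvSeries.mul_sinc,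
      Real.mul_rpow ht.1.le hts.le]
    have : t ^ (-(2 * u) - 1) * t ^ (1 - -(2 * u)) = 1 := by
      rw [← Real.rpow_add ht.1, show -(2 * u) - 1 + (1 - -(2 * u)) = 0 by ring, Real.rpow_zero]
    simp only
    linear_combination (-4 * innerShift u w j t) * this
  have hrest : Tendsto (fun ε : ℝ => ε ^ (1 - -(2 * u)) *
      ∫ b in (Real.pi / 2)..(Real.pi - ε), ConvSeries.kernelFun u i (Real.pi - ε - b) * derivFun u w j b)
      (𝓝[>] 0) (𝓝 0) := by
    refine squeeze_zero_norm' (a := fun ε => ε ^ (1 - -(2 * u)) *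
      (D * ∫ b in (0 : ℝ)..Real.pi, ‖derivFun u w j b‖)) ?_ ?_
    · filter_upwards [Ioo_mem_nhdsGT (show 0 < Real.pi / 2 by positivity)] with ε hε
      rw [norm_mul, Real.norm_of_nonneg (Real.rpow_nonneg hε.1.le _)]
      refine mul_le_mul_of_nonneg_left ?_ (Real.rpow_nonneg hε.1.le _)
      have hle : Real.pi / 2 ≤ Real.pi - ε := by linarith [hε.2]
      have hsub : uIcc (Real.pi / 2) (Real.pi - ε) ⊆ uIcc 0 Real.pi := by
        rw [uIcc_of_le hle, uIcc_of_le hπ.le]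
        exact Icc_subset_Icc (by linarith) (by linarith [hε.1])
      calc ‖∫ b in (Real.pi / 2)..(Real.pi - ε), ConvSeries.kernelFun u i (Real.pi - ε - b) *
            derivFun u w j b‖ ≤ ∫ b in (Real.pi / 2)..(Real.pi - ε), D * ‖derivFun u w j b‖ := by
            refine intervalIntegral.norm_integral_le_of_norm_le hle ?_
              ((hdi.norm.mono_set hsub).const_mul D)
            refine Eventually.of_forall fun b hb => ?_
            rw [norm_mul]
            exact mul_le_mul_of_nonneg_right
              (hD _ ⟨by linarith [hb.2], by linarith [hb.1, hε.1]⟩) (norm_nonneg _)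
        _ = D * ∫ b in (Real.pi / 2)..(Real.pi - ε), ‖derivFun u w j b‖ :=
            intervalIntegral.integral_const_mul _ _
        _ ≤ D * ∫ b in (0 : ℝ)..Real.pi, ‖derivFun u w j b‖ := by
            refine mul_le_mul_of_nonneg_left ?_ hD0
            exact intervalIntegral.integral_mono_interval (by linarith) hle (by linarith [hε.1])
              (Eventually.of_forall fun b => norm_nonneg _) hdi.norm
    · simpa using (tendsto_rpow_nhdsGT_zero (p := -(2 * u)) (by linarith)).mul_const _
  have := hmain.add hrest
  rw [add_zero] at this
  refine this.congr' ?_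
  filter_upwards [Ioo_mem_nhdsGT (show 0 < Real.pi / 4 by positivity)] with ε hε
  have hle : Real.pi / 2 ≤ Real.pi - ε := by linarith [hε.2]
  have e1 : ∫ t in Ioi 0, κ (ε + t) / (ε + t) * (t ^ (-(2 * u) - 1) * h t) =
      ∫ b in (0 : ℝ)..(Real.pi / 2), ConvSeries.kernelFun u i (Real.pi - ε - b) * derivFun u w j b := by
    rw [intervalIntegral.integral_of_le (by positivity), ← integral_indicator measurableSet_Ioi,
      ← integral_indicator measurableSet_Ioc]
    congr 1
    funext t
    by_cases ht0 : t ∈ Ioi (0 : ℝ)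
    · have ht0' : 0 < t := ht0
      rw [indicator_of_mem ht0]
      by_cases ht : t ≤ Real.pi / 2
      · rw [indicator_of_mem (show t ∈ Ioc 0 (Real.pi / 2) from ⟨ht0, ht⟩), hdh t ⟨ht0, ht⟩,
          hκ1 _ ⟨by linarith [hε.1], by linarith [hε.2]⟩,
          kernelEnd_eq u i ⟨by linarith [hε.1], by linarith [hε.2]⟩, sub_sub]
      · rw [indicator_of_notMem (fun h => ht h.2), hh2 t (fun h => ht h.2)]
        simp
    · rw [indicator_of_notMem ht0, indicator_of_notMem (fun h => ht0 h.1)]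
  rw [e1, ← mul_add, intervalIntegral.integral_add_adjacent_intervals]
  · refine IntervalIntegrable.continuousOn_mul (hdi.mono_set ?_) ?_
    · rw [uIcc_of_le (by positivity), uIcc_of_le hπ.le]
      exact Icc_subset_Icc_right (by linarith)
    · rw [uIcc_of_le (by positivity)]
      exact (ConvSeries.continuousOn_kernelFun u i).comp (by fun_prop) fun b hb =>
        ⟨by linarith [hb.2], by linarith [hb.1, hε.1]⟩
  · refine IntervalIntegrable.continuousOn_mul (hdi.mono_set ?_) ?_
    · rw [uIcc_of_le hle, uIcc_of_le hπ.le]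
      exact Icc_subset_Icc (by linarith) (by linarith [hε.1])
    · rw [uIcc_of_le hle]
      exact (ConvSeries.continuousOn_kernelFun u i).comp (by fun_prop) fun b hb =>
        ⟨by linarith [hb.2], by linarith [hb.1, hε.1]⟩

theorem tendsto_left_end (hw : IsPathSolution u w) (hu : u < 0) (hu' : -(1 / 2) < u) (n : ℕ) :
    Tendsto (fun ε : ℝ => ε ^ (1 - -(2 * u)) * (prodFun u w n (Real.pi - ε) +
      (Real.pi - ε) * derivFun u w n (Real.pi - ε))) (𝓝[>] 0)
      (𝓝 (-(Real.pi * (-(2 * u)) * w n Real.pi))) := by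
  have hπ := Real.pi_pos
  have hpow := tendsto_rpow_nhdsGT_zero (p := -(2 * u)) (by linarith)
  have hsubm : Tendsto (fun ε : ℝ => Real.pi - ε) (𝓝[>] 0) (𝓝[Icc 0 Real.pi] Real.pi) := by
    refine tendsto_nhdsWithin_iff.2 ⟨?_, ?_⟩
    · have : Tendsto (fun ε : ℝ => Real.pi - ε) (𝓝 0) (𝓝 (Real.pi - 0)) :=
        tendsto_id.const_sub _
      rw [sub_zero] at this
      exact this.mono_left nhdsWithin_le_nhds
    · filter_upwards [Ioo_mem_nhdsGT hπ] with ε hε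
      exact ⟨by linarith [hε.2], by linarith [hε.1]⟩
  have hsub : Tendsto (fun ε : ℝ => Real.pi - ε) (𝓝[>] 0) (𝓝 Real.pi) :=
    hsubm.mono_right nhdsWithin_le_nhds
  have hπm : Real.pi ∈ Icc 0 Real.pi := ⟨hπ.le, le_rfl⟩
  have hwn := (hw.cont n Real.pi hπm).tendsto.comp hsubm
  have hPn := ((hw.continuousOn_prodFun hu n) Real.pi hπm).tendsto.comp hsubm
  have hcos : Tendsto (fun ε : ℝ => Real.cos ε) (𝓝[>] 0) (𝓝 1) := by
    have := Real.continuous_cos.tendsto 0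
    rw [Real.cos_zero] at this
    exact this.mono_left nhdsWithin_le_nhds
  have hsinc : Tendsto (fun ε : ℝ => Real.sinc ε ^ (-(2 * u) - 1)) (𝓝[>] 0) (𝓝 1) := by
    have := (Real.continuous_sinc.tendsto 0).rpow_const (p := -(2 * u) - 1) (by simp)
    rw [Real.sinc_zero, Real.one_rpow] at this
    exact this.mono_left nhdsWithin_le_nhds
  have hinner : Tendsto (fun ε : ℝ => ε ^ (1 - -(2 * u)) * innerShift u w n (Real.pi - ε)) (𝓝[>] 0)
      (𝓝 0) := by
    obtain ⟨C, hC⟩ := hw.exists_bound_innerShift hu n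
    refine squeeze_zero_norm' (a := fun ε => ε ^ (1 - -(2 * u)) * C) ?_ ?_
    · filter_upwards [Ioo_mem_nhdsGT hπ] with ε hε
      rw [norm_mul, Real.norm_of_nonneg (Real.rpow_nonneg hε.1.le _)]
      exact mul_le_mul_of_nonneg_left (hC _ ⟨by linarith [hε.2], by linarith [hε.1]⟩)
        (Real.rpow_nonneg hε.1.le _)
    · simpa using hpow.mul_const C
  have hall := (hpow.mul hPn).add (hsub.mul ((((hsinc.const_mul (-(2 * u))).mul hcos).neg.mul
    hwn).sub (hinner.const_mul 4)))
  have hlim : 0 * prodFun u w n Real.pi + Real.pi * (-(-(2 * u) * 1 * 1) * w n Real.pi - 4 * 0) =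
      -(Real.pi * (-(2 * u)) * w n Real.pi) := by ring
  rw [hlim] at hall
  refine hall.congr' ?_
  filter_upwards [Ioo_mem_nhdsGT hπ] with ε hε
  have hs : 0 < Real.sinc ε := sinc_pos ⟨hε.1.le, hε.2⟩
  simp only [Function.comp, derivFun]
  rw [Real.sin_pi_sub, Real.cos_pi_sub, ← ConvSeries.mul_sinc, Real.mul_rpow hε.1.le hs.le]
  have : ε ^ (1 - -(2 * u)) * ε ^ (-(2 * u) - 1) = 1 := by
    rw [← Real.rpow_add hε.1, show 1 - -(2 * u) + (-(2 * u) - 1) = 0 by ring, Real.rpow_zero]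
  linear_combination ((Real.pi - ε) * (2 * u) * Real.sinc ε ^ (-(2 * u) - 1) * Real.cos ε *
    w n (Real.pi - ε)) * (-this)

theorem apply_zero (hw : IsPathSolution u w) (n : ℕ) : w n 0 = if n = 0 then 1 else 0 := by
  have h0 : (0 : ℝ) ∈ Icc 0 Real.pi := ⟨le_rfl, Real.pi_pos.le⟩
  cases n with
  | zero => simpa using hw.zero 0 h0
  | succ n => simp [hw.succ n 0 h0]

/-- The values at `π` of the solution. -/
theorem apply_pi (hw : IsPathSolution u w) (hu : u < 0) (hu' : -(1 / 2) < u) (n : ℕ) :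
    w n Real.pi * parSeries (atanCoef u 0) 1 Real.pi =
      parSeries (atanCoef u n) (2 * n + 1) Real.pi := by
  have key : ∀ n, -(Real.pi * (-(2 * u)) * w n Real.pi) =
      parSeries (atanCoef u n) (2 * n + 1) Real.pi * -(2 * u) * stieltjesConst u := fun n => by
    have h1 := hw.tendsto_left_end hu hu' n
    have h2 := tendsto_finsetSum (Finset.HasAntidiagonal.antidiagonal n)
      fun p _ => hw.tendsto_conv_end hu hu' p.1 p.2
    have h3 := tendsto_nhds_unique (h1.congr' ?_) h2
    · rw [h3, Finset.sum_eq_single (n, 0)]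
      · rw [hw.apply_zero, if_pos rfl]; ring
      · rintro ⟨i, j⟩ hij hne
        rw [Finset.HasAntidiagonal.mem_antidiagonal] at hij
        have : j ≠ 0 := by
          rintro rfl
          simp only [add_zero] at hij
          exact hne (by rw [hij])
        rw [hw.apply_zero, if_neg this]; ring
      · intro h
        exact absurd (Finset.HasAntidiagonal.mem_antidiagonal.2 (by simp)) h
    · filter_upwards [Ioo_mem_nhdsGT Real.pi_pos] with ε hε
      rw [hw.deriv_eq hu hu' n (x := Real.pi - ε) ⟨by linarith [hε.2], by linarith [hε.1]⟩,
        Finset.mul_sum]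
  have h0 := key 0
  rw [hw.zero Real.pi ⟨Real.pi_pos.le, le_rfl⟩] at h0
  have hn := key n
  have hq : Real.pi * (-(2 * u)) ≠ 0 := mul_ne_zero Real.pi_pos.ne' (by linarith)
  apply mul_left_cancel₀ hq
  linear_combination (-parSeries (atanCoef u 0) 1 Real.pi) * hn +
    parSeries (atanCoef u n) (2 * n + 1) Real.pi * h0

end IsPathSolution

/-! ### The recursive structure of the polytopes -/

open scoped ENNReal

/-- The pairs of angles at an inner vertex, with bounded sum. -/
def triangle (α : ℝ) : Set (ℝ × ℝ) := {p | 0 < p.1 ∧ 0 < p.2 ∧ p.1 + p.2 < α}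

theorem measurableSet_triangle (α : ℝ) : MeasurableSet (triangle α) := by
  have h1 : IsOpen {p : ℝ × ℝ | 0 < p.1} := isOpen_lt (by fun_prop) (by fun_prop)
  have h2 : IsOpen {p : ℝ × ℝ | 0 < p.2} := isOpen_lt (by fun_prop) (by fun_prop)
  have h3 : IsOpen {p : ℝ × ℝ | p.1 + p.2 < α} := isOpen_lt (by fun_prop) (by fun_prop)
  exact (h1.inter (h2.inter h3)).measurableSet

theorem triangle_mono : Monotone triangle := fun _ _ h _ hp => ⟨hp.1, hp.2.1, hp.2.2.trans_le h⟩

/-- The polytope in terms of the pairs of angles, with a bound at the entrance. -/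
def pairSet (t : BinaryTree Unit) (α : ℝ) : Set (Vertex t → ℝ × ℝ) :=
  {y | (∀ v, y v ∈ triangle Real.pi) ∧
    (∀ v i w, IsInnerEdge v i w → (y w).1 + (y w).2 < if i = 1 then (y v).1 else (y v).2) ∧
    ∀ w, topVertex t = some w → (y w).1 + (y w).2 < α}

theorem pairSet_mono (t : BinaryTree Unit) : Monotone (pairSet t) := fun _ _ h _ hy =>
  ⟨hy.1, hy.2.1, fun w hw => (hy.2.2 w hw).trans_le h⟩

theorem measurableSet_pairSet (t : BinaryTree Unit) (α : ℝ) : MeasurableSet (pairSet t α) := by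
  have e : pairSet t α = (⋂ v, (fun y : Vertex t → ℝ × ℝ => y v) ⁻¹' triangle Real.pi) ∩
      ((⋂ v, ⋂ i, ⋂ w, ⋂ _ : IsInnerEdge v i w,
        {y : Vertex t → ℝ × ℝ | (y w).1 + (y w).2 < if i = 1 then (y v).1 else (y v).2}) ∩
      ⋂ w, ⋂ _ : topVertex t = some w, {y : Vertex t → ℝ × ℝ | (y w).1 + (y w).2 < α}) := by
    ext y
    simp [pairSet]
  rw [e]
  refine .inter (.iInter fun v => measurable_pi_apply v (measurableSet_triangle _))
    (.inter (.iInter fun v => .iInter fun i => .iInter fun w => .iInter fun _ => ?_)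
      (.iInter fun w => .iInter fun _ => ?_))
  · refine measurableSet_lt (by fun_prop) ?_
    split_ifs <;> fun_prop
  · exact measurableSet_lt (by fun_prop) (by fun_prop)

theorem IsInnerEdge.ne_zero {t : BinaryTree Unit} {v w : Vertex t} {i : Fin 3}
    (h : IsInnerEdge v i w) : i = 1 ∨ i = 2 := by
  induction h with
  | topLeft w h => exact Or.inl rfl
  | topRight w h => exact Or.inr rfl
  | inLeft v w i h ih => exact ih
  | inRight v w i h ih => exact ih

theorem anglesOfPair_mem_polytope (t : BinaryTree Unit) (y : Vertex t → ℝ × ℝ) :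
    anglesOfPair t y ∈ polytope t ↔ y ∈ pairSet t Real.pi := by
  simp only [polytope, pairSet, triangle, anglesOfPair, mem_ofPred_eq]
  constructor
  · rintro ⟨h1, -, h3⟩
    refine ⟨fun v => ⟨by simpa using h1 v 1, by simpa using h1 v 2, ?_⟩, fun v i w hw => ?_,
      fun w _ => ?_⟩
    · have := h1 v 0
      simp at this; linarith
    · have := h3 v i w hw
      rcases hw.ne_zero with rfl | rfl
      · simp at this ⊢; linarith
      · simp at this ⊢; linarith
    · have := h1 w 0
      simp at this; linarith
  · rintro ⟨h1, h2, -⟩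
    refine ⟨fun v i => ?_, fun v => ?_, fun v i w hw => ?_⟩
    · have := h1 v
      fin_cases i
      · simp; linarith
      · simpa using this.1
      · simpa using this.2.1
    · simp
      ring
    · have := h2 v i w hw
      rcases hw.ne_zero with rfl | rfl
      · simp at this ⊢; linarith
      · simp at this ⊢; linarith

/-- The pairs of angles of a tree, from those of the top vertex and of the two subtrees. -/
def nodePairs {a : Unit} {l r : BinaryTree Unit}
    (q : (ℝ × ℝ) × (Vertex l → ℝ × ℝ) × (Vertex r → ℝ × ℝ)) : Vertex (.node a l r) → ℝ × ℝ
  | .top => q.1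
  | .inLeft v => q.2.1 v
  | .inRight v => q.2.2 v

theorem measurePreserving_nodePairs (a : Unit) (l r : BinaryTree Unit) :
    MeasurePreserving (nodePairs (a := a) (l := l) (r := r)) := by
  have h1 := volume_measurePreserving_piCongrLeft (fun _ : Vertex (.node a l r) => ℝ × ℝ)
    (Vertex.nodeEquiv a l r).symm
  have h2 := volume_measurePreserving_sumPiEquivProdPi_symm
    (fun _ : Unit ⊕ (Vertex l ⊕ Vertex r) => ℝ × ℝ)
  have h3 := volume_measurePreserving_sumPiEquivProdPi_symm (fun _ : Vertex l ⊕ Vertex r => ℝ × ℝ)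
  have h4 := (volume_preserving_funUnique Unit (ℝ × ℝ)).symm
  have h := h1.comp (h2.comp (h4.prod h3))
  set F := (MeasurableEquiv.sumPiEquivProdPi fun _ : Unit ⊕ (Vertex l ⊕ Vertex r) => ℝ × ℝ).symm ∘
    Prod.map (MeasurableEquiv.funUnique Unit (ℝ × ℝ)).symm
      (MeasurableEquiv.sumPiEquivProdPi fun _ : Vertex l ⊕ Vertex r => ℝ × ℝ).symm
  suffices h' : nodePairs (a := a) (l := l) (r := r) = _ by rw [h']; exact h
  funext q v
  have e : ∀ (f : Unit ⊕ (Vertex l ⊕ Vertex r) → ℝ × ℝ) (s : Unit ⊕ (Vertex l ⊕ Vertex r)),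
      (MeasurableEquiv.piCongrLeft (fun _ : Vertex (.node a l r) => ℝ × ℝ)
        (Vertex.nodeEquiv a l r).symm) f ((Vertex.nodeEquiv a l r).symm s) = f s := fun f s =>
    Equiv.piCongrLeft_apply_apply (fun _ : Vertex (.node a l r) => ℝ × ℝ) _ f s
  cases v with
  | top => exact (e (F q) (.inl ())).symm
  | inLeft v => exact (e (F q) (.inr (.inl v))).symm
  | inRight v => exact (e (F q) (.inr (.inr v))).symm

theorem nodePairs_mem {a : Unit} {l r : BinaryTree Unit} {α : ℝ} (hα : α ≤ Real.pi)
    (q : (ℝ × ℝ) × (Vertex l → ℝ × ℝ) × (Vertex r → ℝ × ℝ)) :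
    nodePairs (a := a) q ∈ pairSet (.node a l r) α ↔
      q.1 ∈ triangle α ∧ q.2.1 ∈ pairSet l q.1.1 ∧ q.2.2 ∈ pairSet r q.1.2 := by
  constructor
  · rintro ⟨h1, h2, h3⟩
    refine ⟨⟨(h1 .top).1, (h1 .top).2.1, h3 .top rfl⟩,
      ⟨fun v => h1 (.inLeft v), fun v i w h => h2 _ _ _ (.inLeft v w i h), fun w hw => ?_⟩,
      ⟨fun v => h1 (.inRight v), fun v i w h => h2 _ _ _ (.inRight v w i h), fun w hw => ?_⟩⟩
    · have h := h2 _ _ _ (.topLeft w hw)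
      rw [if_pos rfl] at h
      exact h
    · have h := h2 _ _ _ (.topRight w hw)
      rw [if_neg (by decide)] at h
      exact h
  · rintro ⟨h1, h2, h3⟩
    refine ⟨fun v => ?_, fun v i w h => ?_, fun w hw => ?_⟩
    · cases v with
      | top => exact triangle_mono hα h1
      | inLeft v => exact h2.1 v
      | inRight v => exact h3.1 v
    · cases h with
      | topLeft w h => rw [if_pos rfl]; exact h2.2.2 w h
      | topRight w h => rw [if_neg (by decide)]; exact h3.2.2 w h
      | inLeft v w i h => exact h2.2.1 v i w h
      | inRight v w i h => exact h3.2.1 v i w h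
    · simp only [topVertex, Option.some.injEq] at hw
      subst hw
      exact h1.2.2

/-- The integral of a product of functions of the pairs of angles over the polytope. -/
def weight (t : BinaryTree Unit) (g : Vertex t → ℝ × ℝ → ℝ≥0∞) (α : ℝ) : ℝ≥0∞ :=
  2 ^ t.numNodes * ∫⁻ y in pairSet t α, ∏ v, g v (y v)

theorem weight_mono (t : BinaryTree Unit) (g : Vertex t → ℝ × ℝ → ℝ≥0∞) :
    Monotone (weight t g) := fun _ _ h =>
  mul_le_mul_right (lintegral_mono_set (pairSet_mono t h)) _

theorem measurable_weight (t : BinaryTree Unit) (g : Vertex t → ℝ × ℝ → ℝ≥0∞) :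
    Measurable (weight t g) := (weight_mono t g).measurable

theorem weight_nil (g : Vertex .nil → ℝ × ℝ → ℝ≥0∞) (α : ℝ) : weight .nil g α = 1 := by
  have h : pairSet .nil α = univ := by
    ext y
    simp only [mem_univ, iff_true]
    exact ⟨fun v => isEmptyElim v, fun v => isEmptyElim v, fun v => isEmptyElim v⟩
  simp [weight, h, BinaryTree.numNodes, volume_pi]

theorem weight_node {a : Unit} {l r : BinaryTree Unit}
    {g : Vertex (.node a l r) → ℝ × ℝ → ℝ≥0∞} (hg : ∀ v, Measurable (g v)) {α : ℝ}
    (hα : α ≤ Real.pi) :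
    weight (.node a l r) g α = 2 * ∫⁻ p in triangle α, g .top p *
      (weight l (fun v => g (.inLeft v)) p.1 * weight r (fun v => g (.inRight v)) p.2) := by
  have hprod : ∀ y : Vertex (.node a l r) → ℝ × ℝ, ∏ v, g v (y v) =
      g .top (y .top) * ((∏ v, g (.inLeft v) (y (.inLeft v))) *
        ∏ v, g (.inRight v) (y (.inRight v))) := fun y => by
    rw [← (Vertex.nodeEquiv a l r).symm.prod_comp, Fintype.prod_sum_type, Fintype.prod_sum_type]
    simp [Vertex.nodeEquiv]
  have hm : Measurable fun y : Vertex (.node a l r) → ℝ × ℝ => ∏ v, g v (y v) :=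
    Finset.measurable_prod _ fun v _ => (hg v).comp (measurable_pi_apply v)
  have hml : Measurable fun y : Vertex l → ℝ × ℝ => ∏ v, g (.inLeft v) (y v) :=
    Finset.measurable_prod _ fun v _ => (hg _).comp (measurable_pi_apply v)
  have hmr : Measurable fun y : Vertex r → ℝ × ℝ => ∏ v, g (.inRight v) (y v) :=
    Finset.measurable_prod _ fun v _ => (hg _).comp (measurable_pi_apply v)
  have hmi := hm.indicator (measurableSet_pairSet (.node a l r) α)
  rw [weight, ← lintegral_indicator (measurableSet_pairSet _ _),
    ← (measurePreserving_nodePairs a l r).lintegral_comp hmi, Measure.volume_eq_prod,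
    lintegral_prod (fun q => (pairSet (.node a l r) α).indicator (fun y => ∏ v, g v (y v))
      (nodePairs q)) (hmi.comp (measurePreserving_nodePairs a l r).measurable).aemeasurable,
    ← lintegral_indicator (measurableSet_triangle α), ← lintegral_const_mul' _ _ (by simp),
    ← lintegral_const_mul' _ _ (by simp)]
  refine lintegral_congr fun p => ?_
  by_cases hp : p ∈ triangle α
  · have hind : ∀ q : (Vertex l → ℝ × ℝ) × (Vertex r → ℝ × ℝ),
        (pairSet (.node a l r) α).indicator (fun y => ∏ v, g v (y v)) (nodePairs (p, q)) =
        g .top p * ((pairSet l p.1).indicator (fun y => ∏ v, g (.inLeft v) (y v)) q.1 *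
          (pairSet r p.2).indicator (fun y => ∏ v, g (.inRight v) (y v)) q.2) := fun q => by
      by_cases h1 : q.1 ∈ pairSet l p.1
      · by_cases h2 : q.2 ∈ pairSet r p.2
        · rw [indicator_of_mem ((nodePairs_mem hα (p, q)).2 ⟨hp, h1, h2⟩), indicator_of_mem h1,
            indicator_of_mem h2, hprod]
          rfl
        · rw [indicator_of_notMem fun h => h2 ((nodePairs_mem hα (p, q)).1 h).2.2,
            indicator_of_notMem h2]
          simp
      · rw [indicator_of_notMem fun h => h1 ((nodePairs_mem hα (p, q)).1 h).2.1,
          indicator_of_notMem h1]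
        simp
    have hli := hml.indicator (measurableSet_pairSet l p.1)
    have hri := hmr.indicator (measurableSet_pairSet r p.2)
    rw [indicator_of_mem hp]
    simp only [hind]
    have hlr : Measurable fun q : (Vertex l → ℝ × ℝ) × (Vertex r → ℝ × ℝ) =>
        (pairSet l p.1).indicator (fun y => ∏ v, g (.inLeft v) (y v)) q.1 *
          (pairSet r p.2).indicator (fun y => ∏ v, g (.inRight v) (y v)) q.2 :=
      (hli.comp measurable_fst).mul (hri.comp measurable_snd)
    rw [lintegral_const_mul _ hlr,
      Measure.volume_eq_prod, lintegral_prod_mul hli.aemeasurable hri.aemeasurable,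
      lintegral_indicator (measurableSet_pairSet _ _),
      lintegral_indicator (measurableSet_pairSet _ _), weight, weight, BinaryTree.numNodes,
      pow_succ, pow_add]
    ring
  · rw [indicator_of_notMem hp, mul_zero]
    have hind : ∀ q : (Vertex l → ℝ × ℝ) × (Vertex r → ℝ × ℝ),
        (pairSet (.node a l r) α).indicator (fun y => ∏ v, g v (y v)) (nodePairs (p, q)) = 0 :=
      fun q => indicator_of_notMem (fun h => hp ((nodePairs_mem hα (p, q)).1 h).1) _
    simp [hind]

theorem weight_lt_top : ∀ {t : BinaryTree Unit} {g : Vertex t → ℝ × ℝ → ℝ≥0∞}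
    (_ : ∀ v, Measurable (g v)) (_ : ∀ v, ∫⁻ p in triangle Real.pi, g v p < ∞),
    weight t g Real.pi < ∞
  | .nil, g, _, _ => by rw [weight_nil]; exact ENNReal.one_lt_top
  | .node a l r, g, hg, h => by
    have hl := weight_lt_top (t := l) (fun v => hg (.inLeft v)) fun v => h (.inLeft v)
    have hr := weight_lt_top (t := r) (fun v => hg (.inRight v)) fun v => h (.inRight v)
    rw [weight_node hg le_rfl]
    refine ENNReal.mul_lt_top (by simp) ?_
    calc _ ≤ ∫⁻ p in triangle Real.pi, g .top p * (weight l (fun v => g (.inLeft v)) Real.pi *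
          weight r (fun v => g (.inRight v)) Real.pi) := by
          refine setLIntegral_mono' (measurableSet_triangle _) fun p hp => ?_
          have h1 : p.1 ≤ Real.pi := by linarith [hp.2.1, hp.2.2]
          have h2 : p.2 ≤ Real.pi := by linarith [hp.1, hp.2.2]
          gcongr
          · exact weight_mono _ _ h1
          · exact weight_mono _ _ h2
      _ < ∞ := by
          rw [lintegral_mul_const _ (hg _)]
          exact ENNReal.mul_lt_top (h _) (ENNReal.mul_lt_top hl hr)

/-! ### Integrals over triangles -/

theorem setLIntegral_triangle {K : ℝ × ℝ → ℝ≥0∞} (hK : Measurable K) (α : ℝ) :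
    ∫⁻ p in triangle α, K p =
      ∫⁻ s in Ioo 0 α, ∫⁻ b in Ioo 0 s, K (b, s - b) := by
  have hKi := hK.indicator (measurableSet_triangle α)
  rw [← lintegral_indicator (measurableSet_triangle α), Measure.volume_eq_prod,
    lintegral_prod _ hKi.aemeasurable]
  have e : ∀ b : ℝ, ∫⁻ c, (triangle α).indicator K (b, c) =
      ∫⁻ s, (triangle α).indicator K (b, s - b) := fun b =>
    (lintegral_sub_right_eq_self (fun c => (triangle α).indicator K (b, c)) b).symm
  simp only [e]
  rw [lintegral_lintegral_swap (f := fun b s => (triangle α).indicator K (b, s - b)),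
    ← lintegral_indicator measurableSet_Ioo]
  · refine lintegral_congr fun s => ?_
    by_cases hs : s ∈ Ioo 0 α
    · rw [indicator_of_mem hs, ← lintegral_indicator measurableSet_Ioo]
      refine lintegral_congr fun b => ?_
      by_cases hb : b ∈ Ioo 0 s
      · rw [indicator_of_mem hb, indicator_of_mem]
        exact ⟨hb.1, by simpa using hb.2, by simpa using hs.2⟩
      · rw [indicator_of_notMem hb, indicator_of_notMem]
        rintro ⟨h1, h2, -⟩
        exact hb ⟨h1, by simpa using h2⟩
    · rw [indicator_of_notMem hs]
      refine (lintegral_congr fun b => ?_).trans lintegral_zero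
      refine indicator_of_notMem ?_ _
      rintro ⟨h1, h2, h3⟩
      simp only at h1 h2 h3
      exact hs ⟨by linarith, by linarith⟩
  · exact (hKi.comp (by fun_prop : Measurable fun z : ℝ × ℝ => (z.1, z.2 - z.1))).aemeasurable

theorem toReal_setLIntegral_triangle {K : ℝ × ℝ → ℝ≥0∞} (hK : Measurable K) {α : ℝ} (hα : 0 ≤ α)
    (hfin : ∫⁻ p in triangle α, K p ≠ ∞) :
    IntervalIntegrable (fun s => ∫ b in (0 : ℝ)..s, (K (b, s - b)).toReal) volume 0 α ∧
    (∫⁻ p in triangle α, K p).toReal =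
      ∫ s in (0 : ℝ)..α, ∫ b in (0 : ℝ)..s, (K (b, s - b)).toReal := by
  rw [setLIntegral_triangle hK] at hfin ⊢
  have hKs : Measurable fun z : ℝ × ℝ => K (z.2, z.1 - z.2) := hK.comp (by fun_prop)
  have hm : Measurable fun s : ℝ => ∫⁻ b in Ioo 0 s, K (b, s - b) := by
    have h1 : MeasurableSet {z : ℝ × ℝ | z.2 ∈ Ioo 0 z.1} :=
      (measurableSet_lt measurable_const measurable_snd).inter
        (measurableSet_lt measurable_snd measurable_fst)
    have h2 := (hKs.indicator h1).lintegral_prod_right' (ν := volume)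
    refine (congrArg Measurable (funext fun s => ?_)).mp h2
    rw [← lintegral_indicator measurableSet_Ioo]
    rfl
  have hae : ∀ᵐ s ∂(volume.restrict (Ioo 0 α)), ∫⁻ b in Ioo 0 s, K (b, s - b) < ∞ :=
    ae_lt_top hm hfin
  have hae' : ∀ᵐ s ∂(volume.restrict (Ioo 0 α)), (∫⁻ b in Ioo 0 s, K (b, s - b)).toReal =
      ∫ b in (0 : ℝ)..s, (K (b, s - b)).toReal := by
    filter_upwards [hae, ae_restrict_mem measurableSet_Ioo] with s hs hs'
    rw [intervalIntegral.integral_of_le hs'.1.le, integral_Ioc_eq_integral_Ioo, integral_toReal]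
    · exact (hKs.comp (measurable_prodMk_left (x := s))).aemeasurable
    · exact ae_lt_top (hKs.comp (measurable_prodMk_left (x := s))) hs.ne
  constructor
  · rw [intervalIntegrable_iff_integrableOn_Ioo_of_le hα]
    exact (integrable_toReal_of_lintegral_ne_top hm.aemeasurable hfin).congr hae'
  · rw [intervalIntegral.integral_of_le hα, integral_Ioc_eq_integral_Ioo,
      ← integral_congr_ae hae', integral_toReal hm.aemeasurable hae]

/-! ### Sums over trees -/

open scoped ENNReal

theorem sum_treesOfNumNodesEq_succ {M : Type*} [AddCommMonoid M] (f : BinaryTree Unit → M) (n : ℕ) :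
    ∑ t ∈ BinaryTree.treesOfNumNodesEq (n + 1), f t =
      ∑ p ∈ Finset.HasAntidiagonal.antidiagonal n, ∑ l ∈ BinaryTree.treesOfNumNodesEq p.1,
        ∑ r ∈ BinaryTree.treesOfNumNodesEq p.2, f (.node () l r) := by
  rw [BinaryTree.treesOfNumNodesEq_succ, Finset.sum_biUnion]
  · refine Finset.sum_congr rfl fun p _ => ?_
    rw [BinaryTree.pairwiseNode, Finset.sum_map, Finset.sum_product]
    rfl
  · simp_rw [Set.PairwiseDisjoint, Set.Pairwise, Function.onFun, Finset.disjoint_left]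
    rintro ⟨i, j⟩ - ⟨i', j'⟩ - hne t ht ht'
    simp only [BinaryTree.pairwiseNode, Finset.mem_map, Finset.mem_product,
      BinaryTree.mem_treesOfNumNodesEq, Prod.exists] at ht ht'
    obtain ⟨a, b, ⟨h1, h2⟩, rfl⟩ := ht
    obtain ⟨a', b', ⟨h1', h2'⟩, h⟩ := ht'
    obtain ⟨-, rfl, rfl⟩ := BinaryTree.node.inj h
    exact hne (by rw [← h1, ← h2, ← h1', ← h2'])

/-- The contribution of an inner vertex with given pair of angles to the integrand. -/
def exitFactor (u : ℝ) (i : Option (Fin 3)) (p : ℝ × ℝ) : ℝ≥0∞ :=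
  match i with
  | none => 1
  | some i => ENNReal.ofReal (Real.exp (2 * u * (Real.log (Real.sin (Real.pi - p.1 - p.2)) -
      Real.log (Real.sin (![Real.pi - p.1 - p.2, p.1, p.2] i)))))

theorem measurable_exitFactor (u : ℝ) (i : Option (Fin 3)) : Measurable (exitFactor u i) := by
  match i with
  | none => exact measurable_const
  | some i =>
    have h : Measurable fun p : ℝ × ℝ => (![Real.pi - p.1 - p.2, p.1, p.2] : Fin 3 → ℝ) i := by
      fin_cases i
      · change Measurable fun p : ℝ × ℝ => Real.pi - p.1 - p.2
        fun_prop
      · exact measurable_fst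
      · exact measurable_snd
    unfold exitFactor
    simp only
    refine ENNReal.measurable_ofReal.comp (Real.measurable_exp.comp (.const_mul (.sub ?_ ?_) _))
    · exact Real.measurable_log.comp (Real.measurable_sin.comp (by fun_prop))
    · exact Real.measurable_log.comp (Real.measurable_sin.comp h)

theorem exitFactor_one (u : ℝ) {p : ℝ × ℝ} (hp : p ∈ triangle Real.pi) :
    exitFactor u (some 1) p =
      ENNReal.ofReal (Real.sin (p.1 + p.2) ^ (2 * u) * Real.sin p.1 ^ (-(2 * u))) := by
  have h1 : 0 < Real.sin (p.1 + p.2) :=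
    Real.sin_pos_of_pos_of_lt_pi (by linarith [hp.1, hp.2.1]) hp.2.2
  have h2 : 0 < Real.sin p.1 :=
    Real.sin_pos_of_pos_of_lt_pi hp.1 (by linarith [hp.2.1, hp.2.2])
  simp only [exitFactor]
  rw [sub_sub, Real.sin_pi_sub, Real.rpow_def_of_pos h1, Real.rpow_def_of_pos h2, ← Real.exp_add]
  congr 2
  simp
  ring

theorem exitFactor_swap (u : ℝ) (p : ℝ × ℝ) :
    exitFactor u (some 2) p.swap = exitFactor u (some 1) p := by
  simp only [exitFactor, Prod.fst_swap, Prod.snd_swap]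
  rw [sub_right_comm]
  rfl

theorem setLIntegral_triangle_swap (K : ℝ × ℝ → ℝ≥0∞) (α : ℝ) :
    ∫⁻ p in triangle α, K p.swap = ∫⁻ p in triangle α, K p := by
  have h : MeasurePreserving (Prod.swap : ℝ × ℝ → ℝ × ℝ) := Measure.measurePreserving_swap
  have := h.setLIntegral_comp_preimage_emb MeasurableEquiv.prodComm.measurableEmbedding K
    (triangle α)
  rw [← this]
  congr 2
  ext p
  simp only [triangle, mem_preimage, Prod.fst_swap, Prod.snd_swap, mem_ofPred_eq, add_comm p.2]
  tauto

theorem lintegral_exitFactor_lt_top {u : ℝ} (hu : |u| < 1 / 2) {i : Option (Fin 3)}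
    (hi : i ≠ some 0) : ∫⁻ p in triangle Real.pi, exitFactor u i p < ∞ := by
  have hu' := abs_lt.1 hu
  set A : ℝ → ℝ≥0∞ := fun s => ENNReal.ofReal (Real.sin s ^ (2 * u))
  set B : ℝ → ℝ≥0∞ := fun b => ENNReal.ofReal (Real.sin b ^ (-(2 * u)))
  have hA : Measurable A := by fun_prop
  have hB : Measurable B := by fun_prop
  have hfin : ∀ p : ℝ, -1 < p →
      ∫⁻ s in Ioo 0 Real.pi, ENNReal.ofReal (Real.sin s ^ p) < ∞ := fun p hp => by
    have h := intervalIntegrable_sin_rpow hp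
    rw [intervalIntegrable_iff_integrableOn_Ioo_of_le Real.pi_pos.le] at h
    exact h.lintegral_lt_top
  have hAB : ∫⁻ s in Ioo 0 Real.pi, ∫⁻ b in Ioo 0 Real.pi, (A s + B b) < ∞ := by
    have hA1 : ∫⁻ s in Ioo 0 Real.pi, A s < ∞ := hfin (2 * u) (by linarith)
    have hB1 : ∫⁻ b in Ioo 0 Real.pi, B b < ∞ := hfin (-(2 * u)) (by linarith)
    simp only [lintegral_add_left measurable_const, setLIntegral_const, Real.volume_Ioo]
    rw [lintegral_add_left (hA.mul_const _), lintegral_mul_const _ hA, setLIntegral_const,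
      Real.volume_Ioo]
    exact ENNReal.add_lt_top.2 ⟨ENNReal.mul_lt_top hA1 ENNReal.ofReal_lt_top,
      ENNReal.mul_lt_top hB1 ENNReal.ofReal_lt_top⟩
  have hone : ∫⁻ p in triangle Real.pi, exitFactor u (some 1) p < ∞ := by
    rw [setLIntegral_triangle (measurable_exitFactor u _)]
    refine lt_of_le_of_lt (setLIntegral_mono' measurableSet_Ioo fun s hs => ?_) hAB
    refine (setLIntegral_mono' measurableSet_Ioo fun b hb => ?_).trans
      (lintegral_mono_set (Ioo_subset_Ioo_right hs.2.le))
    rw [exitFactor_one u ⟨hb.1, by simpa using hb.2, by simpa using hs.2⟩, add_sub_cancel,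
      ← ENNReal.ofReal_add (Real.rpow_nonneg (Real.sin_pos_of_pos_of_lt_pi hs.1 hs.2).le _)
        (Real.rpow_nonneg (Real.sin_pos_of_pos_of_lt_pi hb.1 (hb.2.trans hs.2)).le _)]
    refine ENNReal.ofReal_le_ofReal ?_
    have h1 := (Real.sin_pos_of_pos_of_lt_pi hs.1 hs.2).le
    have h2 := (Real.sin_pos_of_pos_of_lt_pi hb.1 (hb.2.trans hs.2)).le
    have h3 := Real.rpow_nonneg h1 (2 * u)
    have h4 := Real.rpow_nonneg h2 (-(2 * u))
    rcases le_total 0 u with h0 | h0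
    · have := Real.rpow_le_one h1 (Real.sin_le_one s) (by linarith : 0 ≤ 2 * u)
      nlinarith
    · have := Real.rpow_le_one h2 (Real.sin_le_one b) (by linarith : 0 ≤ -(2 * u))
      nlinarith
  match i with
  | none =>
    simp only [exitFactor, setLIntegral_one]
    refine lt_of_le_of_lt (measure_mono (t := Icc 0 Real.pi ×ˢ Icc 0 Real.pi) fun p hp => ?_)
      (isCompact_Icc.prod isCompact_Icc).measure_lt_top
    exact ⟨⟨hp.1.le, by linarith [hp.2.1, hp.2.2]⟩, ⟨hp.2.1.le, by linarith [hp.1, hp.2.2]⟩⟩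
  | some 0 => exact absurd rfl hi
  | some 1 => exact hone
  | some 2 =>
    rw [← setLIntegral_triangle_swap]
    simpa only [exitFactor_swap] using hone

theorem exitEdge_ne_zero : ∀ {t : BinaryTree Unit} (x : Leaf t) (v : Vertex t),
    exitEdge x v ≠ some 0
  | _, .inLeft _, .top => by simp [exitEdge]
  | _, .inLeft x, .inLeft v => by simpa [exitEdge] using exitEdge_ne_zero x v
  | _, .inLeft _, .inRight _ => by simp [exitEdge]
  | _, .inRight _, .top => by simp [exitEdge]
  | _, .inRight _, .inLeft _ => by simp [exitEdge]
  | _, .inRight x, .inRight v => by simpa [exitEdge] using exitEdge_ne_zero x v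

/-- The weight of a tree with a marked exit leaf. -/
def leafWeight (u : ℝ) {t : BinaryTree Unit} (x : Leaf t) : ℝ → ℝ≥0∞ :=
  weight t fun v => exitFactor u (exitEdge x v)

/-- The weight of a tree without exit leaf. -/
def freeWeight (t : BinaryTree Unit) : ℝ → ℝ≥0∞ := weight t fun _ _ => 1

theorem leafWeight_lt_top {u : ℝ} (hu : |u| < 1 / 2) {t : BinaryTree Unit} (x : Leaf t) :
    leafWeight u x Real.pi < ∞ :=
  weight_lt_top (fun _ => measurable_exitFactor u _) fun v =>
    lintegral_exitFactor_lt_top hu (exitEdge_ne_zero x v)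

theorem freeWeight_lt_top (t : BinaryTree Unit) : freeWeight t Real.pi < ∞ :=
  weight_lt_top (fun _ => measurable_const) fun _ =>
    lintegral_exitFactor_lt_top (u := 0) (i := none) (by norm_num) (by simp)

theorem leafWeight_inLeft (u : ℝ) {a : Unit} {l r : BinaryTree Unit} (x : Leaf l) {α : ℝ}
    (hα : α ≤ Real.pi) : leafWeight u (t := .node a l r) (.inLeft x) α =
      2 * ∫⁻ p in triangle α, exitFactor u (some 1) p *
        (leafWeight u x p.1 * freeWeight r p.2) :=
  weight_node (fun _ => measurable_exitFactor u _) hα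

theorem leafWeight_inRight (u : ℝ) {a : Unit} {l r : BinaryTree Unit} (x : Leaf r) {α : ℝ}
    (hα : α ≤ Real.pi) : leafWeight u (t := .node a l r) (.inRight x) α =
      2 * ∫⁻ p in triangle α, exitFactor u (some 2) p *
        (freeWeight l p.1 * leafWeight u x p.2) :=
  weight_node (fun _ => measurable_exitFactor u _) hα

theorem freeWeight_node {a : Unit} {l r : BinaryTree Unit} {α : ℝ} (hα : α ≤ Real.pi) :
    freeWeight (.node a l r) α =
      2 * ∫⁻ p in triangle α, freeWeight l p.1 * freeWeight r p.2 := by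
  refine (weight_node (fun _ => measurable_const) hα).trans ?_
  simp only [one_mul]
  rfl

/-- The sum of the weights of the trees of given size with a marked exit leaf. -/
def pathSum (u : ℝ) (n : ℕ) (α : ℝ) : ℝ≥0∞ :=
  ∑ t ∈ BinaryTree.treesOfNumNodesEq n, ∑ x : Leaf t, leafWeight u x α

/-- The sum of the weights of the trees of given size without exit leaf. -/
def freeSum (n : ℕ) (α : ℝ) : ℝ≥0∞ := ∑ t ∈ BinaryTree.treesOfNumNodesEq n, freeWeight t α

theorem measurable_leafWeight (u : ℝ) {t : BinaryTree Unit} (x : Leaf t) :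
    Measurable (leafWeight u x) := measurable_weight _ _

theorem measurable_freeWeight (t : BinaryTree Unit) : Measurable (freeWeight t) :=
  measurable_weight _ _

theorem measurable_pathSum (u : ℝ) (n : ℕ) : Measurable (pathSum u n) :=
  Finset.measurable_sum _ fun _ _ => Finset.measurable_sum _ fun _ _ => measurable_leafWeight u _

theorem measurable_freeSum (n : ℕ) : Measurable (freeSum n) :=
  Finset.measurable_sum _ fun _ _ => measurable_freeWeight _

theorem pathSum_lt_top {u : ℝ} (hu : |u| < 1 / 2) (n : ℕ) {α : ℝ} (hα : α ≤ Real.pi) :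
    pathSum u n α < ∞ :=
  ENNReal.sum_lt_top.2 fun _ _ => ENNReal.sum_lt_top.2 fun x _ =>
    (weight_mono _ _ hα).trans_lt (leafWeight_lt_top hu x)

theorem freeSum_lt_top (n : ℕ) {α : ℝ} (hα : α ≤ Real.pi) : freeSum n α < ∞ :=
  ENNReal.sum_lt_top.2 fun t _ => (weight_mono _ _ hα).trans_lt (freeWeight_lt_top t)

theorem pathSum_zero (u α : ℝ) : pathSum u 0 α = 1 := by
  have : (Finset.univ : Finset (Leaf .nil)) = {.here} := rfl
  simp only [pathSum, BinaryTree.treesOfNumNodesEq_zero, Finset.sum_singleton, this]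
  exact weight_nil _ _

theorem freeSum_zero (α : ℝ) : freeSum 0 α = 1 := by
  simp only [freeSum, BinaryTree.treesOfNumNodesEq_zero, Finset.sum_singleton]
  exact weight_nil _ _

theorem freeSum_succ (n : ℕ) {α : ℝ} (hα : α ≤ Real.pi) :
    freeSum (n + 1) α = 2 * ∑ p ∈ Finset.HasAntidiagonal.antidiagonal n,
      ∫⁻ q in triangle α, freeSum p.1 q.2 * freeSum p.2 q.1 := by
  rw [freeSum, sum_treesOfNumNodesEq_succ, ← Finset.Nat.sum_antidiagonal_swap, Finset.mul_sum]
  refine Finset.sum_congr rfl fun p _ => ?_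
  simp only [freeWeight_node hα, freeSum, Finset.sum_mul_sum, Prod.fst_swap, Prod.snd_swap]
  rw [lintegral_finsetSum, Finset.sum_comm, Finset.mul_sum]
  · refine Finset.sum_congr rfl fun r _ => ?_
    rw [lintegral_finsetSum, Finset.mul_sum]
    · refine Finset.sum_congr rfl fun l _ => ?_
      simp only [mul_comm]
    · exact fun l _ => ((measurable_freeWeight _).comp measurable_snd).mul
        ((measurable_freeWeight _).comp measurable_fst)
  · exact fun r _ => Finset.measurable_sum _ fun l _ =>
      ((measurable_freeWeight _).comp measurable_snd).mul
        ((measurable_freeWeight _).comp measurable_fst)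

theorem pathSum_succ (u : ℝ) (n : ℕ) {α : ℝ} (hα : α ≤ Real.pi) :
    pathSum u (n + 1) α = 4 * ∑ p ∈ Finset.HasAntidiagonal.antidiagonal n,
      ∫⁻ q in triangle α, exitFactor u (some 1) q * (freeSum p.1 q.2 * pathSum u p.2 q.1) := by
  have hm : ∀ (t t' : BinaryTree Unit) (x : Leaf t'), Measurable fun q : ℝ × ℝ =>
      exitFactor u (some 1) q * (freeWeight t q.2 * leafWeight u x q.1) := fun t t' x =>
    (measurable_exitFactor u _).mul (((measurable_freeWeight t).comp measurable_snd).mul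
      ((measurable_leafWeight u x).comp measurable_fst))
  have hsum : ∀ p : ℕ × ℕ, ∫⁻ q in triangle α,
      exitFactor u (some 1) q * (freeSum p.1 q.2 * pathSum u p.2 q.1) =
      ∑ t ∈ BinaryTree.treesOfNumNodesEq p.1, ∑ t' ∈ BinaryTree.treesOfNumNodesEq p.2,
        ∑ x : Leaf t', ∫⁻ q in triangle α,
          exitFactor u (some 1) q * (freeWeight t q.2 * leafWeight u x q.1) := fun p => by
    simp only [freeSum, pathSum, Finset.sum_mul_sum]
    simp only [Finset.mul_sum]
    rw [lintegral_finsetSum _ fun t _ => Finset.measurable_sum _ fun t' _ =>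
      Finset.measurable_sum _ fun x _ => hm t t' x]
    refine Finset.sum_congr rfl fun t _ => ?_
    rw [lintegral_finsetSum _ fun t' _ => Finset.measurable_sum _ fun x _ => hm t t' x]
    refine Finset.sum_congr rfl fun t' _ => ?_
    rw [lintegral_finsetSum _ fun x _ => hm t t' x]
  have hleft : ∀ {l r : BinaryTree Unit} (x : Leaf l),
      leafWeight u (t := .node () l r) (.inLeft x) α = 2 * ∫⁻ q in triangle α,
        exitFactor u (some 1) q * (freeWeight r q.2 * leafWeight u x q.1) := fun x => by
    rw [leafWeight_inLeft u x hα]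
    simp only [mul_comm (leafWeight u x _)]
  have hright : ∀ {l r : BinaryTree Unit} (x : Leaf r),
      leafWeight u (t := .node () l r) (.inRight x) α = 2 * ∫⁻ q in triangle α,
        exitFactor u (some 1) q * (freeWeight l q.2 * leafWeight u x q.1) := fun x => by
    rw [leafWeight_inRight u x hα, ← setLIntegral_triangle_swap]
    simp only [exitFactor_swap, Prod.fst_swap, Prod.snd_swap]
  have hnode : ∀ l r : BinaryTree Unit,
      ∑ x : Leaf (.node () l r), leafWeight u x α =
        ∑ x : Leaf l, leafWeight u (t := .node () l r) (.inLeft x) α +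
        ∑ x : Leaf r, leafWeight u (t := .node () l r) (.inRight x) α := fun l r => by
    rw [← (Leaf.nodeEquiv () l r).symm.sum_comp, Fintype.sum_sum_type]
    rfl
  rw [pathSum, sum_treesOfNumNodesEq_succ]
  simp only [hnode, hleft, hright, Finset.sum_add_distrib]
  simp only [hsum]
  rw [← Finset.Nat.sum_antidiagonal_swap]
  simp only [Prod.fst_swap, Prod.snd_swap, ← Finset.mul_sum]
  have hc : ∀ p : ℕ × ℕ, ∑ l ∈ BinaryTree.treesOfNumNodesEq p.2,
      ∑ r ∈ BinaryTree.treesOfNumNodesEq p.1, ∑ x : Leaf l, ∫⁻ q in triangle α,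
        exitFactor u (some 1) q * (freeWeight r q.2 * leafWeight u x q.1) =
      ∑ r ∈ BinaryTree.treesOfNumNodesEq p.1, ∑ l ∈ BinaryTree.treesOfNumNodesEq p.2,
        ∑ x : Leaf l, ∫⁻ q in triangle α,
        exitFactor u (some 1) q * (freeWeight r q.2 * leafWeight u x q.1) := fun p =>
    Finset.sum_comm
  simp only [hc]
  rw [← add_mul]
  norm_num

/-! ### The generating functions of the trees -/

open scoped ENNReal

theorem integral_congr_Ioo {f g : ℝ → ℝ} {a b : ℝ} (hab : a ≤ b) (h : EqOn f g (Ioo a b)) :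
    ∫ x in a..b, f x = ∫ x in a..b, g x := by
  rw [intervalIntegral.integral_of_le hab, intervalIntegral.integral_of_le hab,
    integral_Ioc_eq_integral_Ioo, integral_Ioc_eq_integral_Ioo]
  exact setIntegral_congr_fun measurableSet_Ioo h

open ConvFun ConvSeries in
theorem besselY_succ (n : ℕ) :
    besselY (n + 1) = -((2 : ℂ) • (const * seqMul besselY besselY n)) := by
  have h : 2 * PowerSeries.X * z * ofSeq besselY ^ 2 =
      algebraMap ℂ ConvSeries 2 * (PowerSeries.X * (z * (ofSeq besselY * ofSeq besselY))) := by
    rw [map_ofNat]; ring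
  have h2 := ofSeq_besselY
  rw [h, ofSeq_mul, z_mul_ofSeq, X_mul_ofSeq, algebraMap_mul_ofSeq, z_eq, ofSeq_sub] at h2
  have h3 := congrFun (ofSeq_injective h2) (n + 1)
  simpa [shift] using h3

open ConvFun ConvSeries in
theorem besselFun_succ (n : ℕ) {x : ℝ} (hx : x ∈ Ico 0 Real.pi) :
    besselFun (n + 1) x = -2 * ∫ s in (0 : ℝ)..x,
      ∑ p ∈ Finset.HasAntidiagonal.antidiagonal n,
        ∫ b in (0 : ℝ)..s, besselFun p.1 (s - b) * besselFun p.2 b := by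
  have hc : ∀ m, ∀ y ∈ Ico 0 Real.pi, besselY m y = besselFun m y := fun m y hy => by
    rw [besselY_apply m hy, besselFun]
    push_cast
    rfl
  have h := congrArg (fun f : ConvFun => f x) (besselY_succ n)
  simp only [ConvFun.neg_apply, ConvFun.smul_apply] at h
  rw [const_mul_apply _ hx, hc _ _ hx] at h
  have hs : ∫ s in (0 : ℝ)..x, seqMul besselY besselY n s =
      ∫ s in (0 : ℝ)..x, ((∑ p ∈ Finset.HasAntidiagonal.antidiagonal n,
        ∫ b in (0 : ℝ)..s, besselFun p.1 (s - b) * besselFun p.2 b : ℝ) : ℂ) := by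
    refine intervalIntegral.integral_congr fun s hs => ?_
    rw [uIcc_of_le hx.1] at hs
    have hs' : s ∈ Ico 0 Real.pi := ⟨hs.1, hs.2.trans_lt hx.2⟩
    simp only [seqMul, ConvFun.sum_apply, Complex.ofReal_sum]
    refine Finset.sum_congr rfl fun p _ => ?_
    rw [mul_apply _ _ hs', ← intervalIntegral.integral_ofReal]
    refine intervalIntegral.integral_congr fun b hb => ?_
    rw [uIcc_of_le hs.1] at hb
    rw [hc _ _ ⟨by linarith [hb.2], by linarith [hb.1, hs'.2]⟩,
      hc _ _ ⟨hb.1, hb.2.trans_lt hs'.2⟩]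
    push_cast
    rfl
  rw [hs, intervalIntegral.integral_ofReal] at h
  have h' : (besselFun (n + 1) x : ℂ) = ((-2 * ∫ s in (0 : ℝ)..x,
      ∑ p ∈ Finset.HasAntidiagonal.antidiagonal n,
        ∫ b in (0 : ℝ)..s, besselFun p.1 (s - b) * besselFun p.2 b : ℝ) : ℂ) := by
    rw [h]
    push_cast
    ring
  exact_mod_cast h'

theorem toReal_freeSum (n : ℕ) : ∀ {α : ℝ}, α ∈ Ico 0 Real.pi →
    (freeSum n α).toReal = (-1) ^ n * besselFun n α := by
  induction n using Nat.strong_induction_on with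
  | _ n ih =>
    intro α hα
    cases n with
    | zero => simp [freeSum_zero, besselFun]
    | succ n =>
      have hfin := freeSum_lt_top (n + 1) hα.2.le
      have hfin' : ∀ p ∈ Finset.HasAntidiagonal.antidiagonal n,
          ∫⁻ q in triangle α, freeSum p.1 q.2 * freeSum p.2 q.1 ≠ ∞ := by
        rw [freeSum_succ n hα.2.le] at hfin
        exact fun p hp => (ENNReal.sum_lt_top.1 (ENNReal.lt_top_of_mul_ne_top_right hfin.ne
          (by simp)) p hp).ne
      have hK : ∀ p : ℕ × ℕ, Measurable fun q : ℝ × ℝ => freeSum p.1 q.2 * freeSum p.2 q.1 :=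
        fun p => ((measurable_freeSum _).comp measurable_snd).mul
          ((measurable_freeSum _).comp measurable_fst)
      have hp' : ∀ p ∈ Finset.HasAntidiagonal.antidiagonal n, ∀ s ∈ Icc 0 α,
          ∫ b in (0 : ℝ)..s, (freeSum p.1 (s - b) * freeSum p.2 b).toReal =
          (-1) ^ n * ∫ b in (0 : ℝ)..s, besselFun p.1 (s - b) * besselFun p.2 b :=
        fun p hp s hs => by
        rw [Finset.HasAntidiagonal.mem_antidiagonal] at hp
        rw [← intervalIntegral.integral_const_mul]
        refine intervalIntegral.integral_congr fun b hb => ?_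
        rw [uIcc_of_le hs.1] at hb
        rw [ENNReal.toReal_mul, ih p.1 (by omega) ⟨by linarith [hb.2], by linarith [hb.1, hs.2, hα.2]⟩,
          ih p.2 (by omega) ⟨hb.1, by linarith [hb.2, hs.2, hα.2]⟩, ← hp, pow_add]
        ring
      rw [freeSum_succ n hα.2.le, ENNReal.toReal_mul, ENNReal.toReal_sum hfin',
        besselFun_succ n hα, pow_succ, mul_assoc, neg_one_mul, ← neg_mul, neg_neg,
        mul_left_comm, ← intervalIntegral.integral_const_mul,
        Finset.sum_congr rfl fun p hp =>
          (toReal_setLIntegral_triangle (hK p) hα.1 (hfin' p hp)).2,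
        ← intervalIntegral.integral_finsetSum fun p hp =>
          (toReal_setLIntegral_triangle (hK p) hα.1 (hfin' p hp)).1]
      congr 1
      refine intervalIntegral.integral_congr fun s hs => ?_
      rw [uIcc_of_le hα.1] at hs
      simp only
      rw [Finset.mul_sum]
      exact Finset.sum_congr rfl fun p hp => hp' p hp s hs

/-- The signed generating function of the trees with a marked exit leaf. -/
def pathFun (u : ℝ) (n : ℕ) (α : ℝ) : ℝ := (-1) ^ n * (pathSum u n α).toReal

theorem pathFun_succ {u : ℝ} (hu : |u| < 1 / 2) (n : ℕ) : ∃ G : ℕ × ℕ → ℝ → ℝ,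
    (∀ p ∈ Finset.HasAntidiagonal.antidiagonal n, IntervalIntegrable (G p) volume 0 Real.pi) ∧
    (∀ p ∈ Finset.HasAntidiagonal.antidiagonal n, ∀ s ∈ Ioo 0 Real.pi,
      G p s = (-1) ^ n * (Real.sin s ^ (2 * u) * ∫ b in (0 : ℝ)..s, besselFun p.1 (s - b) *
        (Real.sin b ^ (-(2 * u)) * pathFun u p.2 b))) ∧
    ∀ x ∈ Icc 0 Real.pi, pathFun u (n + 1) x =
      (-1) ^ (n + 1) * 4 * ∑ p ∈ Finset.HasAntidiagonal.antidiagonal n, ∫ s in (0 : ℝ)..x, G p s := by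
  have hfin : ∀ α ≤ Real.pi, ∀ p ∈ Finset.HasAntidiagonal.antidiagonal n,
      ∫⁻ q in triangle α, exitFactor u (some 1) q * (freeSum p.1 q.2 * pathSum u p.2 q.1) ≠ ∞ := by
    intro α hα
    have hfin := pathSum_lt_top hu (n + 1) hα
    rw [pathSum_succ u n hα] at hfin
    exact fun p hp => (ENNReal.sum_lt_top.1 (ENNReal.lt_top_of_mul_ne_top_right hfin.ne
      (by simp)) p hp).ne
  have hK : ∀ p : ℕ × ℕ, Measurable fun q : ℝ × ℝ =>
      exitFactor u (some 1) q * (freeSum p.1 q.2 * pathSum u p.2 q.1) :=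
    fun p => (measurable_exitFactor u _).mul (((measurable_freeSum _).comp measurable_snd).mul
      ((measurable_pathSum u _).comp measurable_fst))
  refine ⟨fun p s => ∫ b in (0 : ℝ)..s, (exitFactor u (some 1) (b, s - b) *
    (freeSum p.1 (s - b) * pathSum u p.2 b)).toReal, fun p hp =>
      (toReal_setLIntegral_triangle (hK p) Real.pi_pos.le (hfin _ le_rfl p hp)).1,
      fun p hp s hs => ?_, fun x hx => ?_⟩
  · rw [Finset.HasAntidiagonal.mem_antidiagonal] at hp
    rw [← intervalIntegral.integral_const_mul, ← intervalIntegral.integral_const_mul]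
    refine integral_congr_Ioo hs.1.le fun b hb => ?_
    have h1 := Real.rpow_nonneg (Real.sin_pos_of_pos_of_lt_pi hs.1 hs.2).le (2 * u)
    have h2 := Real.rpow_nonneg (Real.sin_pos_of_pos_of_lt_pi hb.1 (hb.2.trans hs.2)).le (-(2 * u))
    rw [exitFactor_one u ⟨hb.1, by simpa using hb.2, by simpa using hs.2⟩, ENNReal.toReal_mul,
      ENNReal.toReal_mul, toReal_freeSum p.1 ⟨by linarith [hb.2], by linarith [hb.1, hs.2]⟩,
      add_sub_cancel, ENNReal.toReal_ofReal (mul_nonneg h1 h2), pathFun, ← hp, pow_add]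
    have h3 : ((-1 : ℝ) ^ p.2) * (-1) ^ p.2 = 1 := by rw [← mul_pow]; simp
    linear_combination (-((-1) ^ p.1 * Real.sin s ^ (2 * u) * besselFun p.1 (s - b) *
      Real.sin b ^ (-(2 * u)) * (pathSum u p.2 b).toReal)) * h3
  · rw [pathFun, pathSum_succ u n hx.2, ENNReal.toReal_mul, ENNReal.toReal_sum (hfin x hx.2),
      Finset.sum_congr rfl fun p hp =>
        (toReal_setLIntegral_triangle (hK p) hx.1 (hfin x hx.2 p hp)).2, mul_assoc]
    rfl

theorem isPathSolution_pathFun {u : ℝ} (hu : |u| < 1 / 2) : IsPathSolution u (pathFun u) where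
  cont n := by
    cases n with
    | zero => exact (continuousOn_const (c := (1 : ℝ))).congr fun x _ => by simp [pathFun, pathSum_zero]
    | succ n =>
      obtain ⟨G, h1, -, h3⟩ := pathFun_succ hu n
      refine ContinuousOn.congr ?_ h3
      refine continuousOn_const.mul (continuousOn_finsetSum _ fun p hp => ?_)
      have := intervalIntegral.continuousOn_primitive_interval (f := G p) (a := 0) (b := Real.pi)
        (μ := volume) (by
          rw [uIcc_of_le Real.pi_pos.le]
          exact (intervalIntegrable_iff_integrableOn_Icc_of_le Real.pi_pos.le).1 (h1 p hp))
      rwa [uIcc_of_le Real.pi_pos.le] at this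
  zero x _ := by simp [pathFun, pathSum_zero]
  succ n x hx := by
    obtain ⟨G, h1, h2, h3⟩ := pathFun_succ hu n
    rw [h3 x hx, ← intervalIntegral.integral_finsetSum fun p hp => (h1 p hp).mono_set (by
      rw [uIcc_of_le Real.pi_pos.le, uIcc_of_le hx.1]; exact Icc_subset_Icc_right hx.2)]
    have h4 : ∫ s in (0 : ℝ)..x, ∑ p ∈ Finset.HasAntidiagonal.antidiagonal n, G p s =
        (-1) ^ n * ∫ s in (0 : ℝ)..x, Real.sin s ^ (2 * u) * innerConv u (pathFun u) n s := by
      rw [← intervalIntegral.integral_const_mul]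
      refine integral_congr_Ioo hx.1 fun s hs => ?_
      rw [innerConv, Finset.mul_sum, Finset.mul_sum]
      exact Finset.sum_congr rfl fun p hp => h2 p hp s ⟨hs.1, hs.2.trans_le hx.2⟩
    have h5 : ((-1 : ℝ) ^ n) * (-1) ^ n = 1 := by rw [← mul_pow]; simp
    rw [h4, pow_succ]
    linear_combination (-4 * ∫ s in (0 : ℝ)..x, Real.sin s ^ (2 * u) *
      innerConv u (pathFun u) n s) * h5

/-! ### The weights of the trees as integrals -/

theorem measurable_anglesOfPair (t : BinaryTree Unit) : Measurable (anglesOfPair t) := by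
  refine measurable_pi_lambda _ fun v => measurable_pi_lambda _ fun i => ?_
  fin_cases i
  · change Measurable fun y : Vertex t → ℝ × ℝ => Real.pi - (y v).1 - (y v).2
    fun_prop
  · change Measurable fun y : Vertex t → ℝ × ℝ => (y v).1
    fun_prop
  · change Measurable fun y : Vertex t → ℝ × ℝ => (y v).2
    fun_prop

theorem measurableSet_polytope (t : BinaryTree Unit) : MeasurableSet (polytope t) := by
  have e : polytope t = (⋂ v, ⋂ i, {φ : Vertex t → Fin 3 → ℝ | 0 < φ v i}) ∩
      ((⋂ v, {φ : Vertex t → Fin 3 → ℝ | φ v 0 + φ v 1 + φ v 2 = Real.pi}) ∩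
      ⋂ v, ⋂ i, ⋂ w, ⋂ _ : IsInnerEdge v i w,
        {φ : Vertex t → Fin 3 → ℝ | Real.pi < φ v i + φ w 0}) := by
    ext y
    simp [polytope]
  rw [e]
  refine .inter (.iInter fun v => .iInter fun i => measurableSet_lt (by fun_prop) (by fun_prop))
    (.inter (.iInter fun v => measurableSet_eq_fun (by fun_prop) (by fun_prop))
      (.iInter fun v => .iInter fun i => .iInter fun w => .iInter fun _ =>
        measurableSet_lt (by fun_prop) (by fun_prop)))

theorem measurable_distDiff {t : BinaryTree Unit} (x : Leaf t) : Measurable (distDiff x) := by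
  refine Finset.measurable_sum _ fun v _ => ?_
  cases exitEdge x v with
  | none => exact measurable_const
  | some i =>
    exact (Real.measurable_log.comp (Real.measurable_sin.comp (by fun_prop))).sub
      (Real.measurable_log.comp (Real.measurable_sin.comp (by fun_prop)))

theorem lintegral_exp_distDiff {t : BinaryTree Unit} (x : Leaf t) (u : ℝ) :
    ∫⁻ φ in polytope t, ENNReal.ofReal (Real.exp (2 * u * distDiff x φ)) ∂(vol t) =
      leafWeight u x Real.pi := by
  have hm : Measurable fun φ => ENNReal.ofReal (Real.exp (2 * u * distDiff x φ)) :=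
    ENNReal.measurable_ofReal.comp
      (Real.measurable_exp.comp ((measurable_distDiff x).const_mul _))
  have hpre : anglesOfPair t ⁻¹' polytope t = pairSet t Real.pi :=
    Set.ext fun y => anglesOfPair_mem_polytope t y
  rw [vol, Measure.restrict_smul, lintegral_smul_measure, smul_eq_mul,
    setLIntegral_map (measurableSet_polytope t) hm (measurable_anglesOfPair t), hpre, leafWeight,
    weight]
  congr 1
  refine lintegral_congr fun y => ?_
  rw [distDiff, Finset.mul_sum, Real.exp_sum, ENNReal.ofReal_prod_of_nonneg fun _ _ =>
    (Real.exp_pos _).le]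
  refine Finset.prod_congr rfl fun v _ => ?_
  cases exitEdge x v with
  | none => simp [exitFactor]
  | some i => rfl

theorem integrableOn_exp_distDiff {t : BinaryTree Unit} (x : Leaf t) {u : ℝ} (hu : |u| < 1 / 2) :
    IntegrableOn (fun φ => Real.exp (2 * u * distDiff x φ)) (polytope t) (vol t) := by
  refine ⟨(Real.measurable_exp.comp
    ((measurable_distDiff x).const_mul _)).aestronglyMeasurable, ?_⟩
  rw [hasFiniteIntegral_iff_ofReal (ae_of_all _ fun φ => (Real.exp_pos _).le),
    lintegral_exp_distDiff]
  exact leafWeight_lt_top hu x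

theorem treeWeight_eq {t : BinaryTree Unit} (x : Leaf t) (u : ℝ) :
    treeWeight x u = (leafWeight u x Real.pi).toReal := by
  rw [treeWeight, integral_eq_lintegral_of_nonneg_ae (ae_of_all _ fun φ => (Real.exp_pos _).le)
    (Real.measurable_exp.comp ((measurable_distDiff x).const_mul _)).aestronglyMeasurable,
    lintegral_exp_distDiff]

theorem sum_treeWeight {u : ℝ} (hu : |u| < 1 / 2) (n : ℕ) :
    ∑ t ∈ BinaryTree.treesOfNumNodesEq n, ∑ x : Leaf t, treeWeight x u =
      (pathSum u n Real.pi).toReal := by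
  simp only [pathSum, treeWeight_eq]
  rw [ENNReal.toReal_sum fun t _ => (ENNReal.sum_lt_top.2 fun x _ => leafWeight_lt_top hu x).ne]
  refine Finset.sum_congr rfl fun t _ => ?_
  rw [ENNReal.toReal_sum fun x _ => (leafWeight_lt_top hu x).ne]

theorem analyticAt_treeWeight {t : BinaryTree Unit} (x : Leaf t) {u : ℝ} (hu : |u| < 1 / 2) :
    AnalyticAt ℝ (treeWeight x) u := by
  have hu' := abs_lt.1 hu
  have h : u ∈ interior (ProbabilityTheory.integrableExpSet (fun φ => 2 * distDiff x φ)
      ((vol t).restrict (polytope t))) := by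
    refine mem_interior.2 ⟨Ioo (-(1 / 2)) (1 / 2), fun v hv => ?_, isOpen_Ioo, hu'⟩
    have := integrableOn_exp_distDiff x (abs_lt.2 hv)
    refine (integrable_congr (ae_of_all _ fun φ => ?_)).1 this
    simp only
    congr 1
    ring
  have e : treeWeight x = ProbabilityTheory.mgf (fun φ => 2 * distDiff x φ)
      ((vol t).restrict (polytope t)) := by
    funext v
    refine integral_congr_ae (ae_of_all _ fun φ => ?_)
    simp only
    congr 1
    ring
  rw [e]
  exact ProbabilityTheory.analyticAt_mgf h

/-! ### The values at `π` -/

theorem ExpDecay.analyticAt {a : ℕ → ℝ} (ha : ExpDecay a) (x : ℝ) :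
    AnalyticAt ℝ (parSeries a 0) x := by
  obtain ⟨K, C, hC, h⟩ := ha
  have hr : (FormalMultilinearSeries.ofScalars ℝ a).radius = ⊤ := by
    refine FormalMultilinearSeries.radius_eq_top_of_summable_norm _ fun r => ?_
    refine Summable.of_nonneg_of_le (fun n => by positivity) (fun n => ?_)
      ((Real.summable_pow_div_factorial (C * r)).mul_left K)
    rw [FormalMultilinearSeries.ofScalars_norm, mul_pow, mul_div_right_comm, ← mul_assoc]
    exact mul_le_mul_of_nonneg_right (h n) (by positivity)
  have hs := (FormalMultilinearSeries.ofScalars ℝ a).hasFPowerSeriesOnBall (by simp [hr])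
  have h1 : AnalyticAt ℝ (FormalMultilinearSeries.ofScalars ℝ a).sum (x ^ 2) :=
    hs.analyticAt_of_mem (by simp [hr])
  have h2 : AnalyticAt ℝ (fun y : ℝ => y ^ 2) x := by fun_prop
  have e : parSeries a 0 = (FormalMultilinearSeries.ofScalars ℝ a).sum ∘ fun y : ℝ => y ^ 2 := by
    funext y
    simp only [parSeries, FormalMultilinearSeries.sum, Function.comp,
      FormalMultilinearSeries.ofScalars_apply_eq, smul_eq_mul, add_zero, pow_mul]
  rw [e]
  exact AnalyticAt.comp (f := fun y : ℝ => y ^ 2) h1 h2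

/-- The coefficients in `u ^ 2` of the coefficients in `r` of the sum over `p`. -/
def valueCoef (n p : ℕ) : ℝ :=
  (-(2 * Real.pi ^ 2)) ^ (n + p) /
    ((n + p).factorial * n.factorial * (2 * p + 1).doubleFactorial)

theorem expDecay_valueCoef (n : ℕ) : ExpDecay (valueCoef n) := by
  refine ⟨(2 * Real.pi ^ 2) ^ n, 2 * Real.pi ^ 2, by positivity, fun p => ?_⟩
  have h1 : (p.factorial : ℝ) ≤
      ((n + p).factorial * n.factorial * (2 * p + 1).doubleFactorial : ℝ) := by
    have h2 : p.factorial ≤ (n + p).factorial := Nat.factorial_le (by omega)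
    have : p.factorial ≤ (n + p).factorial * n.factorial * (2 * p + 1).doubleFactorial :=
      h2.trans ((Nat.le_mul_of_pos_right _ n.factorial_pos).trans
        (Nat.le_mul_of_pos_right _ (Nat.doubleFactorial_pos _)))
    exact_mod_cast this
  rw [valueCoef, abs_div, abs_pow, abs_neg, abs_of_nonneg (by positivity : 0 ≤ 2 * Real.pi ^ 2),
    abs_of_nonneg (by positivity : (0 : ℝ) ≤ ((n + p).factorial * n.factorial *
      (2 * p + 1).doubleFactorial : ℝ)), pow_add, mul_div_assoc']
  exact div_le_div_of_nonneg_left (by positivity) (by positivity) h1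

theorem parSeries_atanCoef_pi (u : ℝ) (n : ℕ) :
    parSeries (atanCoef u n) (2 * n + 1) Real.pi =
      2 * Real.pi * u * parSeries (valueCoef n) 0 u := by
  rw [parSeries, parSeries, ← tsum_mul_left]
  refine tsum_congr fun p => ?_
  rw [atanCoef, valueCoef, ← neg_mul, mul_pow, ← pow_mul]
  ring

theorem parSeries_valueCoef_zero (u : ℝ) :
    2 * Real.pi * u * parSeries (valueCoef 0) 0 u = Real.sin (2 * Real.pi * u) := by
  rw [← (Real.hasSum_sin (2 * Real.pi * u)).tsum_eq, parSeries, ← tsum_mul_left]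
  refine tsum_congr fun p => ?_
  rw [valueCoef, Nat.factorial_eq_mul_doubleFactorial, Nat.doubleFactorial_two_mul]
  have h1 : (p.factorial : ℝ) ≠ 0 := by exact_mod_cast p.factorial_ne_zero
  have h2 : ((2 * p + 1).doubleFactorial : ℝ) ≠ 0 := by
    exact_mod_cast (Nat.doubleFactorial_pos _).ne'
  rw [zero_add, Nat.factorial_zero, neg_eq_neg_one_mul, mul_pow, mul_pow, mul_pow, mul_pow]
  push_cast
  field_simp
  ring

theorem sinc_ne_zero_of_abs_lt {u : ℝ} (hu : |u| < 1 / 2) : Real.sinc (2 * Real.pi * u) ≠ 0 := by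
  have h : |2 * Real.pi * u| < Real.pi := by
    rw [abs_mul, abs_of_pos (by positivity)]
    nlinarith [Real.pi_pos]
  have h' := ConvSeries.sinc_ne_zero (x := |2 * Real.pi * u|) ⟨abs_nonneg _, h⟩
  rcases abs_choice (2 * Real.pi * u) with h0 | h0
  · rwa [h0] at h'
  · rwa [h0, Real.sinc_neg] at h'

/-- The sum of the weights of all trees of given size. -/
def totalWeight (n : ℕ) (u : ℝ) : ℝ :=
  ∑ t ∈ BinaryTree.treesOfNumNodesEq n, ∑ x : Leaf t, treeWeight x u

theorem analyticAt_totalWeight (n : ℕ) {u : ℝ} (hu : |u| < 1 / 2) :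
    AnalyticAt ℝ (totalWeight n) u := by
  refine Finset.analyticAt_fun_sum _ fun t _ => Finset.analyticAt_fun_sum _ fun x _ => ?_
  exact analyticAt_treeWeight x hu

theorem totalWeight_eq_of_neg (n : ℕ) {u : ℝ} (hu : u ∈ Ioo (-(1 / 2)) 0) :
    Real.sin (2 * Real.pi * u) * ((-1) ^ n * totalWeight n u) =
      2 * Real.pi * u * parSeries (valueCoef n) 0 u := by
  have hu' : |u| < 1 / 2 := abs_lt.2 ⟨hu.1, by linarith [hu.2]⟩
  have h := (isPathSolution_pathFun hu').apply_pi hu.2 hu.1 n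
  have h0 : parSeries (atanCoef u 0) 1 Real.pi = Real.sin (2 * Real.pi * u) := by
    rw [← parSeries_valueCoef_zero]
    exact parSeries_atanCoef_pi u 0
  rw [h0, parSeries_atanCoef_pi] at h
  rw [← h, pathFun, totalWeight, sum_treeWeight hu', mul_comm]

theorem totalWeight_eq (n : ℕ) {u : ℝ} (hu : |u| < 1 / 2) :
    Real.sinc (2 * Real.pi * u) * ((-1) ^ n * totalWeight n u) = parSeries (valueCoef n) 0 u := by
  have hmem : ∀ v ∈ Ioo (-(1 / 2) : ℝ) (1 / 2), |v| < 1 / 2 := fun v hv => abs_lt.2 hv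
  have hS := (expDecay_valueCoef n).analyticAt
  have hf : AnalyticOnNhd ℝ (fun v => Real.sin (2 * Real.pi * v) * ((-1) ^ n * totalWeight n v))
      (Ioo (-(1 / 2)) (1 / 2)) := fun v hv => by
    have h1 := analyticAt_totalWeight n (hmem v hv)
    have h2 : AnalyticAt ℝ (fun v => Real.sin (2 * Real.pi * v)) v :=
      Real.analyticAt_sin.comp (by fun_prop)
    exact h2.mul (analyticAt_const.mul h1)
  have hg : AnalyticOnNhd ℝ (fun v => 2 * Real.pi * v * parSeries (valueCoef n) 0 v)
      (Ioo (-(1 / 2)) (1 / 2)) := fun v _ => by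
    have h2 : AnalyticAt ℝ (fun v : ℝ => 2 * Real.pi * v) v := by fun_prop
    exact h2.mul (hS v)
  have heq := hf.eqOn_of_preconnected_of_eventuallyEq hg isPreconnected_Ioo
    (z₀ := -(1 / 4)) (by constructor <;> norm_num) (by
      filter_upwards [Ioo_mem_nhds (by norm_num : (-(1 / 2) : ℝ) < -(1 / 4))
        (by norm_num : (-(1 / 4) : ℝ) < 0)] with v hv using totalWeight_eq_of_neg n hv)
  have hne : ∀ v ∈ Ioo (-(1 / 2) : ℝ) (1 / 2), v ≠ 0 →
      Real.sinc (2 * Real.pi * v) * ((-1) ^ n * totalWeight n v) =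
        parSeries (valueCoef n) 0 v := fun v hv h0 => by
    have h1 : 2 * Real.pi * v ≠ 0 := by positivity
    have h2 := heq hv
    simp only at h2
    rw [← ConvSeries.mul_sinc, mul_assoc] at h2
    exact mul_left_cancel₀ h1 h2
  by_cases h0 : u = 0
  · subst h0
    have h1 : ContinuousAt (fun v => Real.sinc (2 * Real.pi * v) * ((-1) ^ n * totalWeight n v)) 0 := by
      have h2 := (analyticAt_totalWeight n hu).continuousAt
      have h3 : ContinuousAt (fun v => Real.sinc (2 * Real.pi * v)) 0 :=
        (Real.continuous_sinc.comp (by fun_prop)).continuousAt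
      exact h3.mul (continuousAt_const.mul h2)
    refine tendsto_nhds_unique_of_eventuallyEq (h1.tendsto.mono_left nhdsWithin_le_nhds)
      ((hS 0).continuousAt.tendsto.mono_left nhdsWithin_le_nhds) (l := 𝓝[≠] 0) ?_
    filter_upwards [nhdsWithin_le_nhds (Ioo_mem_nhds (by norm_num : (-(1 / 2) : ℝ) < 0)
      (by norm_num : (0 : ℝ) < 1 / 2)), self_mem_nhdsWithin] with v hv hv0
    exact hne v hv hv0
  · exact hne u (abs_lt.1 hu) h0

/-! ### The power series -/

theorem coeff_derivative_besselSeries (u : ℝ) (n p : ℕ) :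
    PowerSeries.coeff n (PowerSeries.C (u ^ (2 * p) / ((2 * p + 1).doubleFactorial : ℝ)) *
      (PowerSeries.derivative ℝ)^[p + 1] besselSeries) = valueCoef n p * u ^ (2 * p + 0) := by
  rw [PowerSeries.coeff_C_mul, PowerSeries.coeff_iterate_derivative, besselSeries,
    PowerSeries.coeff_mk, if_neg (by omega), valueCoef]
  have h := Nat.factorial_mul_ascFactorial n (p + 1)
  have h1 : ((n + 1).ascFactorial (p + 1) : ℝ) = (n + (p + 1)).factorial / n.factorial := by
    rw [← h]
    have : (n.factorial : ℝ) ≠ 0 := by exact_mod_cast n.factorial_ne_zero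
    push_cast
    field_simp
  have h2 : ((n + (p + 1)).factorial : ℝ) ≠ 0 := by exact_mod_cast (n + (p + 1)).factorial_ne_zero
  rw [h1, show n + (p + 1) - 1 = n + p by omega, neg_pow (2 * Real.pi ^ 2)]
  field_simp
  ring

theorem hasSum_coeff_derivative_besselSeries (u : ℝ) (n : ℕ) :
    HasSum (fun p => PowerSeries.coeff n
      (PowerSeries.C (u ^ (2 * p) / ((2 * p + 1).doubleFactorial : ℝ)) *
        (PowerSeries.derivative ℝ)^[p + 1] besselSeries)) (parSeries (valueCoef n) 0 u) := by
  simp only [coeff_derivative_besselSeries]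
  exact ((expDecay_valueCoef n).summable 0 u).hasSum

theorem hasSum_derivative_besselSeries (u : ℝ) :
    HasSum (fun p => PowerSeries.C (u ^ (2 * p) / ((2 * p + 1).doubleFactorial : ℝ)) *
        (PowerSeries.derivative ℝ)^[p + 1] besselSeries)
      (PowerSeries.mk fun n => parSeries (valueCoef n) 0 u) := by
  rw [PowerSeries.WithPiTopology.hasSum_iff_hasSum_coeff]
  intro n
  rw [PowerSeries.coeff_mk]
  exact hasSum_coeff_derivative_besselSeries u n

theorem XA_eq {u : ℝ} (hu : |u| < 1 / 2) :
    XA u = 1 - PowerSeries.C ((Real.sinc (2 * Real.pi * u))⁻¹) *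
      PowerSeries.mk fun n => parSeries (valueCoef n) 0 u := by
  have hs := sinc_ne_zero_of_abs_lt hu
  ext n
  rw [map_sub, PowerSeries.coeff_C_mul, PowerSeries.coeff_mk, XA, PowerSeries.coeff_mk,
    PowerSeries.coeff_one, ← totalWeight_eq n hu, inv_mul_cancel_left₀ hs]
  cases n with
  | zero =>
    have h : totalWeight 0 u = 1 := by
      rw [totalWeight, sum_treeWeight hu, pathSum_zero, ENNReal.toReal_one]
    simp [h]
  | succ n =>
    simp only [totalWeight, Nat.add_sub_cancel, if_neg n.succ_ne_zero, ← Finset.mul_sum]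
    ring

end AntiDelaunay

end

/-- For `|u| < 1/2`, the integrals `E_t(u)` converge and are analytic in `u`, and
`X̂_A(u, r) = 1 - (2πu / sin 2πu) ∑_p u^{2p} / (2p+1)!! ∂_r^{p+1} [√r / (√2 π) J_1(2π √(2r))]`
in `ℝ⟦r⟧`, the sum over `p` being coefficientwise convergent. -/
theorem mainTheorem9 (u : ℝ) (hu : |u| < 1 / 2) :
    (∀ (t : BinaryTree Unit) (x : AntiDelaunay.Leaf t),
      MeasureTheory.IntegrableOn (fun φ => Real.exp (2 * u * AntiDelaunay.distDiff x φ))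
        (AntiDelaunay.polytope t) (AntiDelaunay.vol t) ∧
      AnalyticAt ℝ (AntiDelaunay.treeWeight x) u) ∧
    Summable (fun p : ℕ =>
      PowerSeries.C (u ^ (2 * p) / ((2 * p + 1).doubleFactorial : ℝ)) *
        (PowerSeries.derivative ℝ)^[p + 1] AntiDelaunay.besselSeries) ∧
    AntiDelaunay.XA u =
      1 - PowerSeries.C ((Real.sinc (2 * Real.pi * u))⁻¹) *
        ∑' p : ℕ, PowerSeries.C (u ^ (2 * p) / ((2 * p + 1).doubleFactorial : ℝ)) *
          (PowerSeries.derivative ℝ)^[p + 1] AntiDelaunay.besselSeries := by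
  refine ⟨fun t x => ⟨AntiDelaunay.integrableOn_exp_distDiff x hu,
    AntiDelaunay.analyticAt_treeWeight x hu⟩,
    (AntiDelaunay.hasSum_derivative_besselSeries u).summable, ?_⟩
  rw [(AntiDelaunay.hasSum_derivative_besselSeries u).tsum_eq]
  exact AntiDelaunay.XA_eq hu
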